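/- Let $P_3$ denote the simple path with three edges (on four vertices). A $P_3$-matching of size $k$ in a finite simple graph $G$ is a collection of $k$ pairwise vertex-disjoint subgraphs of $G$ (not necessarily induced), each isomorphic to $P_3$. The problem $P_3$-Matching asks, given $(G,k)$ with parameter $k\in\mathbb{N}$, whether $G$ has a $P_3$-matching of size $k$. **Theorem.** $P_3$-Matching has kernels with $O(k^{2.5})$ edges. That is, there are a constant $C$, a function $f\colon\mathbb{N}\to\mathbb{N}$ and a polynomial-time algorithm that, given any instance $(G,k)$, computes an instance $(G',k')$ such that 1. $G'$ has a $P_3$-matching of size $k'$ if and only if $G$ has a $P_3$-matching of size $k$; 2. the size of $(G',k')$ and the parameter $k'$ are both at most $f(k)$; 3. $G'$ has at most $C\cdot k^{2.5}$ edges. -/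

import Mathlib

/-! ### Parameterized graph problems -/

/-- An instance of a parameterized graph problem: a finite simple graph, on the vertex set
`{0, …, n - 1}`, together with a parameter `k`. -/
structure GraphInstance where
  n : ℕ
  graph : SimpleGraph (Fin n)
  k : ℕ

/-- The number of bits of an instance: the entries of the adjacency matrix of the graph and
the binary digits of the parameter. -/
def GraphInstance.size (I : GraphInstance) : ℕ := I.n ^ 2 + Nat.size I.k

/-- The number of edges of the graph of an instance. -/
noncomputable def GraphInstance.numEdges (I : GraphInstance) : ℕ := I.graph.edgeSet.ncard

/-- `M` is an `H`-matching in `G`: a collection of pairwise vertex-disjoint (not necessarily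
induced) subgraphs of `G`, each of them isomorphic to `H`. -/
def IsGraphMatching {V W : Type} (H : SimpleGraph W) (G : SimpleGraph V)
    (M : Finset G.Subgraph) : Prop :=
  (∀ S ∈ M, Nonempty (S.coe ≃g H)) ∧
    ∀ S ∈ M, ∀ T ∈ M, S ≠ T → Disjoint S.verts T.verts

/-- The problem `H`-Matching: the set of those `(G, k)` for which `G` has an `H`-matching of
size `k`. -/
def GraphMatchingProblem {W : Type} (H : SimpleGraph W) : Set GraphInstance :=
  {I | ∃ M : Finset I.graph.Subgraph, IsGraphMatching H I.graph M ∧ M.card = I.k}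

/-- The path with `d` edges (and `d + 1` vertices). -/
def pathWithEdges (d : ℕ) : SimpleGraph (Fin (d + 1)) := SimpleGraph.pathGraph (d + 1)

/-! ### The machine model

A random access machine that is programmed by structured programs. It has number variables
and two-dimensional arrays of numbers, both with fixed names in a program (only the indices of
an array cell are computed). The arithmetic is addition and truncated subtraction, each of unit
cost. Multiplication is absent, so numbers gain at most one binary digit per unit of time, and
the model is polynomially equivalent to Turing machines. -/

/-- A memory: the values of the variables and of the array cells. -/
structure RamState where
  var : ℕ → ℕ
  arr : ℕ → ℕ → ℕ → ℕ

/-- Arithmetic expressions. -/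
inductive RamExp where
  | const (c : ℕ)
  | var (x : ℕ)
  | get (a : ℕ) (i j : RamExp)
  | add (e₁ e₂ : RamExp)
  | sub (e₁ e₂ : RamExp)

/-- The value of an expression. -/
def RamExp.val (s : RamState) : RamExp → ℕ
  | .const c => c
  | .var x => s.var x
  | .get a i j => s.arr a (i.val s) (j.val s)
  | .add e₁ e₂ => e₁.val s + e₂.val s
  | .sub e₁ e₂ => e₁.val s - e₂.val s

/-- The time for evaluating an expression: one unit for each symbol of it. -/
def RamExp.cost : RamExp → ℕ
  | .const _ => 1
  | .var _ => 1
  | .get _ i j => i.cost + j.cost + 1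
  | .add e₁ e₂ => e₁.cost + e₂.cost + 1
  | .sub e₁ e₂ => e₁.cost + e₂.cost + 1

/-- The memory after the assignment `x := v`. -/
def RamState.setVar (s : RamState) (x v : ℕ) : RamState :=
  ⟨Function.update s.var x v, s.arr⟩

/-- The memory after the assignment `a[i, j] := v`. -/
def RamState.setArr (s : RamState) (a i j v : ℕ) : RamState :=
  ⟨s.var, Function.update s.arr a
    (Function.update (s.arr a) i (Function.update (s.arr a i) j v))⟩

/-- Programs. Conditions test whether an expression is nonzero;
`loop e p` means: while `e ≠ 0` do `p`. -/
inductive RamProg where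
  | skip
  | assign (x : ℕ) (e : RamExp)
  | store (a : ℕ) (i j e : RamExp)
  | seq (p q : RamProg)
  | ite (e : RamExp) (p q : RamProg)
  | loop (e : RamExp) (p : RamProg)

/-- `RamProg.Runs p s t s'`: the program `p`, started in the memory `s`, halts after exactly
`t` units of time in the memory `s'`. -/
inductive RamProg.Runs : RamProg → RamState → ℕ → RamState → Prop where
  | skip (s : RamState) : Runs .skip s 1 s
  | assign (s : RamState) (x : ℕ) (e : RamExp) :
      Runs (.assign x e) s (e.cost + 1) (s.setVar x (e.val s))
  | store (s : RamState) (a : ℕ) (i j e : RamExp) :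
      Runs (.store a i j e) s (i.cost + j.cost + e.cost + 1)
        (s.setArr a (i.val s) (j.val s) (e.val s))
  | seq {p q : RamProg} {s s' s'' : RamState} {t t' : ℕ} :
      Runs p s t s' → Runs q s' t' s'' → Runs (.seq p q) s (t + t') s''
  | ite_true {e : RamExp} {p q : RamProg} {s s' : RamState} {t : ℕ} :
      e.val s ≠ 0 → Runs p s t s' → Runs (.ite e p q) s (e.cost + 1 + t) s'
  | ite_false {e : RamExp} {p q : RamProg} {s s' : RamState} {t : ℕ} :
      e.val s = 0 → Runs q s t s' → Runs (.ite e p q) s (e.cost + 1 + t) s'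
  | loop_true {e : RamExp} {p : RamProg} {s s' s'' : RamState} {t t' : ℕ} :
      e.val s ≠ 0 → Runs p s t s' → Runs (.loop e p) s' t' s'' →
        Runs (.loop e p) s (e.cost + 1 + t + t') s''
  | loop_false {e : RamExp} {p : RamProg} {s : RamState} :
      e.val s = 0 → Runs (.loop e p) s (e.cost + 1) s

/-! ### Graph instances as inputs and outputs -/

open Classical in
/-- The initial memory on an input: the number of vertices is in variable 0, the parameter in
variable 1, the adjacency matrix in array 0, and everything else is 0. -/
noncomputable def GraphInstance.input (I : GraphInstance) : RamState where
  var x := if x = 0 then I.n else if x = 1 then I.k else 0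
  arr a i j :=
    if a = 0 ∧ ∃ (hi : i < I.n) (hj : j < I.n), I.graph.Adj ⟨i, hi⟩ ⟨j, hj⟩ then 1 else 0

/-- The memory `s` holds the instance `I` as an output: the number of vertices is in variable
0, the parameter in variable 1, and the adjacency matrix in array 0. -/
def RamState.Outputs (s : RamState) (I : GraphInstance) : Prop :=
  s.var 0 = I.n ∧ s.var 1 = I.k ∧
    ∀ u v : Fin I.n,
      (I.graph.Adj u v → s.arr 0 u v = 1) ∧ (¬ I.graph.Adj u v → s.arr 0 u v = 0)

/-- On input `I`, the program `p` halts with output `J` in time at most `T`, where the time for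
writing the output out bit by bit is charged too. -/
def RamProg.ComputesWithin (p : RamProg) (I J : GraphInstance) (T : ℕ) : Prop :=
  ∃ (t : ℕ) (s : RamState), p.Runs I.input t s ∧ s.Outputs J ∧ t + J.size ≤ T

/-! ### Kernels -/

/-- The problem `Q` has kernels with at most `g k` edges: there is a polynomial-time algorithm
that, given an instance `I` with parameter `k`, computes an equivalent instance `J` such that
the size and the parameter of `J` are bounded by a function `f` of `k` alone and `J` has at
most `g k` edges. -/
def HasKernelsWithEdges (Q : Set GraphInstance) (g : ℕ → ℝ) : Prop :=
  ∃ (p : RamProg) (P : Polynomial ℕ) (f : ℕ → ℕ), ∀ I : GraphInstance, ∃ J : GraphInstance,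
    p.ComputesWithin I J (P.eval I.size) ∧
    (J ∈ Q ↔ I ∈ Q) ∧
    J.size ≤ f I.k ∧
    J.k ≤ f I.k ∧
    (J.numEdges : ℝ) ≤ g I.k

/-! The problem asks for `k` disjoint four-vertex paths (`mem_graphMatchingProblem_iff`). Let `S` be
the vertex set of a maximal family of disjoint four-vertex paths. If `S` has at least `4 * k`
vertices, the answer is yes. Otherwise no four-vertex path avoids `S`, so the components outside `S`
are triangles, stars, single edges and single vertices. Each of them has at most three core vertices
(`card_core_near_le`). The remaining vertices form the periphery `I`, an independent set whose
vertices have at most one neighbor outside `S`.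

A vertex of `S` that touches `12 * k` core vertices can always be given a path of its own, so it is
removed and the parameter drops by one (`hasPacking_isolate_insert_iff`). Afterwards only `O(k ^ 2)`
core vertices matter. What remains is to bound the edges between `S` and `I`: each `a` in `S` should
keep only `O(k ^ 1.5)` neighbors in `I`.

If `a` is adjacent to all other neighbors of `o` in `I`, then the edge `ao` can be exchanged for
another edge at `a`, so `4 * k` such edges suffice (`HasPacking.deleteEdge_of_simplicial`). Hence
edges are added in order to create this situation. An edge `ab` is harmless if `a` and `b` have `4 *
k` common neighbors in `I` (`hasPacking_addCommon_iff`). For the other pairs let `s` be about the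
square root of `k`, and let every vertex reserve up to `s` private neighbors in `I`. At a given `a`,
the unreserved `o` with at most `s` neighbors that are still not adjacent to `a` are collected, and
then, repeatedly, the neighbors of every such `b` with fewer than `14 * s` neighbors left are peeled
off. For the surviving set `O a`, all edges between `a` and the neighbors of `O a` can be added; the
reason is an exchange argument with Hall's theorem (`hasPacking_succ_of_link`). The neighbors of `a`
that are not made redundant number `O(k * s)`: `a` has `O(k)` partners, each responsible for at most
`s` private and `14 * s` peeled vertices, and double counting bounds the vertices with more than `s`
bad neighbors by `O(k ^ 2 / s)` (`card_periphery_adj_le`). Summing over the at most `4 * k` vertices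
of `S` gives `O(k ^ 2.5)`. Of the periphery vertices without neighbors in `S`, one at each core
vertex is enough.

For the running time, every graph and set above is a table defined from earlier tables by a formula
with bounded quantifiers and counting. A small language of bounded loops evaluates these formulas,
and its translation runs in polynomial time (`Prg.code_runs`). The greedy choices are loops whose
achieved goals persist (`Prg.loop_progress`). -/

/-! ### Packings of four-vertex paths -/

/-- `p` lists the vertices of a walk with three edges. -/
def IsPath4 {V : Type*} (G : SimpleGraph V) (p : Fin 4 → V) : Prop :=
  G.Adj (p 0) (p 1) ∧ G.Adj (p 1) (p 2) ∧ G.Adj (p 2) (p 3)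

/-- A family of pairwise disjoint four-vertex paths. -/
structure IsPacking {V ι : Type*} (G : SimpleGraph V) (f : ι → Fin 4 → V) : Prop where
  inj : ∀ i j c d, f i c = f j d → i = j ∧ c = d
  path : ∀ i, IsPath4 G (f i)

/-- The graph has `k` pairwise disjoint four-vertex paths. -/
def HasPacking {V : Type*} (G : SimpleGraph V) (k : ℕ) : Prop :=
  ∃ f : Fin k → Fin 4 → V, IsPacking G f

section Packing

variable {V ι κ : Type*} {G H : SimpleGraph V}

theorem IsPath4.mono {p : Fin 4 → V} (h : G ≤ H) (hp : IsPath4 G p) : IsPath4 H p :=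
  ⟨h hp.1, h hp.2.1, h hp.2.2⟩

theorem IsPacking.mono {f : ι → Fin 4 → V} (h : G ≤ H) (hf : IsPacking G f) : IsPacking H f :=
  ⟨hf.inj, fun i => (hf.path i).mono h⟩

theorem HasPacking.mono {k : ℕ} (h : G ≤ H) (hf : HasPacking G k) : HasPacking H k :=
  hf.imp fun _ hf => hf.mono h

theorem IsPacking.comp {f : ι → Fin 4 → V} (hf : IsPacking G f) (e : κ → ι)
    (he : Function.Injective e) : IsPacking G (f ∘ e) :=
  ⟨fun _ _ _ _ h => ⟨he (hf.inj _ _ _ _ h).1, (hf.inj _ _ _ _ h).2⟩, fun _ => hf.path _⟩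

theorem IsPacking.hasPacking [Fintype ι] {f : ι → Fin 4 → V} (hf : IsPacking G f) {k : ℕ}
    (hk : k ≤ Fintype.card ι) : HasPacking G k := by
  have e : Fin k ↪ ι := (Fin.castLEEmb hk).trans (Fintype.equivFin ι).symm.toEmbedding
  exact ⟨f ∘ e, hf.comp e e.injective⟩

theorem hasPacking_zero : HasPacking G 0 :=
  ⟨fun i => i.elim0, fun i => i.elim0, fun i => i.elim0⟩

/-- The vertices of each path may be listed in any order. -/
theorem hasPacking_of_perm [Fintype ι] {f : ι → Fin 4 → V}
    (inj : ∀ i j c d, f i c = f j d → i = j ∧ c = d)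
    (path : ∀ i, ∃ π : Equiv.Perm (Fin 4), IsPath4 G (f i ∘ π)) {k : ℕ}
    (hk : k ≤ Fintype.card ι) : HasPacking G k := by
  choose π hπ using path
  refine IsPacking.hasPacking (f := fun i => f i ∘ π i) ⟨fun i j c d h => ?_, hπ⟩ hk
  obtain ⟨rfl, h2⟩ := inj _ _ _ _ h
  exact ⟨rfl, (π i).injective h2⟩

theorem isPacking_replace [DecidableEq ι] {f : ι → Fin 4 → V}
    (inj : ∀ i j c d, f i c = f j d → i = j ∧ c = d) (i : ι)
    (path : ∀ j ≠ i, IsPath4 G (f j)) {q : Fin 4 → V} (hq : Function.Injective q)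
    (hqp : IsPath4 G q) (hd : ∀ j ≠ i, ∀ c d, f j c ≠ q d) :
    IsPacking G (Function.update f i q) := by
  refine ⟨fun j l c d h => ?_, fun j => ?_⟩
  · by_cases hj : j = i
    · subst hj
      by_cases hl : l = j
      · subst hl
        simp only [Function.update_self] at h
        exact ⟨rfl, hq h⟩
      · simp only [Function.update_self, Function.update_of_ne hl] at h
        exact absurd h.symm (hd l hl _ _)
    · by_cases hl : l = i
      · subst hl
        simp only [Function.update_self, Function.update_of_ne hj] at h
        exact absurd h (hd j hj _ _)
      · simp only [Function.update_of_ne hj, Function.update_of_ne hl] at h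
        exact inj _ _ _ _ h
  · by_cases hj : j = i
    · subst hj; simpa using hqp
    · simpa [Function.update_of_ne hj] using path j hj

theorem inj_option {f : ι → Fin 4 → V} (inj : ∀ i j c d, f i c = f j d → i = j ∧ c = d)
    {q : Fin 4 → V} (hq : Function.Injective q) (hd : ∀ j c d, f j c ≠ q d)
    (i j : Option ι) (c d : Fin 4) (h : i.elim q f c = j.elim q f d) : i = j ∧ c = d := by
  rcases i with _ | i <;> rcases j with _ | j
  · exact ⟨rfl, hq h⟩
  · exact absurd h.symm (hd _ _ _)
  · exact absurd h (hd _ _ _)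
  · obtain ⟨rfl, h2⟩ := inj _ _ _ _ h
    exact ⟨rfl, h2⟩

theorem isPacking_option {f : ι → Fin 4 → V} (hf : IsPacking G f) {q : Fin 4 → V}
    (hq : Function.Injective q) (hqp : IsPath4 G q) (hd : ∀ j c d, f j c ≠ q d) :
    IsPacking G (fun o : Option ι => o.elim q f) := by
  refine ⟨inj_option hf.inj hq hd, ?_⟩
  rintro (_ | i)
  · exact hqp
  · exact hf.path i

theorem injective_vec4 {a b c d : V} (h : a ≠ b ∧ a ≠ c ∧ a ≠ d ∧ b ≠ c ∧ b ≠ d ∧ c ≠ d) :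
    Function.Injective ![a, b, c, d] := by
  obtain ⟨h1, h2, h3, h4, h5, h6⟩ := h
  intro i j hij
  fin_cases i <;> fin_cases j <;> simp_all

/-- The vertices that a family of paths uses. -/
def usedBy [Fintype ι] [DecidableEq V] (f : ι → Fin 4 → V) : Finset V :=
  Finset.univ.image fun x : ι × Fin 4 => f x.1 x.2

theorem mem_usedBy [Fintype ι] [DecidableEq V] {f : ι → Fin 4 → V} {v : V} :
    v ∈ usedBy f ↔ ∃ i c, f i c = v := by
  simp [usedBy]

theorem card_usedBy_le [Fintype ι] [DecidableEq V] (f : ι → Fin 4 → V) :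
    (usedBy f).card ≤ 4 * Fintype.card ι := by
  refine Finset.card_image_le.trans ?_
  simp [mul_comm]

theorem card_usedBy [Fintype ι] [DecidableEq V] {f : ι → Fin 4 → V} (hf : IsPacking G f) :
    (usedBy f).card = 4 * Fintype.card ι := by
  rw [usedBy, Finset.card_image_of_injective]
  · simp [mul_comm]
  · rintro ⟨i, c⟩ ⟨j, d⟩ h
    obtain ⟨h1, h2⟩ := hf.inj _ _ _ _ h
    simp_all

/-- Packings never meet isolated vertices. This is why isolating a vertex can stand for deleting it,
and why isolated vertices can be dropped at the end. -/
theorem IsPacking.exists_adj {f : ι → Fin 4 → V} (hf : IsPacking G f) (i : ι) (c : Fin 4) :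
    ∃ v, G.Adj (f i c) v := by
  have h := hf.path i
  fin_cases c
  exacts [⟨_, h.1⟩, ⟨_, h.2.1⟩, ⟨_, h.2.2⟩, ⟨_, h.2.2.symm⟩]

theorem IsPath4.exists_adj_of_mem {p : Fin 4 → V} (h : IsPath4 G p) (c : Fin 4) :
    ∃ d, G.Adj (p c) (p d) := by
  fin_cases c
  exacts [⟨_, h.1⟩, ⟨_, h.2.1⟩, ⟨_, h.2.2⟩, ⟨_, h.2.2.symm⟩]

/-- A set that is closed under adjacency and meets a path contains it. -/
theorem IsPath4.forall_of_closed {p : Fin 4 → V} (h : IsPath4 G p) {P : V → Prop}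
    (hP : ∀ x y, P x → G.Adj x y → P y) {c : Fin 4} (hc : P (p c)) (d : Fin 4) : P (p d) := by
  obtain ⟨h1, h2, h3⟩ := h
  have a1 : P (p 0) ↔ P (p 1) := ⟨fun h => hP _ _ h h1, fun h => hP _ _ h h1.symm⟩
  have a2 : P (p 1) ↔ P (p 2) := ⟨fun h => hP _ _ h h2, fun h => hP _ _ h h2.symm⟩
  have a3 : P (p 2) ↔ P (p 3) := ⟨fun h => hP _ _ h h3, fun h => hP _ _ h h3.symm⟩
  have hall : P (p 0) ∧ P (p 1) ∧ P (p 2) ∧ P (p 3) := by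
    fin_cases c <;> simp_all
  fin_cases d
  exacts [hall.1, hall.2.1, hall.2.2.1, hall.2.2.2]

/-- Edges can be removed from a graph one at a time. -/
theorem HasPacking.of_step [Finite V] {m : ℕ} {Lo Hi : SimpleGraph V} (hle : Lo ≤ Hi)
    (step : ∀ (H : SimpleGraph V) (a b : V), Lo ≤ H → H ≤ Hi → H.Adj a b → ¬ Lo.Adj a b →
      HasPacking H m → HasPacking (H.deleteEdges {s(a, b)}) m) (h : HasPacking Hi m) :
    HasPacking Lo m := by
  -- Induction on the number of edges. The graph has to vary between `Lo` and `Hi`, because each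
  -- exchange takes place after some of the edges are already gone.
  suffices ∀ (N : ℕ) (H : SimpleGraph V), H.edgeSet.ncard = N → Lo ≤ H → H ≤ Hi →
      HasPacking H m → HasPacking Lo m from this _ Hi rfl hle le_rfl h
  intro N
  induction N using Nat.strong_induction_on with
  | _ N ih =>
    intro H hN h1 h2 hH
    by_cases hall : ∀ a b, H.Adj a b → Lo.Adj a b
    · exact hH.mono fun a b => hall a b
    · push Not at hall
      obtain ⟨a, b, hab, hnot⟩ := hall
      refine ih _ ?_ (H.deleteEdges {s(a, b)}) rfl ?_ ((H.deleteEdges_le _).trans h2)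
        (step H a b h1 h2 hab hnot hH)
      · rw [← hN, SimpleGraph.edgeSet_deleteEdges]
        exact Set.ncard_lt_ncard (Set.sdiff_singleton_ssubset.2 hab) (Set.toFinite _)
      · intro x y hxy
        rw [SimpleGraph.deleteEdges_adj]
        refine ⟨h1 hxy, fun hm => ?_⟩
        rcases Sym2.eq_iff.1 (Set.mem_singleton_iff.1 hm) with ⟨rfl, rfl⟩ | ⟨rfl, rfl⟩
        exacts [hnot hxy, hnot hxy.symm]

/-- A graph whose packings avoid the edge `ab`, or else use it in a single path. -/
theorem IsPacking.deleteEdge_cases {f : ι → Fin 4 → V} (hf : IsPacking G f) (a b : V) :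
    IsPacking (G.deleteEdges {s(a, b)}) f ∨
      ∃ i, (∃ c d, f i c = a ∧ f i d = b ∧
        (c.val + 1 = d.val ∨ d.val + 1 = c.val)) ∧
        ∀ j ≠ i, IsPath4 (G.deleteEdges {s(a, b)}) (f j) := by
  by_cases h : ∀ i, IsPath4 (G.deleteEdges {s(a, b)}) (f i)
  · exact Or.inl ⟨hf.inj, h⟩
  · right
    push Not at h
    obtain ⟨i, hi⟩ := h
    have key : ∀ j, ¬ IsPath4 (G.deleteEdges {s(a, b)}) (f j) →
        ∃ c d, f j c = a ∧ f j d = b ∧ (c.val + 1 = d.val ∨ d.val + 1 = c.val) := by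
      intro j hj
      by_contra hcon
      push Not at hcon
      apply hj
      have aux : ∀ c d : Fin 4, c.val + 1 = d.val → G.Adj (f j c) (f j d) →
          (G.deleteEdges {s(a, b)}).Adj (f j c) (f j d) := by
        intro c d hcd hadj
        rw [SimpleGraph.deleteEdges_adj]
        refine ⟨hadj, fun hm => ?_⟩
        rcases Sym2.eq_iff.1 (Set.mem_singleton_iff.1 hm) with ⟨h1, h2⟩ | ⟨h1, h2⟩
        · exact (hcon c d h1 h2).1 hcd
        · exact (hcon d c h2 h1).2 hcd
      obtain ⟨p1, p2, p3⟩ := hf.path j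
      exact ⟨aux 0 1 rfl p1, aux 1 2 rfl p2, aux 2 3 rfl p3⟩
    -- Two paths that use the edge would both contain `a`.
    refine ⟨i, key i hi, fun j hj => ?_⟩
    by_contra hcon
    obtain ⟨c, d, h1, -, -⟩ := key i hi
    obtain ⟨c', d', h1', -, -⟩ := key j hcon
    exact hj (hf.inj _ _ _ _ (h1'.trans h1.symm)).1

end Packing

/-! ### Packings and graph matchings -/

open Classical in
/-- The matchings of three-edge paths are the packings. -/
theorem mem_graphMatchingProblem_iff (I : GraphInstance) :
    I ∈ GraphMatchingProblem (pathWithEdges 3) ↔ HasPacking I.graph I.k := by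
  have adjP : ∀ i j : Fin 4, (pathWithEdges 3).Adj i j ↔ i.val + 1 = j.val ∨ j.val + 1 = i.val := by
    intro i j
    rw [pathWithEdges, SimpleGraph.pathGraph_adj]
  constructor
  · rintro ⟨M, ⟨hiso, hdis⟩, hcard⟩
    have e : ∀ S : M, (pathWithEdges 3) ≃g S.1.coe := fun S => (hiso S.1 S.2).some.symm
    refine IsPacking.hasPacking (ι := M) (f := fun S c => (e S c).1) ⟨?_, ?_⟩ (by simp [hcard])
    · intro S T c d h
      have hST : S = T := by
        by_contra hne
        have := hdis S.1 S.2 T.1 T.2 fun h => hne (Subtype.ext h)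
        exact Set.disjoint_left.1 this (e S c).2 (h ▸ (e T d).2)
      subst hST
      exact ⟨rfl, (e S).injective (Subtype.ext h)⟩
    · intro S
      have : ∀ i j : Fin 4, i.val + 1 = j.val → I.graph.Adj (e S i).1 (e S j).1 := fun i j hij =>
        S.1.adj_sub (((e S).map_adj_iff).2 ((adjP i j).2 (Or.inl hij)))
      exact ⟨this 0 1 rfl, this 1 2 rfl, this 2 3 rfl⟩
  · rintro ⟨f, hf⟩
    have hom : ∀ i, ∀ c d, (pathWithEdges 3).Adj c d → I.graph.Adj (f i c) (f i d) := by
      intro i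
      obtain ⟨h1, h2, h3⟩ := hf.path i
      have aux : ∀ c d : Fin 4, c.val + 1 = d.val → I.graph.Adj (f i c) (f i d) := by
        intro c d hcd
        have : (c = 0 ∧ d = 1) ∨ (c = 1 ∧ d = 2) ∨ (c = 2 ∧ d = 3) := by omega
        rcases this with ⟨rfl, rfl⟩ | ⟨rfl, rfl⟩ | ⟨rfl, rfl⟩ <;> assumption
      intro c d hcd
      rcases (adjP c d).1 hcd with h | h
      exacts [aux _ _ h, (aux _ _ h).symm]
    let g : ∀ i, SimpleGraph.Copy (pathWithEdges 3) I.graph := fun i =>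
      ⟨⟨f i, fun h => hom i _ _ h⟩, fun c d h => (hf.inj _ _ _ _ h).2⟩
    have hverts : ∀ i v, v ∈ (g i).toSubgraph.verts ↔ ∃ c, f i c = v := by
      intro i v
      simp [SimpleGraph.Copy.toSubgraph, g]
    have hne : ∀ i j, (g i).toSubgraph = (g j).toSubgraph → i = j := by
      intro i j h
      have h1 : f i 0 ∈ (g i).toSubgraph.verts := (hverts i _).2 ⟨0, rfl⟩
      rw [h, hverts] at h1
      obtain ⟨c, hc⟩ := h1
      exact (hf.inj _ _ _ _ hc).1.symm
    refine ⟨Finset.univ.image fun i => (g i).toSubgraph, ⟨?_, ?_⟩, ?_⟩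
    · intro S hS
      obtain ⟨i, -, rfl⟩ := Finset.mem_image.1 hS
      exact ⟨(g i).isoToSubgraph.symm⟩
    · intro S hS T hT hST
      obtain ⟨i, -, rfl⟩ := Finset.mem_image.1 hS
      obtain ⟨j, -, rfl⟩ := Finset.mem_image.1 hT
      refine Set.disjoint_left.2 fun v h1 h2 => ?_
      obtain ⟨c, hc⟩ := (hverts i v).1 h1
      obtain ⟨d, hd⟩ := (hverts j v).1 h2
      exact hST (by rw [(hf.inj _ _ _ _ (hc.trans hd.symm)).1])
    · rw [Finset.card_image_of_injective _ fun i j h => hne i j h]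
      simp


/-! ### Linking two vertices through an independent set -/

section Link

variable {V ι : Type*} {H : SimpleGraph V}

theorem IsPacking.replaceVertex [DecidableEq ι] {f : ι → Fin 4 → V} (hf : IsPacking H f)
    (i : ι) (c : Fin 4) {w : V} (hw : ∀ j d, f j d ≠ w)
    (hp : IsPath4 H (Function.update (f i) c w)) :
    IsPacking H (Function.update f i (Function.update (f i) c w)) := by
  refine isPacking_replace hf.inj i (fun j _ => hf.path j) ?_ hp ?_
  · intro d e h
    by_cases hd : d = c
    · by_cases he : e = c
      · rw [hd, he]
      · rw [hd, Function.update_self, Function.update_of_ne he] at h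
        exact absurd h.symm (hw _ _)
    · by_cases he : e = c
      · rw [he, Function.update_self, Function.update_of_ne hd] at h
        exact absurd h (hw _ _)
      · rw [Function.update_of_ne hd, Function.update_of_ne he] at h
        exact (hf.inj _ _ _ _ h).2
  · intro j hj d e h
    by_cases he : e = c
    · rw [he, Function.update_self] at h
      exact hw _ _ h
    · rw [Function.update_of_ne he] at h
      exact hj (hf.inj _ _ _ _ h).1

/-- A packing can be listed so that the second vertex of each path is outside a given
independent set. -/
theorem IsPacking.exists_orientation {f : ι → Fin 4 → V} (hf : IsPacking H f) (I : Finset V)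
    (hI : ∀ o ∈ I, ∀ v, H.Adj o v → v ∉ I) :
    ∃ g : ι → Fin 4 → V, IsPacking H g ∧ (∀ i, g i 1 ∉ I) ∧ ∀ i c, ∃ d, g i c = f i d := by
  classical
  -- The two middle vertices are adjacent, so at most one of them is in `I`; if it is the second
  -- one, the path is reversed.
  refine ⟨fun i => if f i 1 ∈ I then f i ∘ Fin.rev else f i, ⟨?_, ?_⟩, ?_, ?_⟩
  · intro i j c d h
    have : ∀ i c, (if f i 1 ∈ I then f i ∘ Fin.rev else f i) c =
        f i (if f i 1 ∈ I then Fin.rev c else c) := by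
      intro i c
      split_ifs <;> rfl
    rw [this, this] at h
    obtain ⟨rfl, h2⟩ := hf.inj _ _ _ _ h
    refine ⟨rfl, ?_⟩
    split_ifs at h2
    · exact Fin.rev_injective h2
    · exact h2
  · intro i
    split_ifs
    · exact ⟨(hf.path i).2.2.symm, (hf.path i).2.1.symm, (hf.path i).1.symm⟩
    · exact hf.path i
  · intro i
    dsimp only
    split_ifs with h
    · exact hI _ h _ (hf.path i).2.1
    · exact h
  · intro i c
    dsimp only
    split_ifs
    · exact ⟨Fin.rev c, rfl⟩
    · exact ⟨c, rfl⟩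

theorem exists_mem_notMem_of_card [DecidableEq V] {A B : Finset V} (h : B.card < A.card) :
    ∃ x ∈ A, x ∉ B := by
  by_contra hcon
  push Not at hcon
  exact absurd (Finset.card_le_card hcon) (not_le.2 h)

open Classical in
/-- Suppose that `a` and `b` are not adjacent but have a common neighbor in `O`, where each
vertex of `O` has few neighbors that are not adjacent to `a`, and each of these has many
neighbors in `O`. Then a packing that avoids `a` and `b` can be enlarged. -/
theorem hasPacking_succ_of_link [Fintype V] {I : Finset V} {owner : V → Option V} {k s m : ℕ}
    (hI : ∀ o ∈ I, ∀ v, H.Adj o v → v ∉ I)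
    (own1 : ∀ o w, owner o = some w → o ∈ I ∧ H.Adj w o)
    (own2 : ∀ o ∈ I, owner o = none → ∀ w, H.Adj w o →
      s ≤ (Finset.univ.filter fun o' => owner o' = some w).card)
    {a b : V} (ha : a ∉ I) (hb : b ∉ I) (hne : a ≠ b) (hks : k < s ^ 2) (hmk : m + 1 ≤ k)
    (high : 4 * k ≤ (I.filter fun o => H.Adj a o).card)
    {O : Finset V} (hO : ∀ o ∈ O, o ∈ I ∧ H.Adj a o ∧ owner o = none)
    (few : ∀ o ∈ O,
      (Finset.univ.filter fun b' => b' ≠ a ∧ H.Adj b' o ∧ ¬ H.Adj a b').card ≤ s)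
    (many : ∀ b', b' ≠ a → ¬ H.Adj a b' → (∃ o ∈ O, H.Adj b' o) →
      14 * s ≤ (O.filter fun o => H.Adj b' o).card)
    (hab : ¬ H.Adj a b) (hbO : ∃ o ∈ O, H.Adj b o)
    {g₀ : Fin m → Fin 4 → V} (hg₀ : IsPacking H g₀) (ha₀ : ∀ i c, g₀ i c ≠ a)
    (hb₀ : ∀ i c, g₀ i c ≠ b) : HasPacking H (m + 1) := by
  -- Choose the packing with as few endpoints in `O` as possible.
  obtain ⟨g, hg, ha', hb', hor, hend⟩ : ∃ g : Fin m → Fin 4 → V, IsPacking H g ∧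
      (∀ i c, g i c ≠ a) ∧ (∀ i c, g i c ≠ b) ∧ (∀ i, g i 1 ∉ I) ∧
      ∀ i, (g i 0 ∈ O → ∀ w, owner w = some (g i 1) → w ∈ usedBy g) ∧
        (g i 3 ∈ O → ∀ w, owner w = some (g i 2) → w ∈ usedBy g) := by
    let good : Set (Fin m → Fin 4 → V) := {g | IsPacking H g ∧
      (∀ i c, g i c ≠ a) ∧ (∀ i c, g i c ≠ b) ∧ (∀ i, g i 1 ∉ I)}
    let μ : (Fin m → Fin 4 → V) → ℕ := fun g =>
      (Finset.univ.filter fun i => g i 0 ∈ O).card + (Finset.univ.filter fun i => g i 3 ∈ O).card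
    have hgood : good.Nonempty := by
      obtain ⟨g, h1, h2, h3⟩ := hg₀.exists_orientation I hI
      refine ⟨g, h1, fun i c => ?_, fun i c => ?_, h2⟩
      · obtain ⟨d, hd⟩ := h3 i c
        rw [hd]; exact ha₀ _ _
      · obtain ⟨d, hd⟩ := h3 i c
        rw [hd]; exact hb₀ _ _
    obtain ⟨g, ⟨h1, h2, h3, h4⟩, hmin⟩ := (measure μ).wf.has_min good hgood
    have wne : ∀ w v, owner w = some v → w ≠ a ∧ w ≠ b ∧ w ∉ O ∧ H.Adj v w := by
      intro w v hw
      obtain ⟨hwI, hvw⟩ := own1 _ _ hw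
      exact ⟨fun h => ha (h ▸ hwI), fun h => hb (h ▸ hwI),
        fun h => by simp [(hO _ h).2.2] at hw, hvw⟩
    refine ⟨g, h1, h2, h3, h4, fun i => ⟨fun hi w hw => ?_, fun hi w hw => ?_⟩⟩
    -- An unused private neighbor `w` could take the place of this endpoint. As `w` is owned, it is
    -- not in `O`, so the measure would drop.
    · by_contra hwu
      obtain ⟨w1, w2, w3, w4⟩ := wne _ _ hw
      have hwu' : ∀ j d, g j d ≠ w := fun j d h => hwu (mem_usedBy.2 ⟨j, d, h⟩)
      have hval : ∀ j d, Function.update g i (Function.update (g i) 0 w) j d =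
          if j = i ∧ d = 0 then w else g j d := by
        intro j d
        by_cases hj : j = i
        · subst hj
          by_cases hd : d = 0 <;> simp [hd]
        · simp [hj]
      refine hmin (Function.update g i (Function.update (g i) 0 w))
        ⟨h1.replaceVertex i 0 hwu' ⟨w4.symm, (h1.path i).2.1, (h1.path i).2.2⟩, ?_, ?_, ?_⟩ ?_
      · intro j d; rw [hval]; split_ifs; exacts [w1, h2 _ _]
      · intro j d; rw [hval]; split_ifs; exacts [w2, h3 _ _]
      · intro j; rw [hval]; simpa using h4 j
      · change μ _ < μ _
        refine add_lt_add_of_lt_of_le (Finset.card_lt_card ?_) (Finset.card_le_card ?_)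
        · rw [Finset.ssubset_iff_of_subset]
          · exact ⟨i, by simpa using hi, by simp [w3]⟩
          · intro j
            simp only [Finset.mem_filter, Finset.mem_univ, true_and, hval]
            split_ifs
            · exact fun h => absurd h w3
            · exact id
        · intro j
          simp only [Finset.mem_filter, Finset.mem_univ, true_and, hval]
          simp
    · by_contra hwu
      obtain ⟨w1, w2, w3, w4⟩ := wne _ _ hw
      have hwu' : ∀ j d, g j d ≠ w := fun j d h => hwu (mem_usedBy.2 ⟨j, d, h⟩)
      have hval : ∀ j d, Function.update g i (Function.update (g i) 3 w) j d =
          if j = i ∧ d = 3 then w else g j d := by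
        intro j d
        by_cases hj : j = i
        · subst hj
          by_cases hd : d = 3 <;> simp [hd]
        · simp [hj]
      refine hmin (Function.update g i (Function.update (g i) 3 w))
        ⟨h1.replaceVertex i 3 hwu' ⟨(h1.path i).1, (h1.path i).2.1, w4⟩, ?_, ?_, ?_⟩ ?_
      · intro j d; rw [hval]; split_ifs; exacts [w1, h2 _ _]
      · intro j d; rw [hval]; split_ifs; exacts [w2, h3 _ _]
      · intro j; rw [hval]; simpa using h4 j
      · change μ _ < μ _
        refine add_lt_add_of_le_of_lt (Finset.card_le_card ?_) (Finset.card_lt_card ?_)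
        · intro j
          simp only [Finset.mem_filter, Finset.mem_univ, true_and, hval]
          simp
        · rw [Finset.ssubset_iff_of_subset]
          · exact ⟨i, by simpa using hi, by simp [w3]⟩
          · intro j
            simp only [Finset.mem_filter, Finset.mem_univ, true_and, hval]
            split_ifs
            · exact fun h => absurd h w3
            · exact id
  have hUcard : (usedBy g).card ≤ 4 * m := by simpa using card_usedBy_le g
  have hs : 0 < s := by
    rcases Nat.eq_zero_or_pos s with rfl | h
    · simp at hks
    · exact h
  -- The vertices all of whose private neighbors are used.
  let Bl : Finset V := Finset.univ.filter fun v =>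
    s ≤ (Finset.univ.filter fun o' => owner o' = some v).card ∧
      ∀ w, owner w = some v → w ∈ usedBy g
  -- The blocked vertices own disjoint sets of at least `s` used vertices, and fewer than `4 * s ^
  -- 2` vertices are used.
  have hBl : Bl.card < 4 * s := by
    have h1 : Bl.card * s ≤ (usedBy g).card := by
      calc Bl.card * s ≤ ∑ v ∈ Bl, (Finset.univ.filter fun o' => owner o' = some v).card := by
            rw [← smul_eq_mul]
            exact Finset.card_nsmul_le_sum _ _ _ fun v hv => (Finset.mem_filter.1 hv).2.1
        _ = (Bl.biUnion fun v => Finset.univ.filter fun o' => owner o' = some v).card := by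
            rw [Finset.card_biUnion]
            intro v _ v' _ hvv
            refine Finset.disjoint_left.2 fun o h1 h2 => hvv ?_
            simp only [Finset.mem_filter, Finset.mem_univ, true_and] at h1 h2
            rw [h1] at h2
            exact Option.some.inj h2
        _ ≤ (usedBy g).card := by
            refine Finset.card_le_card fun o ho => ?_
            obtain ⟨v, hv, hov⟩ := Finset.mem_biUnion.1 ho
            exact (Finset.mem_filter.1 hv).2.2 o (Finset.mem_filter.1 hov).2
    by_contra hcon
    push Not at hcon
    have h2 : 4 * s * s ≤ Bl.card * s := Nat.mul_le_mul_right _ hcon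
    nlinarith
  -- With a further vertex `p`, such a `y` completes a new path through `a`: either `p a o y` or `p
  -- a y w`.
  let Star : V → Prop := fun y => (∃ o ∈ O, o ∉ usedBy g ∧ H.Adj y o) ∨
    (H.Adj a y ∧ ∃ w ∈ I, w ∉ usedBy g ∧ H.Adj y w)
  -- The last vertices of the paths, together with `b`, are redistributed. The slots are the old
  -- paths and, as `none`, the new path. A path whose third vertex is outside `O` keeps its last
  -- vertex; the other candidates may move to a path whose third vertex is in `O` and adjacent to
  -- them, or to the new path if they satisfy `Star`.
  let y : Option (Fin m) → V := fun j => j.elim b fun i => g i 3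
  have yinj : Function.Injective y := by
    rintro (_ | i) (_ | j) h
    · rfl
    · exact absurd h.symm (hb' _ _)
    · exact absurd h (hb' _ _)
    · rw [(hg.inj _ _ _ _ h).1]
  let act : Option (Fin m) → Prop := fun j => ∀ i, j = some i → g i 2 ∈ O
  let t : Option (Fin m) → Finset (Option (Fin m)) := fun j =>
    if act j then
      Finset.univ.filter fun l => (l = none ∧ Star (y j)) ∨
        ∃ i, l = some i ∧ g i 2 ∈ O ∧ H.Adj (y j) (g i 2)
    else {j}
  have tself : ∀ i, some i ∈ t (some i) := by
    intro i
    by_cases hi : act (some i)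
    · simp only [t, if_pos hi, Finset.mem_filter, Finset.mem_univ, true_and]
      exact Or.inr ⟨i, rfl, hi i rfl, (hg.path i).2.2.symm⟩
    · simp [t, if_neg hi]
  have hall : ∀ Y : Finset (Option (Fin m)), Y.card ≤ (Y.biUnion t).card := by
    intro Y
    by_contra hcon
    push Not at hcon
    -- Each old path may keep its own last vertex. So a set that violates Hall's condition contains
    -- `b`, and none of its members can go to the new path.
    have hnot : ¬ Y ⊆ Y.biUnion t := fun h => absurd (Finset.card_le_card h) (not_le.2 hcon)
    have hnone : none ∈ Y ∧ none ∉ Y.biUnion t := by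
      obtain ⟨j, hj, hjt⟩ := Finset.not_subset.1 hnot
      rcases j with _ | i
      · exact ⟨hj, hjt⟩
      · exact absurd (Finset.mem_biUnion.2 ⟨_, hj, tself i⟩) hjt
    have hstar : ∀ j ∈ Y, act j → ¬ Star (y j) := by
      intro j hj hact hst
      refine hnone.2 (Finset.mem_biUnion.2 ⟨j, hj, ?_⟩)
      simp only [t, if_pos hact, Finset.mem_filter, Finset.mem_univ, true_and]
      exact Or.inl hst
    let Y₁ := Y.filter act
    let N₁ := (Finset.univ.filter fun i => some i ∈ Y.biUnion t ∧ g i 2 ∈ O)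
    -- The inactive members of `Y` have themselves as their only choice, so they cancel from both
    -- sides of the violated inequality.
    have hN₁ : N₁.card < Y₁.card := by
      have e1 : (Y.filter act).card + (Y.filter fun j => ¬ act j).card = Y.card :=
        Finset.card_filter_add_card_filter_not _
      have e2 : ((Y.biUnion t).filter act).card + ((Y.biUnion t).filter fun j => ¬ act j).card =
        (Y.biUnion t).card := Finset.card_filter_add_card_filter_not _
      have e3 : (Y.filter fun j => ¬ act j).card ≤
          ((Y.biUnion t).filter fun j => ¬ act j).card := by
        refine Finset.card_le_card fun j hj => ?_
        obtain ⟨h1, h2⟩ := Finset.mem_filter.1 hj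
        exact Finset.mem_filter.2 ⟨Finset.mem_biUnion.2 ⟨j, h1, by simp [t, if_neg h2]⟩, h2⟩
      have e4 : N₁.card ≤ ((Y.biUnion t).filter act).card := by
        refine Finset.card_le_card_of_injOn some ?_ fun _ _ _ _ h => Option.some.inj h
        intro i hi
        obtain ⟨-, h1, h2⟩ := Finset.mem_filter.1 (Finset.mem_coe.1 hi)
        refine Finset.mem_coe.2 (Finset.mem_filter.2 ⟨h1, ?_⟩)
        intro i' hi'
        rw [← Option.some.inj hi']
        exact h2
      change N₁.card < (Y.filter act).card
      omega
    have yOadj : ∀ j, act j → ∃ o ∈ O, H.Adj (y j) o := by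
      rintro (_ | i) hj
      · exact hbO
      · exact ⟨_, hj i rfl, (hg.path i).2.2.symm⟩
    have yne : ∀ j, y j ≠ a := by
      rintro (_ | i)
      · exact hne.symm
      · exact ha' _ _
    have ownB : ∀ o ∈ O, ∀ v, H.Adj v o → (∀ w, owner w = some v → w ∈ usedBy g) → v ∈ Bl :=
      fun o ho v hv hall => Finset.mem_filter.2
        ⟨Finset.mem_univ _, own2 o (hO o ho).1 (hO o ho).2.2 v hv, hall⟩
    let Y₂ := Y₁.filter fun j => ¬ H.Adj a (y j)
    -- If `a` is adjacent to `y j`, then an unused private neighbor of `y j` would make it satisfy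
    -- `Star`. Hence `y j` is blocked.
    have hY₁₂ : Y₁.card ≤ Y₂.card + Bl.card := by
      have e1 : (Y₁.filter fun j => H.Adj a (y j)).card + Y₂.card = Y₁.card :=
        Finset.card_filter_add_card_filter_not _
      have e2 : (Y₁.filter fun j => H.Adj a (y j)).card ≤ Bl.card := by
        refine Finset.card_le_card_of_injOn y ?_ yinj.injOn
        intro j hj
        obtain ⟨h1, h2⟩ := Finset.mem_filter.1 (Finset.mem_coe.1 hj)
        obtain ⟨h3, h4⟩ := Finset.mem_filter.1 h1
        obtain ⟨o, ho, hjo⟩ := yOadj j h4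
        refine Finset.mem_coe.2 (ownB o ho _ hjo fun w hw => ?_)
        by_contra hwu
        obtain ⟨hwI, hvw⟩ := own1 _ _ hw
        exact hstar j h3 h4 (Or.inr ⟨h2, w, hwI, hwu, hvw⟩)
      omega
    let T := O.filter fun o => ∃ j ∈ Y₂, H.Adj (y j) o
    -- All of `T` is used, since otherwise `Star` would hold. By the orientation no vertex of `T` is
    -- the second of its path; those in third place are counted by `N₁`; and by the extremal choice
    -- of `g`, the path neighbor of one at either end is blocked.
    have hT : T.card ≤ N₁.card + 2 * Bl.card := by
      let E₀ := Finset.univ.filter fun i => g i 0 ∈ O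
      let E₃ := Finset.univ.filter fun i => g i 3 ∈ O
      have hE₀ : E₀.card ≤ Bl.card := by
        refine Finset.card_le_card_of_injOn (fun i => g i 1) ?_
          fun i _ j _ h => (hg.inj _ _ _ _ h).1
        intro i hi
        have hi' := (Finset.mem_filter.1 (Finset.mem_coe.1 hi)).2
        exact Finset.mem_coe.2 (ownB _ hi' _ (hg.path i).1.symm ((hend i).1 hi'))
      have hE₃ : E₃.card ≤ Bl.card := by
        refine Finset.card_le_card_of_injOn (fun i => g i 2) ?_
          fun i _ j _ h => (hg.inj _ _ _ _ h).1
        intro i hi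
        have hi' := (Finset.mem_filter.1 (Finset.mem_coe.1 hi)).2
        exact Finset.mem_coe.2 (ownB _ hi' _ (hg.path i).2.2 ((hend i).2 hi'))
      have hsub : T ⊆ (N₁.image fun i => g i 2) ∪ ((E₀.image fun i => g i 0) ∪
          (E₃.image fun i => g i 3)) := by
        intro o ho
        obtain ⟨hoO, j, hj, hjo⟩ := Finset.mem_filter.1 ho
        obtain ⟨hj1, hj2⟩ := Finset.mem_filter.1 hj
        obtain ⟨hjY, hjact⟩ := Finset.mem_filter.1 hj1
        have hou : o ∈ usedBy g := by
          by_contra hcon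
          exact hstar j hjY hjact (Or.inl ⟨o, hoO, hcon, hjo⟩)
        obtain ⟨i, c, hic⟩ := mem_usedBy.1 hou
        simp only [Finset.mem_union, Finset.mem_image]
        have hc : c = 0 ∨ c = 1 ∨ c = 2 ∨ c = 3 := by omega
        rcases hc with rfl | rfl | rfl | rfl
        · exact Or.inr (Or.inl ⟨i, by simp [E₀, hic, hoO], hic⟩)
        · exact absurd (hic ▸ (hO o hoO).1) (hor i)
        · refine Or.inl ⟨i, ?_, hic⟩
          refine Finset.mem_filter.2 ⟨Finset.mem_univ _, Finset.mem_biUnion.2 ⟨j, hjY, ?_⟩, hic ▸ hoO⟩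
          simp only [t, if_pos hjact, Finset.mem_filter, Finset.mem_univ, true_and]
          exact Or.inr ⟨i, rfl, hic ▸ hoO, hic ▸ hjo⟩
        · exact Or.inr (Or.inr ⟨i, by simp [E₃, hic, hoO], hic⟩)
      have h1 := Finset.card_le_card hsub
      have h2 := Finset.card_union_le (N₁.image fun i => g i 2) ((E₀.image fun i => g i 0) ∪
          (E₃.image fun i => g i 3))
      have h3 := Finset.card_union_le (E₀.image fun i => g i 0) (E₃.image fun i => g i 3)
      have h4 := Finset.card_image_le (s := N₁) (f := fun i => g i 2)
      have h5 := Finset.card_image_le (s := E₀) (f := fun i => g i 0)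
      have h6 := Finset.card_image_le (s := E₃) (f := fun i => g i 3)
      omega
    have hdeg : ∀ j ∈ Y₂, 14 * s ≤ (T.bipartiteAbove (fun j o => H.Adj (y j) o) j).card := by
      intro j hj
      obtain ⟨hj1, hj2⟩ := Finset.mem_filter.1 hj
      obtain ⟨hjY, hjact⟩ := Finset.mem_filter.1 hj1
      refine (many _ (yne j) hj2 (yOadj j hjact)).trans (Finset.card_le_card fun o ho => ?_)
      obtain ⟨h1, h2⟩ := Finset.mem_filter.1 ho
      exact Finset.mem_filter.2 ⟨Finset.mem_filter.2 ⟨h1, j, hj, h2⟩, h2⟩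
    have hdeg' : ∀ o ∈ T, (Y₂.bipartiteBelow (fun j o => H.Adj (y j) o) o).card ≤ s := by
      intro o ho
      refine le_trans (Finset.card_le_card_of_injOn y ?_ yinj.injOn)
        (few o (Finset.mem_filter.1 ho).1)
      intro j hj
      obtain ⟨h1, h2⟩ := Finset.mem_filter.1 (Finset.mem_coe.1 hj)
      exact Finset.mem_coe.2 (Finset.mem_filter.2
        ⟨Finset.mem_univ _, yne j, h2, (Finset.mem_filter.1 h1).2⟩)
    have hcount : Y₂.card * (14 * s) ≤ T.card * s := by
      have e1 := Finset.sum_card_bipartiteAbove_eq_sum_card_bipartiteBelow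
        (s := Y₂) (t := T) (fun j o => H.Adj (y j) o)
      calc Y₂.card * (14 * s) ≤ _ := by
            rw [← smul_eq_mul]
            exact Finset.card_nsmul_le_sum _ _ _ hdeg
        _ = _ := e1
        _ ≤ T.card * s := by
            rw [← smul_eq_mul]
            exact Finset.sum_le_card_nsmul _ _ _ hdeg'
    have hTbig : 14 * s ≤ T.card := by
      have hn : none ∈ Y₂ := by
        refine Finset.mem_filter.2 ⟨Finset.mem_filter.2 ⟨hnone.1, ?_⟩, hab⟩
        intro i hi
        cases hi
      exact (hdeg _ hn).trans (Finset.card_le_card (Finset.filter_subset _ _))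
    have hcount' : Y₂.card * 14 ≤ T.card := by
      have : (Y₂.card * 14) * s ≤ T.card * s := by linarith
      exact Nat.le_of_mul_le_mul_right this hs
    -- The contradiction: `|T| ≤ |N₁| + 2|Bl| < |Y₂| + 3|Bl| < |Y₂| + 12 * s`, where both `14|Y₂|`
    -- and `14 * s` are at most `|T|`, so that `|T|` would be less than `13/14` of itself.
    omega
  obtain ⟨φ, φinj, hφ⟩ := (Finset.all_card_le_biUnion_card_iff_exists_injective t).1 hall
  let e : Equiv.Perm (Option (Fin m)) := Equiv.ofBijective φ (Finite.injective_iff_bijective.1 φinj)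
  have he : ∀ l, l ∈ t (e.symm l) := by
    intro l
    have := hφ (e.symm l)
    have h2 : φ (e.symm l) = l := e.apply_symm_apply l
    rwa [h2] at this
  have hnact : ∀ i, g i 2 ∉ O → e.symm (some i) = some i := by
    intro i hi
    have h1 := hφ (some i)
    have h2 : ¬ act (some i) := fun h => hi (h i rfl)
    simp only [t, if_neg h2, Finset.mem_singleton] at h1
    rw [Equiv.symm_apply_eq]
    exact h1.symm
  have hpath : ∀ i, g i 2 ∈ O → H.Adj (y (e.symm (some i))) (g i 2) := by
    intro i hi
    have h1 := he (some i)
    by_cases hact : act (e.symm (some i))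
    · simp only [t, if_pos hact, Finset.mem_filter, Finset.mem_univ, true_and] at h1
      rcases h1 with ⟨h1, -⟩ | ⟨i', h1, -, h2⟩
      · cases h1
      · rw [← Option.some.inj h1] at h2
        exact h2
    · simp only [t, if_neg hact, Finset.mem_singleton] at h1
      exact absurd (fun i' hi' => by rw [← h1] at hi'; rw [← Option.some.inj hi']; exact hi) hact
  have hst : Star (y (e.symm none)) := by
    have h1 := he none
    by_cases hact : act (e.symm none)
    · simp only [t, if_pos hact, Finset.mem_filter, Finset.mem_univ, true_and] at h1
      rcases h1 with h1 | ⟨i', h1, -, h2⟩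
      · exact h1
      · cases h1
    · simp only [t, if_neg hact, Finset.mem_singleton] at h1
      exact absurd (fun i' hi' => by rw [← h1] at hi'; cases hi') hact
  -- `w` is the further vertex of the new path.
  obtain ⟨w, hwI, hwu, hw⟩ : ∃ w ∈ I, w ∉ usedBy g ∧
      ((H.Adj a w ∧ H.Adj (y (e.symm none)) w) ∨
        (H.Adj a (y (e.symm none)) ∧ H.Adj (y (e.symm none)) w)) := by
    rcases hst with ⟨o, ho, h1, h2⟩ | ⟨h1, w, h2, h3, h4⟩
    · exact ⟨o, (hO o ho).1, h1, Or.inl ⟨(hO o ho).2.1, h2⟩⟩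
    · exact ⟨w, h2, h3, Or.inr ⟨h1, h4⟩⟩
  -- At most `4 * m + 1 < 4 * k` vertices are used or equal to `w`.
  obtain ⟨p, hp, hpn⟩ := exists_mem_notMem_of_card (A := I.filter fun o => H.Adj a o)
    (B := insert w (usedBy g)) (by
      have := Finset.card_insert_le w (usedBy g)
      omega)
  obtain ⟨hpI, hap⟩ := Finset.mem_filter.1 hp
  simp only [Finset.mem_insert, not_or] at hpn
  have hq : Function.Injective ![p, a, w, b] := injective_vec4
    ⟨fun h => ha (h ▸ hpI), hpn.1, fun h => hb (h ▸ hpI), fun h => ha (h ▸ hwI), hne,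
      fun h => hb (h ▸ hwI)⟩
  have hd : ∀ j c d, g j c ≠ ![p, a, w, b] d := by
    intro j c d h
    have hu : g j c ∈ usedBy g := mem_usedBy.2 ⟨j, c, rfl⟩
    fin_cases d
    · exact hpn.2 (by rw [← show g j c = p from h]; exact hu)
    · exact ha' _ _ h
    · exact hwu (by rw [← show g j c = w from h]; exact hu)
    · exact hb' _ _ h
  let g' : Option (Fin m) → Fin 4 → V := fun l => l.elim ![p, a, w, b] g
  have g'inj : ∀ i j c d, g' i c = g' j d → i = j ∧ c = d := inj_option hg.inj hq hd
  have yg' : ∀ l, y l = g' l 3 := by rintro (_ | i) <;> rfl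
  -- Every path keeps its first three vertices; only the last ones are permuted.
  let f : Option (Fin m) → Fin 4 → V := fun l c => if c = 3 then g' (e.symm l) 3 else g' l c
  refine hasPacking_of_perm (ι := Option (Fin m)) (f := f) ?_ ?_ (by simp)
  · intro i j c d h
    by_cases hc : c = 3 <;> by_cases hd : d = 3
    · simp only [f, if_pos hc, if_pos hd] at h
      exact ⟨e.symm.injective (g'inj _ _ _ _ h).1, hc.trans hd.symm⟩
    · simp only [f, if_pos hc, if_neg hd] at h
      exact absurd (g'inj _ _ _ _ h).2.symm hd
    · simp only [f, if_neg hc, if_pos hd] at h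
      exact absurd (g'inj _ _ _ _ h).2 hc
    · simp only [f, if_neg hc, if_neg hd] at h
      exact g'inj _ _ _ _ h
  · rintro (_ | i)
    · have f0 : f none 0 = p := rfl
      have f1 : f none 1 = a := rfl
      have f2 : f none 2 = w := rfl
      have f3 : f none 3 = y (e.symm none) := by rw [yg']; rfl
      rcases hw with ⟨h1, h2⟩ | ⟨h1, h2⟩
      · refine ⟨1, ?_, ?_, ?_⟩
        · change H.Adj (f none 0) (f none 1)
          rw [f0, f1]; exact hap.symm
        · change H.Adj (f none 1) (f none 2)
          rw [f1, f2]; exact h1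
        · change H.Adj (f none 2) (f none 3)
          rw [f2, f3]; exact h2.symm
      -- Here the new last vertex is itself adjacent to `a`, and it comes before `w` on the path.
      · refine ⟨Equiv.swap 2 3, ?_, ?_, ?_⟩
        · change H.Adj (f none 0) (f none 1)
          rw [f0, f1]; exact hap.symm
        · change H.Adj (f none 1) (f none 3)
          rw [f1, f3]; exact h1
        · change H.Adj (f none 3) (f none 2)
          rw [f2, f3]; exact h2
    · refine ⟨1, (hg.path i).1, (hg.path i).2.1, ?_⟩
      have f3 : f (some i) 3 = y (e.symm (some i)) := by rw [yg']; rfl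
      change H.Adj (g i 2) (f (some i) 3)
      rw [f3]
      by_cases hi : g i 2 ∈ O
      · exact (hpath i hi).symm
      · rw [hnact i hi]
        exact (hg.path i).2.2

end Link


/-! ### Graphs with a set of vertices that meets all four-vertex paths -/

/-- The graph without the edges that meet `B`. -/
def isolate {V : Type*} (G : SimpleGraph V) (B : Finset V) : SimpleGraph V where
  Adj x y := G.Adj x y ∧ x ∉ B ∧ y ∉ B
  symm := ⟨fun _ _ h => ⟨h.1.symm, h.2.2, h.2.1⟩⟩
  loopless := ⟨fun _ h => h.1.ne rfl⟩

section Structure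

open scoped Classical

variable {V : Type*} [Fintype V] (G : SimpleGraph V) (S : Finset V)

/-- The number of neighbors outside `S`. -/
noncomputable def outDegree (v : V) : ℕ :=
  (Finset.univ.filter fun y => y ∉ S ∧ G.Adj v y).card

/-- Outside `S`: the vertices of the triangles, the centers of the stars, and the endpoints of
the isolated edges. -/
noncomputable def core : Finset V :=
  Finset.univ.filter fun v => v ∉ S ∧
    (2 ≤ outDegree G S v ∨ ∃ y, y ∉ S ∧ G.Adj v y ∧ outDegree G S y ≤ 1)

/-- Outside `S`: the isolated vertices and the leaves of the stars. -/
noncomputable def periphery : Finset V :=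
  Finset.univ.filter fun v => v ∉ S ∧ v ∉ core G S

/-- The vertex `a` of `S` has a neighbor in the component of `d` outside `S`. -/
def Touches (a d : V) : Prop :=
  a ∈ S ∧ d ∈ core G S ∧ ∃ x, x ∉ S ∧ G.Adj a x ∧ (x = d ∨ G.Adj x d)

/-- The vertices of `S` that touch many components. -/
noncomputable def rich (k : ℕ) : Finset V :=
  Finset.univ.filter fun a => a ∈ S ∧ 12 * k ≤ (Finset.univ.filter fun d => Touches G S a d).card

/-- The rich vertices and the vertices of the core that only rich vertices touch. -/
noncomputable def dispensable (k : ℕ) : Finset V :=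
  Finset.univ.filter fun v => v ∈ rich G S k ∨
    (v ∈ core G S ∧ ¬ ∃ a, Touches G S a v ∧ a ∉ rich G S k)

/-- Every four-vertex path meets `S`. -/
def MeetsPaths : Prop := ∀ a b c d : V, a ∉ S → b ∉ S → c ∉ S → d ∉ S →
  a ≠ c → a ≠ d → b ≠ d → G.Adj a b → G.Adj b c → G.Adj c d → False

variable {G S}

theorem mem_core {v : V} : v ∈ core G S ↔ v ∉ S ∧
    (2 ≤ outDegree G S v ∨ ∃ y, y ∉ S ∧ G.Adj v y ∧ outDegree G S y ≤ 1) := by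
  simp [core]

theorem mem_periphery {v : V} : v ∈ periphery G S ↔ v ∉ S ∧ v ∉ core G S := by
  simp [periphery]

theorem mem_cases (v : V) : v ∈ S ∨ v ∈ core G S ∨ v ∈ periphery G S := by
  rw [mem_periphery]; tauto

theorem notMem_periphery_iff {v : V} : v ∉ periphery G S ↔ v ∈ S ∨ v ∈ core G S := by
  rw [mem_periphery]; tauto

theorem notMem_of_mem_core {v : V} (h : v ∈ core G S) : v ∉ S := (mem_core.1 h).1

theorem two_le_outDegree {v x y : V} (hx : x ∉ S) (hy : y ∉ S) (hvx : G.Adj v x)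
    (hvy : G.Adj v y) (hxy : x ≠ y) : 2 ≤ outDegree G S v := by
  refine Finset.one_lt_card.2 ⟨x, by simp [hx, hvx], y, by simp [hy, hvy], hxy⟩

theorem exists_ne_of_two_le {v : V} (h : 2 ≤ outDegree G S v) (x : V) :
    ∃ z, z ≠ x ∧ z ∉ S ∧ G.Adj v z := by
  obtain ⟨z, hz, hzx⟩ := Finset.exists_mem_ne h x
  simp only [Finset.mem_filter, Finset.mem_univ, true_and] at hz
  exact ⟨z, hzx, hz⟩

theorem exists_adj_of_mem_core {d : V} (h : d ∈ core G S) : ∃ z, z ∉ S ∧ G.Adj d z := by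
  rcases (mem_core.1 h).2 with h | ⟨y, h1, h2, -⟩
  · obtain ⟨z, -, hz⟩ := exists_ne_of_two_le h d
    exact ⟨z, hz⟩
  · exact ⟨y, h1, h2⟩

theorem exists_ne_of_mem_core {d x : V} (h : d ∈ core G S) (hx : 2 ≤ outDegree G S x) :
    ∃ z, z ≠ x ∧ z ∉ S ∧ G.Adj d z := by
  rcases (mem_core.1 h).2 with h | ⟨y, h1, h2, h3⟩
  · exact exists_ne_of_two_le h x
  · exact ⟨y, fun hyx => by subst hyx; omega, h1, h2⟩

theorem outDegree_le_of_mem_periphery {o : V} (ho : o ∈ periphery G S) : outDegree G S o ≤ 1 := by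
  obtain ⟨h1, h2⟩ := mem_periphery.1 ho
  by_contra hcon
  exact h2 (mem_core.2 ⟨h1, Or.inl (by omega)⟩)

/-- Since `o` has at most one neighbor outside `S`, the second clause in the definition of the core
applies to each of its neighbors outside `S`. So the periphery is independent. -/
theorem not_adj_of_mem_periphery {o v : V} (ho : o ∈ periphery G S) (h : G.Adj o v) :
    v ∉ periphery G S := by
  intro hv
  exact (mem_periphery.1 hv).2 (mem_core.2 ⟨(mem_periphery.1 hv).1, Or.inr
    ⟨o, (mem_periphery.1 ho).1, h.symm, outDegree_le_of_mem_periphery ho⟩⟩)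

theorem eq_of_mem_periphery {o x y : V} (ho : o ∈ periphery G S) (hx : x ∉ S) (hy : y ∉ S)
    (hox : G.Adj o x) (hoy : G.Adj o y) : x = y := by
  by_contra hne
  have h1 := two_le_outDegree hx hy hox hoy hne
  have h2 := outDegree_le_of_mem_periphery ho
  omega

/-- If `y` were at distance two from `d` through `x`, then `x` would have two neighbors outside `S`,
and the core vertex `d` would have a neighbor `z` other than `x`. The path `z d x y` would avoid
`S`. So a core vertex together with its neighbors outside `S` forms a whole component. -/
theorem closed_core (hP : MeetsPaths G S) {d x y : V} (hd : d ∈ core G S) (hx : x ∉ S)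
    (hxd : x = d ∨ G.Adj x d) (hy : y ∉ S) (hxy : G.Adj x y) : y = d ∨ G.Adj y d := by
  rcases hxd with rfl | hxd
  · exact Or.inr hxy.symm
  · by_cases hyd : y = d
    · exact Or.inl hyd
    · right
      by_contra hcon
      have hds := notMem_of_mem_core hd
      obtain ⟨z, hz1, hz2, hz3⟩ :=
        exists_ne_of_mem_core hd (two_le_outDegree hds hy hxd hxy (Ne.symm hyd))
      refine hP z d x y hz2 hds hx hy hz1 ?_ (Ne.symm hyd) hz3.symm hxd.symm hxy
      rintro rfl
      exact hcon hz3.symm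

theorem core_adj_of_common (hP : MeetsPaths G S) {d d' x : V} (hd : d ∈ core G S)
    (hd' : d' ∈ core G S) (hx : x ∉ S) (h : x = d ∨ G.Adj x d) (h' : x = d' ∨ G.Adj x d') :
    d = d' ∨ G.Adj d d' := by
  rcases h' with rfl | h'
  · rcases h with h | h
    · exact Or.inl h.symm
    · exact Or.inr h.symm
  · rcases closed_core hP hd hx h (notMem_of_mem_core hd') h' with h | h
    · exact Or.inl h.symm
    · exact Or.inr h.symm

/-- Core vertices of the same component are pairwise adjacent, so four of them would form a path
outside `S`. A triangle attains the bound. -/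
theorem card_core_near_le (hP : MeetsPaths G S) {x : V} (hx : x ∉ S) :
    ((core G S).filter fun d => x = d ∨ G.Adj x d).card ≤ 3 := by
  by_contra hcon
  push Not at hcon
  obtain ⟨t, hts, htc⟩ := Finset.exists_subset_card_eq (show 4 ≤ _ from hcon)
  have e : Fin 4 ≃ t := Fintype.equivOfCardEq (by simp [htc])
  have hmem : ∀ i, (e i).1 ∈ core G S ∧ (x = (e i).1 ∨ G.Adj x (e i).1) := fun i =>
    Finset.mem_filter.1 (hts (e i).2)
  have hne : ∀ i j, i ≠ j → (e i).1 ≠ (e j).1 := fun i j hij h => hij (e.injective (Subtype.ext h))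
  have hadj : ∀ i j, i ≠ j → G.Adj (e i).1 (e j).1 := fun i j hij =>
    (core_adj_of_common hP (hmem i).1 (hmem j).1 hx (hmem i).2 (hmem j).2).resolve_left
      (hne i j hij)
  have hout : ∀ i, (e i).1 ∉ S := fun i => notMem_of_mem_core (hmem i).1
  exact hP _ _ _ _ (hout 0) (hout 1) (hout 2) (hout 3) (hne 0 2 (by decide)) (hne 0 3 (by decide))
    (hne 1 3 (by decide)) (hadj 0 1 (by decide)) (hadj 1 2 (by decide)) (hadj 2 3 (by decide))

theorem mem_rich {k : ℕ} {a : V} : a ∈ rich G S k ↔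
    a ∈ S ∧ 12 * k ≤ (Finset.univ.filter fun d => Touches G S a d).card := by
  simp [rich]

theorem mem_dispensable {k : ℕ} {v : V} : v ∈ dispensable G S k ↔ v ∈ rich G S k ∨
    (v ∈ core G S ∧ ¬ ∃ a, Touches G S a v ∧ a ∉ rich G S k) := by
  simp [dispensable]

/-- A rich vertex can be removed together with one path. -/
theorem hasPacking_isolate_insert_iff (hP : MeetsPaths G S) {A : Finset V} {a : V} {k m : ℕ}
    (hA : A ⊆ S) (ha : a ∈ rich G S k) (haA : a ∉ A) (hm : m ≤ k) :
    HasPacking (isolate G A) m ↔ HasPacking (isolate G (insert a A)) (m - 1) := by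
  obtain ⟨haS, hak⟩ := mem_rich.1 ha
  constructor
  · rintro ⟨f, hf⟩
    rcases m with _ | m
    · exact hasPacking_zero
    -- The path through `a` is given up, or an arbitrary one if no path contains `a`.
    obtain ⟨i, hi⟩ : ∃ i, ∀ j ≠ i, ∀ c, f j c ≠ a := by
      by_cases h : ∃ i c, f i c = a
      · obtain ⟨i, c, hic⟩ := h
        exact ⟨i, fun j hj d hd => hj (hf.inj _ _ _ _ (hd.trans hic.symm)).1⟩
      · push Not at h
        exact ⟨0, fun j _ => h j⟩
    refine ⟨f ∘ i.succAbove, ?_⟩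
    have h1 := hf.comp _ (Fin.succAbove_right_injective (p := i))
    refine ⟨h1.inj, fun j => ?_⟩
    have h2 := h1.path j
    have h3 : ∀ c, f (i.succAbove j) c ≠ a := hi _ (Fin.succAbove_ne i j)
    have h4 : ∀ c d, (isolate G A).Adj (f (i.succAbove j) c) (f (i.succAbove j) d) →
        (isolate G (insert a A)).Adj (f (i.succAbove j) c) (f (i.succAbove j) d) := by
      intro c d h
      exact ⟨h.1, by simp [h3, h.2.1], by simp [h3, h.2.2]⟩
    exact ⟨h4 _ _ h2.1, h4 _ _ h2.2.1, h4 _ _ h2.2.2⟩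
  · intro hpack
    rcases m with _ | m
    · exact hasPacking_zero
    obtain ⟨f, hf⟩ : HasPacking (isolate G (insert a A)) m := hpack
    have hU : (usedBy f).card ≤ 4 * m := by simpa using card_usedBy_le f
    have haU : ∀ i c, f i c ≠ a := by
      intro i c h
      obtain ⟨v, hv⟩ := hf.exists_adj i c
      rw [h] at hv
      exact hv.2.1 (Finset.mem_insert_self _ _)
    let N : V → Finset V := fun x =>
      if x ∈ S then ∅ else (core G S).filter fun d => x = d ∨ G.Adj x d
    have hN : ∀ x, (N x).card ≤ 3 := by
      intro x
      by_cases hx : x ∈ S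
      · simp [N, hx]
      · simpa [N, hx] using card_core_near_le hP hx
    have memN : ∀ x d, x ∉ S → d ∈ core G S → (x = d ∨ G.Adj x d) → d ∈ N x := by
      intro x d hx hd h
      simp [N, hx, hd, h]
    -- The used vertices block at most `12 * m` core vertices, and the vertices `x₁` and `y₁` of a
    -- first free component block at most `6` more. Since `12 * m + 6 < 12 * k`, two free components
    -- can be found in turn, and they provide the new path `x₂ a x₁ y₁`.
    have hNU : ((usedBy f).biUnion N).card ≤ (usedBy f).card * 3 :=
      Finset.card_biUnion_le_card_mul _ _ _ fun x _ => hN x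
    obtain ⟨d₁, hd₁, hd₁U⟩ := exists_mem_notMem_of_card
      (A := Finset.univ.filter fun d => Touches G S a d) (B := (usedBy f).biUnion N) (by omega)
    obtain ⟨-, hd₁c, x₁, hx₁, hax₁, hx₁d⟩ := (Finset.mem_filter.1 hd₁).2
    obtain ⟨y₁, hy₁, hxy₁⟩ : ∃ y, y ∉ S ∧ G.Adj x₁ y := by
      rcases hx₁d with rfl | h
      · exact exists_adj_of_mem_core hd₁c
      · exact ⟨d₁, notMem_of_mem_core hd₁c, h⟩
    have hy₁d := closed_core hP hd₁c hx₁ hx₁d hy₁ hxy₁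
    obtain ⟨d₂, hd₂, hd₂U⟩ := exists_mem_notMem_of_card
      (A := Finset.univ.filter fun d => Touches G S a d)
      (B := (usedBy f).biUnion N ∪ (N x₁ ∪ N y₁)) (by
        have h1 := Finset.card_union_le ((usedBy f).biUnion N) (N x₁ ∪ N y₁)
        have h2 := Finset.card_union_le (N x₁) (N y₁)
        have h3 := hN x₁
        have h4 := hN y₁
        omega)
    obtain ⟨-, hd₂c, x₂, hx₂, hax₂, hx₂d⟩ := (Finset.mem_filter.1 hd₂).2
    simp only [Finset.mem_union, not_or] at hd₂U
    have hx₂₁ : x₂ ≠ x₁ := fun h => hd₂U.2.1 (memN _ _ hx₁ hd₂c (h ▸ hx₂d))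
    have hx₂y : x₂ ≠ y₁ := fun h => hd₂U.2.2 (memN _ _ hy₁ hd₂c (h ▸ hx₂d))
    have nU : ∀ x d, x ∉ S → d ∈ core G S → (x = d ∨ G.Adj x d) → d ∉ (usedBy f).biUnion N →
        ∀ i c, f i c ≠ x := by
      intro x d h1 h2 h3 h4 i c h5
      exact h4 (Finset.mem_biUnion.2 ⟨x, mem_usedBy.2 ⟨i, c, h5⟩, memN x d h1 h2 h3⟩)
    have hne : ∀ x, x ∉ S → a ≠ x := fun x hx h => hx (h ▸ haS)
    have hnA : ∀ x, x ∉ S → x ∉ A := fun x hx h => hx (hA h)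
    have hf' : IsPacking (isolate G A) f := hf.mono fun x y (h : (isolate G (insert a A)).Adj x y) =>
      ⟨h.1, fun h' => h.2.1 (Finset.mem_insert_of_mem h'),
        fun h' => h.2.2 (Finset.mem_insert_of_mem h')⟩
    refine (isPacking_option hf' (q := ![x₂, a, x₁, y₁])
      (injective_vec4 ⟨(hne _ hx₂).symm, hx₂₁, hx₂y, hne _ hx₁, hne _ hy₁, hxy₁.ne⟩)
      ⟨⟨hax₂.symm, hnA _ hx₂, haA⟩, ⟨hax₁, haA, hnA _ hx₁⟩, ⟨hxy₁, hnA _ hx₁, hnA _ hy₁⟩⟩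
      ?_).hasPacking (by simp)
    intro j c d
    fin_cases d
    · exact nU _ _ hx₂ hd₂c hx₂d hd₂U.1 j c
    · exact haU j c
    · exact nU _ _ hx₁ hd₁c hx₁d hd₁U j c
    · exact nU _ _ hy₁ hd₁c hy₁d hd₁U j c

/-- The rich vertices are isolated one at a time, each at the price of one path. Truncated
subtraction does no harm: once the parameter is zero, both sides hold trivially. -/
theorem hasPacking_isolate_rich_iff (hP : MeetsPaths G S) (k : ℕ) :
    HasPacking G k ↔ HasPacking (isolate G (rich G S k)) (k - (rich G S k).card) := by
  suffices ∀ A ⊆ rich G S k, HasPacking G k ↔ HasPacking (isolate G A) (k - A.card) from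
    this _ subset_rfl
  intro A
  induction A using Finset.induction_on with
  | empty =>
    intro _
    have : isolate G ∅ = G := by ext; simp [isolate]
    simp [this]
  | insert a A haA ih =>
    intro hA
    rw [ih ((Finset.subset_insert _ _).trans hA),
      hasPacking_isolate_insert_iff hP (k := k) (a := a) _ (hA (Finset.mem_insert_self _ _)) haA
        (Nat.sub_le _ _), Finset.card_insert_of_notMem haA, Nat.sub_sub]
    intro x hx
    exact (mem_rich.1 (hA (Finset.mem_insert_of_mem hx))).1

/-- No path meets the vertices of the core that only rich vertices touch. -/
theorem hasPacking_isolate_dispensable_iff (hP : MeetsPaths G S) (k : ℕ) :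
    HasPacking G k ↔ HasPacking (isolate G (dispensable G S k)) (k - (rich G S k).card) := by
  rw [hasPacking_isolate_rich_iff hP]
  refine ⟨?_, HasPacking.mono fun x y h => ⟨h.1, fun h' => h.2.1 (mem_dispensable.2 (Or.inl h')),
    fun h' => h.2.2 (mem_dispensable.2 (Or.inl h'))⟩⟩
  rintro ⟨f, hf⟩
  have key : ∀ i c, f i c ∉ dispensable G S k := by
    intro i c hic
    obtain ⟨v, hv⟩ := hf.exists_adj i c
    rcases mem_dispensable.1 hic with h | ⟨hd, hun⟩
    · exact hv.2.1 h
    -- The component of `f i c` has no neighbor in `S` left, so the path would lie entirely outside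
    -- `S`.
    · have hall := (hf.path i).forall_of_closed
        (P := fun x => x ∉ S ∧ (x = f i c ∨ G.Adj x (f i c))) (c := c) (by
          rintro x y ⟨hx, hxd⟩ hxy
          have hy : y ∉ S := fun hy => hun ⟨y, ⟨hy, hd, x, hx, hxy.1.symm, hxd⟩, hxy.2.2⟩
          exact ⟨hy, closed_core hP hd hx hxd hy hxy.1⟩) ⟨notMem_of_mem_core hd, Or.inl rfl⟩
      have hne : ∀ c d, c ≠ d → f i c ≠ f i d := fun c d hcd h => hcd (hf.inj _ _ _ _ h).2
      exact hP _ _ _ _ (hall 0).1 (hall 1).1 (hall 2).1 (hall 3).1 (hne _ _ (by decide))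
        (hne _ _ (by decide)) (hne _ _ (by decide)) (hf.path i).1.1 (hf.path i).2.1.1
        (hf.path i).2.2.1
  refine ⟨f, hf.inj, fun i => ?_⟩
  obtain ⟨h1, h2, h3⟩ := hf.path i
  exact ⟨⟨h1.1, key _ _, key _ _⟩, ⟨h2.1, key _ _, key _ _⟩, ⟨h3.1, key _ _, key _ _⟩⟩

theorem touches_of_isolate_adj {k : ℕ} {a d : V} (ha : a ∈ S) (hd : d ∈ core G S)
    (h : (isolate G (dispensable G S k)).Adj a d) : Touches G S a d ∧ a ∉ rich G S k :=
  ⟨⟨ha, hd, d, notMem_of_mem_core hd, h.1, Or.inl rfl⟩,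
    fun h' => h.2.1 (mem_dispensable.2 (Or.inl h'))⟩

/-- The common neighbor `o` belongs to the component of `d`. Thus edges that are later added because
of common neighbors join `a` only to core vertices that it touches anyway, and the bound `12 * k`
survives. -/
theorem touches_of_common {k : ℕ} {a d o : V} (ha : a ∈ S) (hd : d ∈ core G S)
    (ho : o ∈ periphery G S) (h : (isolate G (dispensable G S k)).Adj a o)
    (h' : (isolate G (dispensable G S k)).Adj d o) : Touches G S a d ∧ a ∉ rich G S k :=
  ⟨⟨ha, hd, o, (mem_periphery.1 ho).1, h.1, Or.inr h'.1.symm⟩,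
    fun h'' => h.2.1 (mem_dispensable.2 (Or.inl h''))⟩

theorem card_touches_lt {k : ℕ} {a : V} (ha : a ∈ S) (h : a ∉ rich G S k) :
    (Finset.univ.filter fun d => Touches G S a d).card < 12 * k := by
  by_contra hcon
  exact h (mem_rich.2 ⟨ha, not_lt.1 hcon⟩)

end Structure


/-! ### Adding and removing edges -/

section EdgeRules

open scoped Classical

variable {V : Type*} {K : SimpleGraph V} {m : ℕ}

/-- To remove an edge, it suffices to enlarge the packings that avoid it. -/
theorem HasPacking.deleteEdge_of_link {a b : V}
    (link : ∀ (l : ℕ) (g : Fin l → Fin 4 → V), l + 1 = m →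
      IsPacking (K.deleteEdges {s(a, b)}) g → (∀ i c, g i c ≠ a) → (∀ i c, g i c ≠ b) →
      HasPacking (K.deleteEdges {s(a, b)}) (l + 1))
    (h : HasPacking K m) : HasPacking (K.deleteEdges {s(a, b)}) m := by
  obtain ⟨f, hf⟩ := h
  rcases hf.deleteEdge_cases a b with h | ⟨i, ⟨c, d, hc, hd, -⟩, hi⟩
  · exact ⟨f, h⟩
  · rcases m with _ | l
    · exact i.elim0
    have h1 := hf.comp _ (Fin.succAbove_right_injective (p := i))
    refine link l _ rfl ⟨h1.inj, fun j => hi _ (Fin.succAbove_ne i j)⟩ ?_ ?_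
    · intro j e h
      exact Fin.succAbove_ne i j (hf.inj _ _ _ _ (h.trans hc.symm)).1
    · intro j e h
      exact Fin.succAbove_ne i j (hf.inj _ _ _ _ (h.trans hd.symm)).1

theorem deleteEdge_adj_of_ne {a o x y : V} (h : K.Adj x y) (hx : x ≠ o) (hy : y ≠ o) :
    (K.deleteEdges {s(a, o)}).Adj x y := by
  rw [SimpleGraph.deleteEdges_adj]
  refine ⟨h, fun hm => ?_⟩
  rcases Sym2.eq_iff.1 (Set.mem_singleton_iff.1 hm) with ⟨-, h2⟩ | ⟨h1, -⟩
  exacts [hy h2, hx h1]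

theorem deleteEdge_adj_of_ne_left {a o x y : V} (h : K.Adj x y) (hx : x ≠ a) (hy : y ≠ a) :
    (K.deleteEdges {s(a, o)}).Adj x y := by
  rw [Sym2.eq_swap]
  exact deleteEdge_adj_of_ne h hx hy

/-- If all other neighbors of `o` are adjacent to `a`, then the edge `ao` can be replaced by an
edge to another neighbor of `a`. -/
theorem HasPacking.deleteEdge_of_simplicial {a o : V} (hao : K.Adj a o)
    (hsimp : ∀ b, b ≠ a → K.Adj o b → K.Adj a b) {N : Finset V} (hN : ∀ p ∈ N, p ≠ o ∧ K.Adj a p)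
    (hcard : 4 * m ≤ N.card) (h : HasPacking K m) : HasPacking (K.deleteEdges {s(a, o)}) m := by
  obtain ⟨f, hf⟩ := h
  rcases hf.deleteEdge_cases a o with h | ⟨i, ⟨c, d, hc, hd, hcd⟩, hi⟩
  · exact ⟨f, h⟩
  -- The vertex `a` is used but not in `N`, so fewer than `4 * m` vertices of `N` can be used.
  obtain ⟨p, hpN, hpU⟩ : ∃ p ∈ N, p ∉ usedBy f := by
    by_contra hcon
    push Not at hcon
    have h1 : insert a N ⊆ usedBy f :=
      Finset.insert_subset (mem_usedBy.2 ⟨i, c, hc⟩) hcon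
    have h2 := Finset.card_le_card h1
    rw [Finset.card_insert_of_notMem fun h => (hN a h).2.ne rfl] at h2
    have h3 : (usedBy f).card ≤ 4 * m := by simpa using card_usedBy_le f
    omega
  obtain ⟨hpo, hap⟩ := hN p hpN
  have hpu : ∀ j e, f j e ≠ p := fun j e h => hpU (mem_usedBy.2 ⟨j, e, h⟩)
  have hne : ∀ e e', e ≠ e' → f i e ≠ f i e' := fun e e' h h' => h (hf.inj _ _ _ _ h').2
  have hap' : (K.deleteEdges {s(a, o)}).Adj a p := deleteEdge_adj_of_ne hap hao.ne hpo
  -- If `o` is an inner vertex with a second path neighbor `b`, the path is replaced by `p a b o`,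
  -- whose edge `ab` comes from the hypothesis on the neighbors of `o`.
  have mid : ∀ e, e ≠ c → e ≠ d → K.Adj o (f i e) → HasPacking (K.deleteEdges {s(a, o)}) m := by
    intro e hec hed hadj
    have hba : f i e ≠ a := hc ▸ hne _ _ hec
    have hbo : f i e ≠ o := hd ▸ hne _ _ hed
    refine ⟨_, isPacking_replace hf.inj i hi (q := ![p, a, f i e, o])
      (injective_vec4 ⟨hap.ne', (hpu _ _).symm, hpo, hba.symm, hao.ne, hbo⟩)
      ⟨hap'.symm, deleteEdge_adj_of_ne (hsimp _ hba hadj) hao.ne hbo, ?_⟩ ?_⟩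
    · exact deleteEdge_adj_of_ne_left hadj.symm hba hao.ne'
    · intro j hj x y hxy
      fin_cases y
      · exact hpu _ _ hxy
      · exact hj (hf.inj _ _ _ _ (hxy.trans hc.symm)).1
      · exact hj (hf.inj _ _ _ _ hxy).1
      · exact hj (hf.inj _ _ _ _ (hxy.trans hd.symm)).1
  have adj' : ∀ x y, x ≠ d → y ≠ d → K.Adj (f i x) (f i y) →
      (K.deleteEdges {s(a, o)}).Adj (f i x) (f i y) := fun x y hx hy h =>
    deleteEdge_adj_of_ne h (hd ▸ hne _ _ hx) (hd ▸ hne _ _ hy)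
  obtain ⟨p1, p2, p3⟩ := hf.path i
  have hcases : (c = 1 ∧ d = 0) ∨ (c = 2 ∧ d = 3) ∨ (c = 0 ∧ d = 1) ∨ (c = 2 ∧ d = 1) ∨
      (c = 1 ∧ d = 2) ∨ (c = 3 ∧ d = 2) := by omega
  -- If `o` is an end of the path, `p` takes its place.
  have final : IsPath4 (K.deleteEdges {s(a, o)}) (Function.update (f i) d p) →
      HasPacking (K.deleteEdges {s(a, o)}) m := by
    intro hpath
    refine ⟨_, isPacking_replace hf.inj i hi (q := Function.update (f i) d p) ?_ hpath ?_⟩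
    · intro x y h
      by_cases hx : x = d <;> by_cases hy : y = d
      · exact hx.trans hy.symm
      · rw [hx, Function.update_self, Function.update_of_ne hy] at h
        exact absurd h.symm (hpu _ _)
      · rw [hy, Function.update_self, Function.update_of_ne hx] at h
        exact absurd h (hpu _ _)
      · rw [Function.update_of_ne hx, Function.update_of_ne hy] at h
        exact (hf.inj _ _ _ _ h).2
    · intro j hj x y h
      by_cases hy : y = d
      · rw [hy, Function.update_self] at h
        exact hpu _ _ h
      · rw [Function.update_of_ne hy] at h
        exact hj (hf.inj _ _ _ _ h).1
  rcases hcases with ⟨rfl, rfl⟩ | ⟨rfl, rfl⟩ | ⟨rfl, rfl⟩ | ⟨rfl, rfl⟩ | ⟨rfl, rfl⟩ | ⟨rfl, rfl⟩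
  · refine final ⟨?_, adj' 1 2 (by decide) (by decide) p2, adj' 2 3 (by decide) (by decide) p3⟩
    change (K.deleteEdges {s(a, o)}).Adj p (f i 1)
    rw [hc]; exact hap'.symm
  · refine final ⟨adj' 0 1 (by decide) (by decide) p1, adj' 1 2 (by decide) (by decide) p2, ?_⟩
    change (K.deleteEdges {s(a, o)}).Adj (f i 2) p
    rw [hc]; exact hap'
  · exact mid 2 (by decide) (by decide) (hd ▸ p2)
  · exact mid 0 (by decide) (by decide) (hd ▸ p1.symm)
  · exact mid 3 (by decide) (by decide) (hd ▸ p3)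
  · exact mid 1 (by decide) (by decide) (hd ▸ p2.symm)

/-- If two vertices have the same neighbor and no other one, then one of the two edges can be
removed. -/
theorem HasPacking.deleteEdge_of_twin {u o o' : V} (hne : o ≠ o') (ho : ∀ v, K.Adj o v → v = u)
    (ho' : ∀ v, K.Adj o' v → v = u) (hu : K.Adj o u) (hu' : K.Adj o' u) (h : HasPacking K m) :
    HasPacking (K.deleteEdges {s(u, o)}) m := by
  obtain ⟨f, hf⟩ := h
  rcases hf.deleteEdge_cases u o with h | ⟨i, ⟨c, d, hc, hd, hcd⟩, hi⟩
  · exact ⟨f, h⟩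
  have hinj : ∀ e e', f i e = f i e' → e = e' := fun e e' h' => (hf.inj _ _ _ _ h').2
  obtain ⟨p1, p2, p3⟩ := hf.path i
  -- With `u` as its only neighbor, `o` must be an end of the path.
  have hcases : (c = 1 ∧ d = 0) ∨ (c = 2 ∧ d = 3) := by
    have h1 : d ≠ 1 := by
      rintro rfl
      have := hinj 0 2 ((ho _ (hd ▸ p1.symm)).trans (ho _ (hd ▸ p2)).symm)
      exact absurd this (by decide)
    have h2 : d ≠ 2 := by
      rintro rfl
      have := hinj 1 3 ((ho _ (hd ▸ p2.symm)).trans (ho _ (hd ▸ p3)).symm)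
      exact absurd this (by decide)
    omega
  -- A path through `o'` contains `u`, so it is the path `i`. There every place except that of `o`
  -- has a path neighbor other than `u`.
  have hunused : ∀ j e, f j e ≠ o' := by
    intro j e he
    have hnbr : ∀ e', K.Adj (f j e) (f j e') → j = i ∧ e' = c := fun e' h =>
      hf.inj _ _ _ _ ((ho' _ (he ▸ h)).trans hc.symm)
    obtain ⟨e', he'⟩ := (hf.path j).exists_adj_of_mem e
    obtain ⟨rfl, -⟩ := hnbr _ he'
    have hed : e ≠ d := fun h => hne (hd.symm.trans (h ▸ he))
    have h1 := fun e' h => (hnbr e' h).2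
    have : e = 0 ∨ e = 1 ∨ e = 2 ∨ e = 3 := by omega
    rcases hcases with ⟨rfl, rfl⟩ | ⟨rfl, rfl⟩ <;> rcases this with rfl | rfl | rfl | rfl
    · exact hed rfl
    · exact absurd (h1 _ p2) (by decide)
    · exact absurd (h1 _ p3) (by decide)
    · exact absurd (h1 _ p3.symm) (by decide)
    · exact absurd (h1 _ p1) (by decide)
    · exact absurd (h1 _ p1.symm) (by decide)
    · exact absurd (h1 _ p2.symm) (by decide)
    · exact hed rfl
  have hne' : ∀ e, e ≠ d → f i e ≠ o := fun e he h => he (hinj _ _ (h.trans hd.symm))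
  have adj' : ∀ x y, x ≠ d → y ≠ d → K.Adj (f i x) (f i y) →
      (K.deleteEdges {s(u, o)}).Adj (f i x) (f i y) := fun x y hx hy h =>
    deleteEdge_adj_of_ne h (hne' _ hx) (hne' _ hy)
  have hu2 : (K.deleteEdges {s(u, o)}).Adj u o' := deleteEdge_adj_of_ne hu'.symm hu.ne' hne.symm
  have final : IsPath4 (K.deleteEdges {s(u, o)}) (Function.update (f i) d o') →
      HasPacking (K.deleteEdges {s(u, o)}) m := by
    intro hpath
    refine ⟨_, isPacking_replace hf.inj i hi (q := Function.update (f i) d o') ?_ hpath ?_⟩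
    · intro x y h
      by_cases hx : x = d <;> by_cases hy : y = d
      · exact hx.trans hy.symm
      · rw [hx, Function.update_self, Function.update_of_ne hy] at h
        exact absurd h.symm (hunused _ _)
      · rw [hy, Function.update_self, Function.update_of_ne hx] at h
        exact absurd h (hunused _ _)
      · rw [Function.update_of_ne hx, Function.update_of_ne hy] at h
        exact (hf.inj _ _ _ _ h).2
    · intro j hj x y h
      by_cases hy : y = d
      · rw [hy, Function.update_self] at h
        exact hunused _ _ h
      · rw [Function.update_of_ne hy] at h
        exact hj (hf.inj _ _ _ _ h).1
  rcases hcases with ⟨rfl, rfl⟩ | ⟨rfl, rfl⟩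
  · refine final ⟨?_, adj' 1 2 (by decide) (by decide) p2, adj' 2 3 (by decide) (by decide) p3⟩
    change (K.deleteEdges {s(u, o)}).Adj o' (f i 1)
    rw [hc]; exact hu2.symm
  · refine final ⟨adj' 0 1 (by decide) (by decide) p1, adj' 1 2 (by decide) (by decide) p2, ?_⟩
    change (K.deleteEdges {s(u, o)}).Adj (f i 2) o'
    rw [hc]; exact hu2

end EdgeRules


/-! ### The transformations of the graph -/

section Transformations

open scoped Classical

variable {V : Type*} [Fintype V]

/-- The number of common neighbors in `I`. -/
noncomputable def commonCount (H : SimpleGraph V) (I : Finset V) (a b : V) : ℕ :=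
  (I.filter fun o => H.Adj a o ∧ H.Adj b o).card

/-- The graph with additional edges between the vertices of `S` and the vertices with which they
have many common neighbors. -/
def addCommon (H : SimpleGraph V) (S I : Finset V) (k : ℕ) : SimpleGraph V where
  Adj x y := H.Adj x y ∨
    (x ≠ y ∧ (x ∈ S ∨ y ∈ S) ∧ x ∉ I ∧ y ∉ I ∧ 4 * k ≤ commonCount H I x y)
  symm := ⟨fun _ _ h => h.imp SimpleGraph.Adj.symm fun ⟨h1, h2, h3, h4, h5⟩ =>
    ⟨h1.symm, h2.symm, h4, h3, by simpa only [commonCount, and_comm] using h5⟩⟩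
  loopless := ⟨fun _ h => h.elim (fun h => h.ne rfl) fun h => h.1 rfl⟩

/-- The graph `K` with additional edges between each vertex `a` and the neighbors of `O a`. -/
def addLinks (H K : SimpleGraph V) (O : V → Finset V) : SimpleGraph V where
  Adj x y := K.Adj x y ∨ (x ≠ y ∧ ((∃ o ∈ O x, H.Adj y o) ∨ (∃ o ∈ O y, H.Adj x o)))
  symm := ⟨fun _ _ h => h.imp SimpleGraph.Adj.symm fun ⟨h1, h2⟩ => ⟨h1.symm, h2.symm⟩⟩
  loopless := ⟨fun _ h => h.elim (fun h => h.ne rfl) fun h => h.1 rfl⟩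

/-- The hypotheses under which additional edges between `a` and the neighbors of `O a` do not
make a difference. -/
structure IsLinkFamily (H K : SimpleGraph V) (S I : Finset V) (owner : V → Option V) (k s : ℕ)
    (O : V → Finset V) : Prop where
  mem : ∀ a, ∀ o ∈ O a, a ∈ S ∧ o ∈ I ∧ H.Adj a o ∧ owner o = none
  high : ∀ a, ∀ o ∈ O a, 4 * k ≤ (I.filter fun o => H.Adj a o).card
  few : ∀ a, ∀ o ∈ O a,
    (Finset.univ.filter fun b => b ≠ a ∧ H.Adj b o ∧ ¬ K.Adj a b).card ≤ s
  many : ∀ a b, b ≠ a → ¬ K.Adj a b → (∃ o ∈ O a, H.Adj b o) →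
    14 * s ≤ ((O a).filter fun o => H.Adj b o).card

/-- The vertex `a` is adjacent to all other neighbors of `o`. -/
def Simplicial (K : SimpleGraph V) (S I : Finset V) (a o : V) : Prop :=
  a ∈ S ∧ o ∈ I ∧ K.Adj a o ∧ ∀ b, b ≠ a → K.Adj o b → K.Adj a b

/-- The vertex `a` has many simplicial neighbors before `o`. -/
def Surplus [PartialOrder V] (K : SimpleGraph V) (S I : Finset V) (k : ℕ) (a o : V) : Prop :=
  Simplicial K S I a o ∧
    4 * k ≤ (Finset.univ.filter fun o' => o' < o ∧ Simplicial K S I a o').card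

/-- The graph without the edges to surplus simplicial neighbors. -/
def removeSurplus [PartialOrder V] (K : SimpleGraph V) (S I : Finset V) (k : ℕ) :
    SimpleGraph V where
  Adj x y := K.Adj x y ∧ ¬ Surplus K S I k x y ∧ ¬ Surplus K S I k y x
  symm := ⟨fun _ _ h => ⟨h.1.symm, h.2.2, h.2.1⟩⟩
  loopless := ⟨fun _ h => h.1.ne rfl⟩

/-- A vertex of `I` without neighbors in `S`. -/
def Pendant (K : SimpleGraph V) (S I : Finset V) (o : V) : Prop :=
  o ∈ I ∧ ¬ ∃ a, a ∈ S ∧ K.Adj a o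

/-- A pendant neighbor of `u` precedes the pendant vertex `o`. -/
def LaterTwin [PartialOrder V] (K : SimpleGraph V) (S C I : Finset V) (o u : V) : Prop :=
  Pendant K S I o ∧ u ∈ C ∧ ∃ o', o' < o ∧ Pendant K S I o' ∧ K.Adj o' u

/-- The graph with at most one edge to a pendant vertex at each vertex of `C`. -/
def removeTwins [PartialOrder V] (K : SimpleGraph V) (S C I : Finset V) : SimpleGraph V where
  Adj x y := K.Adj x y ∧ ¬ LaterTwin K S C I x y ∧ ¬ LaterTwin K S C I y x
  symm := ⟨fun _ _ h => ⟨h.1.symm, h.2.2, h.2.1⟩⟩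
  loopless := ⟨fun _ h => h.1.ne rfl⟩

variable {H K : SimpleGraph V} {S C I : Finset V} {k m s : ℕ} {O : V → Finset V}

omit [Fintype V] in
theorem le_addCommon : H ≤ addCommon H S I k := fun _ _ h => Or.inl h

omit [Fintype V] in
theorem le_addLinks : K ≤ addLinks H K O := fun _ _ h => Or.inl h

omit [Fintype V] in
theorem le_deleteEdge {L : SimpleGraph V} {a b : V} (h : K ≤ L) (hab : ¬ K.Adj a b) :
    K ≤ L.deleteEdges {s(a, b)} := by
  intro x y hxy
  rw [SimpleGraph.deleteEdges_adj]
  refine ⟨h hxy, fun hm => ?_⟩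
  rcases Sym2.eq_iff.1 (Set.mem_singleton_iff.1 hm) with ⟨rfl, rfl⟩ | ⟨rfl, rfl⟩
  exacts [hab hxy, hab hxy.symm]

/-- When an added edge `ab` is removed, the other at most `k - 1` paths leave two common neighbors
`o` and `p` of `a` and `b` free, and `p a o b` replaces the lost path. -/
theorem hasPacking_addCommon_iff (hmk : m ≤ k) :
    HasPacking (addCommon H S I k) m ↔ HasPacking H m := by
  refine ⟨HasPacking.of_step le_addCommon ?_, HasPacking.mono le_addCommon⟩
  intro L a b hHL hL hab hnot
  obtain ⟨hne, -, ha, hb, hc⟩ := (hL hab).resolve_left hnot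
  refine HasPacking.deleteEdge_of_link ?_
  intro l g hl hg hga hgb
  have hle := le_deleteEdge hHL hnot
  have hU : (usedBy g).card ≤ 4 * l := by simpa using card_usedBy_le g
  obtain ⟨o, ho, hoU⟩ := exists_mem_notMem_of_card
    (A := I.filter fun o => H.Adj a o ∧ H.Adj b o) (B := usedBy g) (by
      rw [commonCount] at hc; omega)
  obtain ⟨p, hp, hpU⟩ := exists_mem_notMem_of_card
    (A := I.filter fun o => H.Adj a o ∧ H.Adj b o) (B := insert o (usedBy g)) (by
      have := Finset.card_insert_le o (usedBy g)
      rw [commonCount] at hc; omega)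
  obtain ⟨hoI, hao, hbo⟩ := Finset.mem_filter.1 ho
  obtain ⟨hpI, hap, hbp⟩ := Finset.mem_filter.1 hp
  simp only [Finset.mem_insert, not_or] at hpU
  refine (isPacking_option hg (q := ![p, a, o, b])
    (injective_vec4 ⟨hap.ne', hpU.1, hbp.ne', hao.ne, hne, hbo.ne'⟩)
    ⟨hle hap.symm, hle hao, hle hbo.symm⟩ ?_).hasPacking (by simp)
  intro j c d h
  have hu : g j c ∈ usedBy g := mem_usedBy.2 ⟨j, c, rfl⟩
  fin_cases d
  · exact hpU.2 (by rw [← show g j c = p from h]; exact hu)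
  · exact hga _ _ h
  · exact hoU (by rw [← show g j c = o from h]; exact hu)
  · exact hgb _ _ h

omit [Fintype V] in
theorem adj_of_addCommon_adj {v o : V} (ho : o ∈ I) (h : (addCommon H S I k).Adj v o) :
    H.Adj v o :=
  h.resolve_right fun h => h.2.2.2.1 ho

theorem adj_of_addLinks_adj {owner : V → Option V} (hI : ∀ o ∈ I, ∀ v, H.Adj o v → v ∉ I)
    (hSI : ∀ a ∈ S, a ∉ I) (hO : IsLinkFamily H K S I owner k s O) {v o : V} (ho : o ∈ I)
    (h : (addLinks H K O).Adj v o) : K.Adj v o := by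
  refine h.resolve_right fun ⟨_, h⟩ => ?_
  rcases h with ⟨o', h1, h2⟩ | ⟨o', h1, -⟩
  · exact hI o ho _ h2 (hO.mem _ _ h1).2.1
  · exact hSI _ (hO.mem _ _ h1).1 ho

/-- The added edges are removed one at a time, and `hasPacking_succ_of_link` restores the lost path.
It applies to every intermediate graph: the edges at `I` are always those of `H`, and since all
edges of `K` are present, the conditions `few` and `many` can only become weaker requirements. -/
theorem hasPacking_addLinks_iff {owner : V → Option V}
    (hI : ∀ o ∈ I, ∀ v, H.Adj o v → v ∉ I) (hSI : ∀ a ∈ S, a ∉ I)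
    (own1 : ∀ o w, owner o = some w → o ∈ I ∧ H.Adj w o)
    (own2 : ∀ o ∈ I, owner o = none → ∀ w, H.Adj w o →
      s ≤ (Finset.univ.filter fun o' => owner o' = some w).card)
    (hHK : H ≤ K) (hKI : ∀ o ∈ I, ∀ v, K.Adj v o → H.Adj v o)
    (hO : IsLinkFamily H K S I owner k s O) (hks : k < s ^ 2) (hmk : m ≤ k) :
    HasPacking (addLinks H K O) m ↔ HasPacking K m := by
  refine ⟨HasPacking.of_step le_addLinks ?_, HasPacking.mono le_addLinks⟩
  intro L a b hKL hL hab hnot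
  have main : ∀ a b, L.Adj a b → ¬ K.Adj a b → (∃ o ∈ O a, H.Adj b o) → HasPacking L m →
      HasPacking (L.deleteEdges {s(a, b)}) m := by
    intro a b hab hnot hbO
    refine HasPacking.deleteEdge_of_link ?_
    intro l g hl hg hga hgb
    obtain ⟨L', hL'⟩ : ∃ L', L' = L.deleteEdges {s(a, b)} := ⟨_, rfl⟩
    rw [← hL'] at hg ⊢
    have hle : K ≤ L' := hL' ▸ le_deleteEdge hKL hnot
    have hLI : ∀ o ∈ I, ∀ v, L'.Adj v o ↔ H.Adj v o := fun o ho v =>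
      ⟨fun h => hKI o ho v (adj_of_addLinks_adj hI hSI hO ho
        (hL (SimpleGraph.deleteEdges_le _ (hL' ▸ h)))), fun h => hle (hHK h)⟩
    obtain ⟨o, ho, hbo⟩ := hbO
    obtain ⟨haS, hoI, hao, -⟩ := hO.mem a o ho
    have hOI : ∀ o ∈ O a, o ∈ I := fun o ho => (hO.mem a o ho).2.1
    have e1 : (I.filter fun o => L'.Adj a o) = I.filter fun o => H.Adj a o :=
      Finset.filter_congr fun o ho => hLI o ho a
    refine hasPacking_succ_of_link (H := L') (I := I) (owner := owner) (k := k) (s := s)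
      (a := a) (b := b) (O := O a) (g₀ := g)
      (fun o ho v h => hI o ho v ((hLI o ho v).1 h.symm).symm)
      (fun o w h => ⟨(own1 o w h).1, (hLI o (own1 o w h).1 w).2 (own1 o w h).2⟩)
      (fun o ho h w hw => own2 o ho h w ((hLI o ho w).1 hw)) (hSI a haS)
      (hI o hoI b hbo.symm) hab.ne hks (by omega)
      (by rw [e1]; exact hO.high a o ho)
      (fun o ho => ⟨hOI o ho, (hLI o (hOI o ho) a).2 (hO.mem a o ho).2.2.1, (hO.mem a o ho).2.2.2⟩)
      ?_ ?_ ?_ ⟨o, ho, (hLI o hoI b).2 hbo⟩ hg hga hgb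
    · intro o ho
      refine le_trans (Finset.card_le_card fun b' hb' => ?_) (hO.few a o ho)
      obtain ⟨h1, h2, h3⟩ := (Finset.mem_filter.1 hb').2
      exact Finset.mem_filter.2 ⟨Finset.mem_univ _, h1, (hLI o (hOI o ho) b').1 h2,
        fun h => h3 (hle h)⟩
    · rintro b' h1 h2 ⟨o', h3, h4⟩
      refine (hO.many a b' h1 (fun h => h2 (hle h)) ⟨o', h3, (hLI o' (hOI o' h3) b').1 h4⟩).trans
        (Finset.card_le_card fun o'' h5 => ?_)
      obtain ⟨h6, h7⟩ := Finset.mem_filter.1 h5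
      exact Finset.mem_filter.2 ⟨h6, (hLI o'' (hOI o'' h6) b').2 h7⟩
    · rw [hL', SimpleGraph.deleteEdges_adj]
      exact fun h => h.2 rfl
  rcases ((hL hab).resolve_left hnot).2 with h | h
  · exact main a b hab hnot h
  · rw [Sym2.eq_swap]
    exact main b a hab.symm (fun h' => hnot h'.symm) h

/-! ### Deletion of redundant edges, with the order of the vertices as a tie-breaker -/

section Order

variable [PartialOrder V]

theorem removeSurplus_le : removeSurplus K S I k ≤ K := fun _ _ h => h.1

omit [Fintype V] in
theorem removeTwins_le : removeTwins K S C I ≤ K := fun _ _ h => h.1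

/-- The first simplicial neighbors are kept. -/
theorem le_card_kept {a o : V} (h : Surplus K S I k a o) : 4 * k ≤ (Finset.univ.filter fun o' =>
    Simplicial K S I a o' ∧ ¬ Surplus K S I k a o').card := by
  -- All simplicial predecessors of a minimal surplus vertex are kept.
  obtain ⟨o₁, ho₁, hmin⟩ := wellFounded_lt.has_min {o | Surplus K S I k a o} ⟨o, h⟩
  refine ho₁.2.trans (Finset.card_le_card fun o' ho' => ?_)
  obtain ⟨h1, h2⟩ := (Finset.mem_filter.1 ho').2
  exact Finset.mem_filter.2 ⟨Finset.mem_univ _, h2, fun h3 => hmin o' h3 h1⟩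

/-- Every deleted edge has an end in `I`, so edges outside `I` stay and `o` remains simplicial for
`a` in the intermediate graphs. The kept simplicial neighbors supply the substitute for `o`. -/
theorem hasPacking_removeSurplus_iff (hSI : ∀ a ∈ S, a ∉ I)
    (hI : ∀ o ∈ I, ∀ v, K.Adj o v → v ∉ I) (hmk : m ≤ k) :
    HasPacking (removeSurplus K S I k) m ↔ HasPacking K m := by
  refine ⟨HasPacking.mono removeSurplus_le, HasPacking.of_step removeSurplus_le ?_⟩
  intro L a b hKL hL hab hnot
  have main : ∀ a o, L.Adj a o → Surplus K S I k a o → HasPacking L m →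
      HasPacking (L.deleteEdges {s(a, o)}) m := by
    intro a o hao hsur
    obtain ⟨⟨haS, hoI, -, hsimp⟩, -⟩ := id hsur
    have hKeep : ∀ x y, x ∉ I → y ∉ I → K.Adj x y → L.Adj x y := fun x y hx hy h =>
      hKL ⟨h, fun h' => hy h'.1.2.1, fun h' => hx h'.1.2.1⟩
    refine HasPacking.deleteEdge_of_simplicial hao ?_ (N := Finset.univ.filter fun o' =>
      Simplicial K S I a o' ∧ ¬ Surplus K S I k a o') ?_
      ((Nat.mul_le_mul_left 4 hmk).trans (le_card_kept hsur))
    · intro b hba hob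
      exact hKeep _ _ (hSI _ haS) (hI o hoI b (hL hob)) (hsimp b hba (hL hob))
    · intro p hp
      obtain ⟨h1, h2⟩ := (Finset.mem_filter.1 hp).2
      refine ⟨fun h => h2 (h ▸ hsur), hKL ⟨h1.2.2.1, h2, fun h => ?_⟩⟩
      exact hSI _ haS h.1.2.1
  have h1 : Surplus K S I k a b ∨ Surplus K S I k b a := by
    by_contra hcon
    push Not at hcon
    exact hnot ⟨hL hab, hcon.1, hcon.2⟩
  rcases h1 with h | h
  · exact main a b hab h
  · rw [Sym2.eq_swap]
    exact main b a hab.symm h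

/-- A pendant vertex at `u` has no neighbor but `u`. The first one keeps its edge throughout and
serves as the twin of all later ones. -/
theorem hasPacking_removeTwins_iff (hcases : ∀ v, v ∈ S ∨ v ∈ C ∨ v ∈ I)
    (hI : ∀ o ∈ I, ∀ v, K.Adj o v → v ∉ I)
    (huniq : ∀ o ∈ I, ∀ u ∈ C, ∀ v ∈ C, K.Adj o u → K.Adj o v → v = u) :
    HasPacking (removeTwins K S C I) m ↔ HasPacking K m := by
  refine ⟨HasPacking.mono removeTwins_le, HasPacking.of_step removeTwins_le ?_⟩
  intro L a b hKL hL hab hnot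
  have main : ∀ u o, L.Adj u o → LaterTwin K S C I o u → HasPacking L m →
      HasPacking (L.deleteEdges {s(u, o)}) m := by
    rintro u o huo ⟨hpend, huC, hex⟩
    have hnbr : ∀ o, Pendant K S I o → K.Adj o u → ∀ v, L.Adj o v → v = u := by
      intro o ho hou v hv
      rcases hcases v with h | h | h
      · exact absurd ⟨v, h, (hL hv).symm⟩ ho.2
      · exact huniq o ho.1 u huC v h hou (hL hv)
      · exact absurd h (hI o ho.1 v (hL hv))
    obtain ⟨o', ⟨h1, h2, h3⟩, hmin⟩ := wellFounded_lt.has_min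
      {o' | o' < o ∧ Pendant K S I o' ∧ K.Adj o' u} hex
    have huI : u ∉ I := hI o' h2.1 u h3
    have h4 : L.Adj o' u := by
      refine hKL ⟨h3, ?_, fun h => huI h.1.1⟩
      rintro ⟨-, -, o'', h5, h6, h7⟩
      exact hmin o'' ⟨h5.trans h1, h6, h7⟩ h5
    exact HasPacking.deleteEdge_of_twin h1.ne' (hnbr o hpend (hL huo).symm) (hnbr o' h2 h3)
      huo.symm h4
  have h1 : LaterTwin K S C I a b ∨ LaterTwin K S C I b a := by
    by_contra hcon
    push Not at hcon
    exact hnot ⟨hL hab, hcon.1, hcon.2⟩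
  rcases h1 with h | h
  · rw [Sym2.eq_swap]
    exact main b a hab.symm h
  · exact main a b hab h

end Order

end Transformations


/-! ### The kernel and the number of its edges -/

section Peeling

open scoped Classical

variable {V : Type*} [Fintype V]

/-- The private neighbors: each vertex owns at most `s` vertices of `I`, and exactly `s` if some
neighbor in `I` is not owned by any vertex. -/
structure IsOwner (H : SimpleGraph V) (I : Finset V) (owner : V → Option V) (s : ℕ) : Prop where
  adj : ∀ o w, owner o = some w → o ∈ I ∧ H.Adj w o
  ge : ∀ o ∈ I, owner o = none → ∀ w, H.Adj w o →
    s ≤ (Finset.univ.filter fun o' => owner o' = some w).card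
  le : ∀ w, (Finset.univ.filter fun o' => owner o' = some w).card ≤ s

/-- The neighbors in `I` with which the peeling starts. -/
noncomputable def seed (H K : SimpleGraph V) (S I : Finset V) (owner : V → Option V) (k s : ℕ)
    (a : V) : Finset V :=
  Finset.univ.filter fun o => a ∈ S ∧ o ∈ I ∧ H.Adj a o ∧ owner o = none ∧
    4 * k ≤ (I.filter fun o => H.Adj a o).card ∧
    (Finset.univ.filter fun b => b ≠ a ∧ H.Adj b o ∧ ¬ K.Adj a b).card ≤ s

/-- One round of peeling. -/
noncomputable def peelStep (H K : SimpleGraph V) (s : ℕ) (a : V) (O : Finset V) : Finset V :=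
  O.filter fun o => ∀ b, b ≠ a → ¬ K.Adj a b → H.Adj b o →
    14 * s ≤ (O.filter fun o => H.Adj b o).card

/-- The result of the peeling. -/
noncomputable def linkFamily (H K : SimpleGraph V) (S I : Finset V) (owner : V → Option V)
    (k s : ℕ) (a : V) : Finset V :=
  (peelStep H K s a)^[Fintype.card V] (seed H K S I owner k s a)

variable {H K : SimpleGraph V} {S I : Finset V} {owner : V → Option V} {k s : ℕ} {a : V}

theorem peelStep_subset (O : Finset V) : peelStep H K s a O ⊆ O := Finset.filter_subset _ _

/-- A decreasing sequence of finite sets becomes stationary. -/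
theorem iterate_card_fixed {f : Finset V → Finset V} (hf : ∀ O, f O ⊆ O) (O : Finset V) :
    f (f^[Fintype.card V] O) = f^[Fintype.card V] O := by
  have key : ∀ n, f (f^[n] O) = f^[n] O ∨ (f^[n] O).card + n ≤ Fintype.card V := by
    intro n
    induction n with
    | zero => exact Or.inr (Finset.card_le_univ _)
    | succ n ih =>
      rw [Function.iterate_succ_apply']
      rcases ih with h | h
      · left; rw [h, h]
      · by_cases h2 : f (f^[n] O) = f^[n] O
        · left; rw [h2, h2]
        · right
          have := Finset.card_lt_card ((hf (f^[n] O)).ssubset_of_ne h2)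
          omega
  rcases key (Fintype.card V) with h | h
  · exact h
  · have h0 : f^[Fintype.card V] O = ∅ := Finset.card_eq_zero.1 (by omega)
    rw [h0]
    exact Finset.subset_empty.1 (hf ∅)

omit [Fintype V] in
theorem iterate_subset {f : Finset V → Finset V} (hf : ∀ O, f O ⊆ O) (O : Finset V) (n : ℕ) :
    f^[n] O ⊆ O := by
  induction n with
  | zero => exact subset_rfl
  | succ n ih =>
    rw [Function.iterate_succ_apply']
    exact (hf _).trans ih

theorem linkFamily_subset : linkFamily H K S I owner k s a ⊆ seed H K S I owner k s a :=
  iterate_subset peelStep_subset _ _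

theorem mem_seed {o : V} : o ∈ seed H K S I owner k s a ↔
    a ∈ S ∧ o ∈ I ∧ H.Adj a o ∧ owner o = none ∧
    4 * k ≤ (I.filter fun o => H.Adj a o).card ∧
    (Finset.univ.filter fun b => b ≠ a ∧ H.Adj b o ∧ ¬ K.Adj a b).card ≤ s := by
  simp [seed]

/-- The selection of the seed gives all conditions but `many`, which expresses that the peeling has
become stationary. -/
theorem isLinkFamily_linkFamily :
    IsLinkFamily H K S I owner k s (linkFamily H K S I owner k s) where
  mem a o ho := by
    obtain ⟨h1, h2, h3, h4, -⟩ := mem_seed.1 (linkFamily_subset ho)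
    exact ⟨h1, h2, h3, h4⟩
  high a o ho := (mem_seed.1 (linkFamily_subset ho)).2.2.2.2.1
  few a o ho := (mem_seed.1 (linkFamily_subset ho)).2.2.2.2.2
  many a b hb hab := by
    rintro ⟨o, ho, hbo⟩
    have h1 : peelStep H K s a (linkFamily H K S I owner k s a) = _ :=
      iterate_card_fixed peelStep_subset _
    have h2 : o ∈ peelStep H K s a (linkFamily H K S I owner k s a) := by
      rw [h1]; exact ho
    exact (Finset.mem_filter.1 h2).2 b hb hab hbo

/-- The vertices that have a common neighbor in `I` with `a`. -/
noncomputable def partners (H : SimpleGraph V) (I : Finset V) (a : V) : Finset V :=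
  Finset.univ.filter fun b => b ≠ a ∧ ∃ o ∈ I, H.Adj a o ∧ H.Adj b o

/-- Each peeled vertex is charged to a partner `b` with fewer than `14 * s` neighbors in the current
set. The round removes all these neighbors, so `b` is dead afterwards and is charged in a single
round. The invariant weighs every dead partner with `14 * s`. -/
theorem card_seed_le : (seed H K S I owner k s a).card ≤
    (linkFamily H K S I owner k s a).card + (partners H I a).card * (14 * s) := by
  let dead : Finset V → Finset V := fun O => (partners H I a).filter fun b => ∀ o ∈ O, ¬ H.Adj b o
  suffices ∀ n, (seed H K S I owner k s a).card ≤
      ((peelStep H K s a)^[n] (seed H K S I owner k s a)).card +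
        (dead ((peelStep H K s a)^[n] (seed H K S I owner k s a))).card * (14 * s) by
    refine (this (Fintype.card V)).trans (Nat.add_le_add_left (Nat.mul_le_mul_right _ ?_) _)
    exact Finset.card_le_card (Finset.filter_subset _ _)
  intro n
  induction n with
  | zero => exact Nat.le_add_right _ _
  | succ n ih =>
    rw [Function.iterate_succ_apply']
    set O := (peelStep H K s a)^[n] (seed H K S I owner k s a) with hO
    have hsub : O ⊆ seed H K S I owner k s a := iterate_subset peelStep_subset _ _
    let light := (partners H I a).filter fun b =>
      b ≠ a ∧ ¬ K.Adj a b ∧ (O.filter fun o => H.Adj b o).card < 14 * s ∧ ∃ o ∈ O, H.Adj b o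
    have h1 : O \ peelStep H K s a O ⊆ light.biUnion fun b => O.filter fun o => H.Adj b o := by
      intro o ho
      obtain ⟨hoO, hop⟩ := Finset.mem_sdiff.1 ho
      have : ∃ b, b ≠ a ∧ ¬ K.Adj a b ∧ H.Adj b o ∧ (O.filter fun o => H.Adj b o).card < 14 * s := by
        by_contra hcon
        push Not at hcon
        exact hop (Finset.mem_filter.2 ⟨hoO, hcon⟩)
      obtain ⟨b, h1, h2, h3, h4⟩ := this
      obtain ⟨-, h5, h6, -⟩ := mem_seed.1 (hsub hoO)
      exact Finset.mem_biUnion.2 ⟨b, Finset.mem_filter.2 ⟨Finset.mem_filter.2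
        ⟨Finset.mem_univ _, h1, o, h5, h6, h3⟩, h1, h2, h4, o, hoO, h3⟩,
        Finset.mem_filter.2 ⟨hoO, h3⟩⟩
    have h2 : (O \ peelStep H K s a O).card ≤ light.card * (14 * s) :=
      (Finset.card_le_card h1).trans (Finset.card_biUnion_le_card_mul _ _ _ fun b hb =>
        (Finset.mem_filter.1 hb).2.2.2.1.le)
    have h3 : light ∪ dead O ⊆ dead (peelStep H K s a O) := by
      refine Finset.union_subset (fun b hb => ?_) fun b hb => ?_
      · obtain ⟨h4, h5, h6, h7, -⟩ := Finset.mem_filter.1 hb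
        refine Finset.mem_filter.2 ⟨h4, fun o ho hbo => ?_⟩
        exact absurd ((Finset.mem_filter.1 ho).2 b h5 h6 hbo) (not_le.2 h7)
      · obtain ⟨h4, h5⟩ := Finset.mem_filter.1 hb
        exact Finset.mem_filter.2 ⟨h4, fun o ho => h5 o (peelStep_subset _ ho)⟩
    have h4 : Disjoint light (dead O) := by
      refine Finset.disjoint_left.2 fun b hb hb' => ?_
      obtain ⟨o, ho, hbo⟩ := (Finset.mem_filter.1 hb).2.2.2.2
      exact (Finset.mem_filter.1 hb').2 o ho hbo
    have h5 := Finset.card_le_card h3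
    rw [Finset.card_union_of_disjoint h4] at h5
    have h6 := Finset.card_sdiff_add_card_eq_card (peelStep_subset (H := H) (K := K) (s := s) (a := a) O)
    have h7 := Nat.mul_le_mul_right (14 * s) h5
    rw [add_mul] at h7
    omega

/-- The last of more than `4 * k` kept vertices would have `4 * k` simplicial predecessors and thus
be surplus. -/
theorem card_kept_le [PartialOrder V] (total : ∀ x y : V, x ≤ y ∨ y ≤ x) (K : SimpleGraph V)
    (S I : Finset V) (k : ℕ) (a : V) :
    (Finset.univ.filter fun o => Simplicial K S I a o ∧ ¬ Surplus K S I k a o).card ≤ 4 * k := by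
  set T := Finset.univ.filter fun o => Simplicial K S I a o ∧ ¬ Surplus K S I k a o with hT
  by_contra hcon
  push Not at hcon
  have hne : T.Nonempty := Finset.card_pos.1 (by omega)
  obtain ⟨x, hx, hmax⟩ := T.exists_maximal hne
  obtain ⟨h1, h2⟩ := (Finset.mem_filter.1 hx).2
  refine h2 ⟨h1, ?_⟩
  have h3 : T.erase x ⊆ Finset.univ.filter fun o' => o' < x ∧ Simplicial K S I a o' := by
    intro o ho
    obtain ⟨h4, h5⟩ := Finset.mem_erase.1 ho
    have h6 : o ≤ x := (total o x).elim id fun h => hmax h5 h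
    exact Finset.mem_filter.2 ⟨Finset.mem_univ _, lt_of_le_of_ne h6 h4,
      (Finset.mem_filter.1 h5).2.1⟩
  have h4 := Finset.card_le_card h3
  rw [Finset.card_erase_of_mem hx] at h4
  omega

end Peeling

/-! ### The composed transformation, its correctness and the edge count -/

section Kernel

open scoped Classical

variable {V : Type*} [Fintype V]

/-- The graph without the dispensable vertices. -/
noncomputable def reduced (G : SimpleGraph V) (S : Finset V) (k : ℕ) : SimpleGraph V :=
  isolate G (dispensable G S k)

/-- The reduced graph with the edges between the pairs with many common neighbors. -/
noncomputable def dense (G : SimpleGraph V) (S : Finset V) (k : ℕ) : SimpleGraph V :=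
  addCommon (reduced G S k) S (periphery G S) k

/-- The family of links of the reduced graph. -/
noncomputable def links (G : SimpleGraph V) (S : Finset V) (owner : V → Option V) (k s : ℕ) :
    V → Finset V :=
  linkFamily (reduced G S k) (dense G S k) S (periphery G S) owner k s

/-- The graph after all additions of edges. -/
noncomputable def linked (G : SimpleGraph V) (S : Finset V) (owner : V → Option V) (k s : ℕ) :
    SimpleGraph V :=
  addLinks (reduced G S k) (dense G S k) (links G S owner k s)

variable [PartialOrder V]

/-- The graph after the removal of the surplus neighbors. -/
noncomputable def pruned (G : SimpleGraph V) (S : Finset V) (owner : V → Option V) (k s : ℕ) :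
    SimpleGraph V :=
  removeSurplus (linked G S owner k s) S (periphery G S) k

/-- The graph of the kernel, with isolated vertices. -/
noncomputable def kernelGraph (G : SimpleGraph V) (S : Finset V) (owner : V → Option V) (k s : ℕ) :
    SimpleGraph V :=
  removeTwins (pruned G S owner k s) S (core G S) (periphery G S)

variable {G : SimpleGraph V} {S : Finset V} {owner : V → Option V} {k s : ℕ}

omit [PartialOrder V] in
theorem notMem_periphery_of_mem {a : V} (h : a ∈ S) : a ∉ periphery G S := fun h' =>
  (mem_periphery.1 h').1 h

omit [PartialOrder V] in
theorem reduced_adj_periphery {o v : V} (ho : o ∈ periphery G S) (h : (reduced G S k).Adj o v) :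
    v ∉ periphery G S :=
  not_adj_of_mem_periphery ho h.1

omit [PartialOrder V] in
theorem reduced_adj_of_linked_adj {o v : V} (ho : o ∈ periphery G S)
    (h : (linked G S owner k s).Adj v o) : (reduced G S k).Adj v o :=
  adj_of_addCommon_adj ho (adj_of_addLinks_adj (fun _ ho _ => reduced_adj_periphery ho)
    (fun _ => notMem_periphery_of_mem) isLinkFamily_linkFamily ho h)

/-- Only the removal of the rich vertices lowers the parameter. The later rules need edges at the
periphery to be those of the reduced graph, which holds because every added edge avoids the
periphery. -/
theorem hasPacking_kernelGraph_iff (hP : MeetsPaths G S)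
    (hown : IsOwner (reduced G S k) (periphery G S) owner s) (hks : k < s ^ 2) :
    HasPacking (kernelGraph G S owner k s) (k - (rich G S k).card) ↔ HasPacking G k := by
  have hm : k - (rich G S k).card ≤ k := Nat.sub_le _ _
  have hSI : ∀ a ∈ S, a ∉ periphery G S := fun _ => notMem_periphery_of_mem
  have h3 : ∀ o ∈ periphery G S, ∀ v, (linked G S owner k s).Adj o v → v ∉ periphery G S :=
    fun o ho v h => reduced_adj_periphery ho (reduced_adj_of_linked_adj ho h.symm).symm
  rw [hasPacking_isolate_dispensable_iff hP, kernelGraph, hasPacking_removeTwins_iff mem_cases,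
    pruned, hasPacking_removeSurplus_iff hSI h3 hm, linked, links, dense,
    hasPacking_addLinks_iff (fun _ ho _ => reduced_adj_periphery ho) hSI hown.adj hown.ge
      le_addCommon (fun o ho v => adj_of_addCommon_adj ho) isLinkFamily_linkFamily hks hm,
    hasPacking_addCommon_iff hm]
  · rfl
  · exact fun o ho v h => h3 o ho v h.1
  · intro o ho u hu v hv h1 h2
    exact eq_of_mem_periphery ho (notMem_of_mem_core hv) (notMem_of_mem_core hu)
      (reduced_adj_of_linked_adj ho h2.1.symm).symm.1
      (reduced_adj_of_linked_adj ho h1.1.symm).symm.1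

omit [PartialOrder V] in
theorem notMem_rich_of_adj {a v : V} (h : (reduced G S k).Adj a v) : a ∉ rich G S k :=
  fun h' => h.2.1 (mem_dispensable.2 (Or.inl h'))

omit [PartialOrder V] in
-- A partner lies in `S`, with at most `4 * k` vertices, or is one of the fewer than `12 * k` core
-- vertices that `a` touches.
theorem card_partners_le (hS : S.card ≤ 4 * k) {a : V} (ha : a ∈ S) (har : a ∉ rich G S k) :
    (partners (reduced G S k) (periphery G S) a).card ≤ 16 * k := by
  have h1 : partners (reduced G S k) (periphery G S) a ⊆
      S ∪ Finset.univ.filter fun d => Touches G S a d := by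
    intro b hb
    obtain ⟨-, o, ho, h1, h2⟩ := (Finset.mem_filter.1 hb).2
    rcases notMem_periphery_iff.1 (reduced_adj_periphery ho h2.symm) with h | h
    · exact Finset.mem_union_left _ h
    · exact Finset.mem_union_right _ (Finset.mem_filter.2
        ⟨Finset.mem_univ _, (touches_of_common ha h ho h1 h2).1⟩)
  have h2 := Finset.card_le_card h1
  have h3 := Finset.card_union_le S (Finset.univ.filter fun d => Touches G S a d)
  have h4 := card_touches_lt ha har
  omega

omit [PartialOrder V] in
/-- The number of neighbors in the periphery with many neighbors that are not adjacent to `a`. -/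
theorem card_many_mul_le (hS : S.card ≤ 4 * k) {a : V} (ha : a ∈ S) (har : a ∉ rich G S k) :
    ((periphery G S).filter fun o => (reduced G S k).Adj a o ∧ s < (Finset.univ.filter fun b =>
      b ≠ a ∧ (reduced G S k).Adj b o ∧ ¬ (dense G S k).Adj a b).card).card * s ≤
      16 * k * (4 * k) := by
  set I := periphery G S with hI
  set H := reduced G S k with hH
  set M := I.filter fun o => H.Adj a o ∧ s < (Finset.univ.filter fun b =>
      b ≠ a ∧ H.Adj b o ∧ ¬ (dense G S k).Adj a b).card with hM
  let B := (partners H I a).filter fun b => ¬ (dense G S k).Adj a b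
  -- Count the adjacent pairs of `M` and `B` twice. Each vertex of `M` is in more than `s` pairs;
  -- each `b` in `B` is in at most `4 * k`, since with more common neighbors it would be adjacent to
  -- `a` in the dense graph.
  have e1 := Finset.sum_card_bipartiteAbove_eq_sum_card_bipartiteBelow
    (s := M) (t := B) (fun o b => H.Adj b o)
  have h1 : ∀ o ∈ M, s ≤ (B.bipartiteAbove (fun o b => H.Adj b o) o).card := by
    intro o ho
    obtain ⟨h1, h2, h3⟩ := Finset.mem_filter.1 ho
    refine h3.le.trans (Finset.card_le_card fun b hb => ?_)
    obtain ⟨h4, h5, h6⟩ := (Finset.mem_filter.1 hb).2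
    exact Finset.mem_filter.2 ⟨Finset.mem_filter.2 ⟨Finset.mem_filter.2
      ⟨Finset.mem_univ _, h4, o, h1, h2, h5⟩, h6⟩, h5⟩
  have h2 : ∀ b ∈ B, (M.bipartiteBelow (fun o b => H.Adj b o) b).card ≤ 4 * k := by
    intro b hb
    obtain ⟨h3, h4⟩ := Finset.mem_filter.1 hb
    obtain ⟨h5, o, ho, h6, h7⟩ := (Finset.mem_filter.1 h3).2
    have h8 : ¬ 4 * k ≤ commonCount H I a b := fun h => h4 (Or.inr
      ⟨h5.symm, Or.inl ha, notMem_periphery_of_mem ha, reduced_adj_periphery ho h7.symm, h⟩)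
    refine le_trans (Finset.card_le_card fun o' ho' => ?_) (not_le.1 h8).le
    obtain ⟨h9, h10⟩ := Finset.mem_filter.1 ho'
    obtain ⟨h11, h12, -⟩ := Finset.mem_filter.1 h9
    exact Finset.mem_filter.2 ⟨h11, h12, h10⟩
  calc M.card * s ≤ _ := by
        rw [← smul_eq_mul]
        exact Finset.card_nsmul_le_sum _ _ _ h1
    _ = _ := e1
    _ ≤ B.card * (4 * k) := by
        rw [← smul_eq_mul]
        exact Finset.sum_le_card_nsmul _ _ _ h2
    _ ≤ 16 * k * (4 * k) := by
        refine Nat.mul_le_mul_right _ ((Finset.card_le_card (Finset.filter_subset _ _)).trans ?_)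
        exact card_partners_le hS ha har

/-- If `a` has `4 * k` neighbors in the periphery, a surviving one is a kept simplicial vertex (`4 *
k`), is owned by `a` or a partner (`17 * (k * s)`), has more than `s` neighbors not adjacent to `a`
(`64 * (k * s)`, where `k < s ^ 2` enters), or was peeled off (`224 * (k * s)`). Vertices that
survive the peeling are simplicial because of the added links. -/
theorem card_periphery_adj_le (total : ∀ x y : V, x ≤ y ∨ y ≤ x) (hS : S.card ≤ 4 * k)
    (hown : IsOwner (reduced G S k) (periphery G S) owner s) (hks : k < s ^ 2) (hk : 1 ≤ k)
    {a : V} (ha : a ∈ S) :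
    ((periphery G S).filter fun o => (pruned G S owner k s).Adj a o).card ≤ 313 * (k * s) := by
  set I := periphery G S with hI
  set H := reduced G S k with hH
  have hs : 1 ≤ s := by
    rcases Nat.eq_zero_or_pos s with rfl | h
    · simp at hks
    · exact h
  have hkks : k ≤ k * s := Nat.le_mul_of_pos_right _ hs
  have toH : ∀ o ∈ I, (pruned G S owner k s).Adj a o → H.Adj a o := fun o ho h =>
    reduced_adj_of_linked_adj ho h.1
  by_cases har : a ∈ rich G S k
  · rw [Finset.filter_false_of_mem fun o ho h => notMem_rich_of_adj (toH o ho h) har]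
    simp
  by_cases hhigh : 4 * k ≤ (I.filter fun o => H.Adj a o).card
  swap
  · have h1 : (I.filter fun o => (pruned G S owner k s).Adj a o) ⊆ I.filter fun o => H.Adj a o := by
      intro o ho
      obtain ⟨h1, h2⟩ := Finset.mem_filter.1 ho
      exact Finset.mem_filter.2 ⟨h1, toH o h1 h2⟩
    have := Finset.card_le_card h1
    omega
  set P := partners H I a with hP
  set L := links G S owner k s a with hL
  have hPc : P.card ≤ 16 * k := card_partners_le hS ha har
  let A₁ := Finset.univ.filter fun o => Simplicial (linked G S owner k s) S I a o ∧
    ¬ Surplus (linked G S owner k s) S I k a o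
  let A₂ := (insert a P).biUnion fun b => Finset.univ.filter fun o' => owner o' = some b
  let A₃ := I.filter fun o => H.Adj a o ∧ s < (Finset.univ.filter fun b =>
      b ≠ a ∧ H.Adj b o ∧ ¬ (dense G S k).Adj a b).card
  let A₄ := seed H (dense G S k) S I owner k s a \ L
  have hsub : (I.filter fun o => (pruned G S owner k s).Adj a o) ⊆ A₁ ∪ (A₂ ∪ (A₃ ∪ A₄)) := by
    intro o ho
    obtain ⟨hoI, hao⟩ := Finset.mem_filter.1 ho
    have haoH := toH o hoI hao
    simp only [Finset.mem_union]
    by_cases h1 : Simplicial (linked G S owner k s) S I a o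
    · exact Or.inl (Finset.mem_filter.2 ⟨Finset.mem_univ _, h1, hao.2.1⟩)
    right
    rcases hw : owner o with _ | w
    swap
    · left
      refine Finset.mem_biUnion.2 ⟨w, ?_, Finset.mem_filter.2 ⟨Finset.mem_univ _, hw⟩⟩
      by_cases hwa : w = a
      · exact hwa ▸ Finset.mem_insert_self _ _
      · exact Finset.mem_insert_of_mem (Finset.mem_filter.2
          ⟨Finset.mem_univ _, hwa, o, hoI, haoH, (hown.adj o w hw).2⟩)
    right
    by_cases h2 : (Finset.univ.filter fun b =>
      b ≠ a ∧ H.Adj b o ∧ ¬ (dense G S k).Adj a b).card ≤ s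
    swap
    · exact Or.inl (Finset.mem_filter.2 ⟨hoI, haoH, not_le.1 h2⟩)
    right
    refine Finset.mem_sdiff.2 ⟨mem_seed.2 ⟨ha, hoI, haoH, hw, hhigh, h2⟩, fun hoL => h1 ?_⟩
    refine ⟨ha, hoI, hao.1, fun b hba hob => Or.inr ⟨hba.symm, Or.inl ⟨o, hoL, ?_⟩⟩⟩
    exact reduced_adj_of_linked_adj hoI hob.symm
  have c1 : A₁.card ≤ 4 * k := card_kept_le total _ _ _ _ _
  have c2 : A₂.card ≤ (16 * k + 1) * s := by
    refine (Finset.card_biUnion_le_card_mul _ _ s fun b _ => hown.le b).trans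
      (Nat.mul_le_mul_right _ ((Finset.card_insert_le _ _).trans ?_))
    omega
  have c3 : A₃.card ≤ 64 * (k * s) := by
    have h1 : A₃.card * s ≤ 16 * k * (4 * k) := card_many_mul_le hS ha har
    have h2 : 16 * k * (4 * k) ≤ 64 * (k * s) * s := by nlinarith
    exact Nat.le_of_mul_le_mul_right (h1.trans h2) hs
  have c4 : A₄.card ≤ 224 * (k * s) := by
    have h1 := Finset.card_sdiff_add_card_eq_card (linkFamily_subset (H := H) (K := dense G S k)
      (S := S) (I := I) (owner := owner) (k := k) (s := s) (a := a))
    have h2 := card_seed_le (H := H) (K := dense G S k)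
      (S := S) (I := I) (owner := owner) (k := k) (s := s) (a := a)
    have h3 : P.card * (14 * s) ≤ 16 * k * (14 * s) := Nat.mul_le_mul_right _ hPc
    have h4 : A₄.card + (linkFamily H (dense G S k) S I owner k s a).card =
        (seed H (dense G S k) S I owner k s a).card := h1
    have h5 : 16 * k * (14 * s) = 224 * (k * s) := by ring
    change P.card * (14 * s) ≤ _ at h3
    have h6 : (seed H (dense G S k) S I owner k s a).card ≤
      (linkFamily H (dense G S k) S I owner k s a).card + P.card * (14 * s) := h2
    omega
  have d0 := Finset.card_le_card hsub
  have d1 := Finset.card_union_le A₁ (A₂ ∪ (A₃ ∪ A₄))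
  have d2 := Finset.card_union_le A₂ (A₃ ∪ A₄)
  have d3 := Finset.card_union_le A₃ A₄
  have d4 : (16 * k + 1) * s ≤ 17 * (k * s) := by nlinarith
  omega

omit [PartialOrder V] in
/-- The edges between `S` and the core belong to touched vertices. -/
theorem touches_of_linked_adj {a d : V} (hk : 1 ≤ k) (ha : a ∈ S) (hd : d ∈ core G S)
    (h : (linked G S owner k s).Adj a d) : Touches G S a d ∧ a ∉ rich G S k := by
  have hdS := notMem_of_mem_core hd
  have hO : IsLinkFamily (reduced G S k) (dense G S k) S (periphery G S) owner k s
    (links G S owner k s) := isLinkFamily_linkFamily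
  rcases h with (h | ⟨-, -, -, -, h⟩) | ⟨-, ⟨o, h1, h2⟩ | ⟨o, h1, h2⟩⟩
  · exact touches_of_isolate_adj ha hd h
  · obtain ⟨o, ho⟩ := Finset.card_pos.1 (lt_of_lt_of_le (by omega : 0 < 4 * k) h)
    obtain ⟨h1, h2, h3⟩ := Finset.mem_filter.1 ho
    exact touches_of_common ha hd h1 h2 h3
  · obtain ⟨-, h3, h4, -⟩ := hO.mem a o h1
    exact touches_of_common ha hd h3 h4 h2
  · exact absurd (hO.mem d o h1).1 hdS

omit [PartialOrder V] in
/-- Outside `S`, the linked graph agrees with the reduced graph. -/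
theorem reduced_adj_of_linked_adj_of_notMem {x y : V} (hx : x ∉ S) (hy : y ∉ S)
    (h : (linked G S owner k s).Adj x y) : (reduced G S k).Adj x y := by
  have hO : IsLinkFamily (reduced G S k) (dense G S k) S (periphery G S) owner k s
    (links G S owner k s) := isLinkFamily_linkFamily
  rcases h with (h | ⟨-, h, -⟩) | ⟨-, ⟨o, h1, -⟩ | ⟨o, h1, -⟩⟩
  · exact h
  · exact absurd h (not_or.2 ⟨hx, hy⟩)
  · exact absurd (hO.mem x o h1).1 hx
  · exact absurd (hO.mem y o h1).1 hy

/-- The number of edges of the kernel. -/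
theorem ncard_edgeSet_kernelGraph_le (total : ∀ x y : V, x ≤ y ∨ y ≤ x) (hP : MeetsPaths G S)
    (hS : S.card ≤ 4 * k)
    (hown : IsOwner (reduced G S k) (periphery G S) owner s) (hks : k < s ^ 2) (hk : 1 ≤ k) :
    (kernelGraph G S owner k s).edgeSet.ncard ≤ 2760 * (k ^ 2 * s) := by
  set F := kernelGraph G S owner k s with hF
  set I := periphery G S with hI
  set D := core G S with hD
  have hs : 1 ≤ s := by
    rcases Nat.eq_zero_or_pos s with rfl | h
    · simp at hks
    · exact h
  have toL : ∀ {x y}, F.Adj x y → (linked G S owner k s).Adj x y := fun h => h.1.1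
  -- All other core vertices are dispensable and hence isolated in the reduced graph.
  let D' := S.biUnion fun a => Finset.univ.filter fun d => Touches G S a d ∧ a ∉ rich G S k
  have hD' : D'.card ≤ 4 * k * (12 * k) := by
    refine (Finset.card_biUnion_le_card_mul _ _ (12 * k) fun a ha => ?_).trans
      (Nat.mul_le_mul_right _ hS)
    by_cases har : a ∈ rich G S k
    · simp [har]
    · simpa [har] using (card_touches_lt ha har).le
  have memD' : ∀ {d y}, d ∈ D → (reduced G S k).Adj d y → d ∈ D' := by
    intro d y hd h
    have h1 : ∃ a, Touches G S a d ∧ a ∉ rich G S k := by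
      by_contra hcon
      exact h.2.1 (mem_dispensable.2 (Or.inr ⟨hd, hcon⟩))
    obtain ⟨a, h1, h2⟩ := h1
    exact Finset.mem_biUnion.2 ⟨a, h1.1, Finset.mem_filter.2 ⟨Finset.mem_univ _, h1, h2⟩⟩
  let N : V → Finset V := fun a => I.filter fun o => (pruned G S owner k s).Adj a o
  let J := S.biUnion N
  have hJ : J.card ≤ 4 * k * (313 * (k * s)) :=
    (Finset.card_biUnion_le_card_mul _ _ _ fun a ha =>
      card_periphery_adj_le total hS hown hks hk ha).trans (Nat.mul_le_mul_right _ hS)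
  -- The four sets cover the edges at `S`, the edges inside the core, the edges from periphery
  -- vertices with a neighbor in `S` to the core, and the edges from pendant vertices to the core.
  -- In the third set each periphery vertex has one core neighbor; in the fourth each core vertex
  -- has one pendant neighbor.
  let Q₁ : Finset (V × V) := S.biUnion fun a =>
    (S ∪ ((Finset.univ.filter fun d => Touches G S a d ∧ a ∉ rich G S k) ∪ N a)).image (Prod.mk a)
  let Q₂ : Finset (V × V) := D'.biUnion fun d =>
    (D.filter fun d' => d = d' ∨ G.Adj d d').image (Prod.mk d)
  let Q₃ : Finset (V × V) := J.biUnion fun o => (D.filter fun u => F.Adj o u).image (Prod.mk o)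
  let Q₄ : Finset (V × V) := D'.biUnion fun u =>
    (I.filter fun o => F.Adj o u ∧ Pendant (pruned G S owner k s) S I o).image fun o => (o, u)
  have c1 : Q₁.card ≤ 4 * k * (4 * k + 12 * k + 313 * (k * s)) := by
    refine (Finset.card_biUnion_le_card_mul _ _ _ fun a ha => ?_).trans (Nat.mul_le_mul_right _ hS)
    refine Finset.card_image_le.trans ?_
    have h1 := Finset.card_union_le S ((Finset.univ.filter fun d =>
      Touches G S a d ∧ a ∉ rich G S k) ∪ N a)
    have h2 := Finset.card_union_le (Finset.univ.filter fun d =>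
      Touches G S a d ∧ a ∉ rich G S k) (N a)
    have h3 : (N a).card ≤ 313 * (k * s) := card_periphery_adj_le total hS hown hks hk ha
    have h4 : (Finset.univ.filter fun d => Touches G S a d ∧ a ∉ rich G S k).card ≤ 12 * k := by
      by_cases har : a ∈ rich G S k
      · simp [har]
      · simpa [har] using (card_touches_lt ha har).le
    omega
  have c2 : Q₂.card ≤ 4 * k * (12 * k) * 3 := by
    refine (Finset.card_biUnion_le_card_mul _ _ 3 fun d hd => ?_).trans (Nat.mul_le_mul_right _ hD')
    obtain ⟨a, -, h⟩ := Finset.mem_biUnion.1 hd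
    exact Finset.card_image_le.trans
      (card_core_near_le hP (notMem_of_mem_core (Finset.mem_filter.1 h).2.1.2.1))
  have toG : ∀ {o u}, o ∈ I → F.Adj o u → G.Adj o u := fun ho h =>
    (reduced_adj_of_linked_adj ho (toL h).symm).1.symm
  have c3 : Q₃.card ≤ 4 * k * (313 * (k * s)) * 1 := by
    refine (Finset.card_biUnion_le_card_mul _ _ 1 fun o ho => ?_).trans (Nat.mul_le_mul_right _ hJ)
    refine Finset.card_image_le.trans (Finset.card_le_one.2 fun u hu v hv => ?_)
    obtain ⟨a, -, h⟩ := Finset.mem_biUnion.1 ho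
    obtain ⟨h1, h2⟩ := Finset.mem_filter.1 hu
    obtain ⟨h3, h4⟩ := Finset.mem_filter.1 hv
    have hoI := (Finset.mem_filter.1 h).1
    exact eq_of_mem_periphery hoI (notMem_of_mem_core h1) (notMem_of_mem_core h3) (toG hoI h2)
      (toG hoI h4)
  have c4 : Q₄.card ≤ 4 * k * (12 * k) * 1 := by
    refine (Finset.card_biUnion_le_card_mul _ _ 1 fun u hu => ?_).trans (Nat.mul_le_mul_right _ hD')
    refine Finset.card_image_le.trans (Finset.card_le_one.2 fun o ho o' ho' => ?_)
    obtain ⟨a, -, h⟩ := Finset.mem_biUnion.1 hu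
    have huD : u ∈ D := (Finset.mem_filter.1 h).2.1.2.1
    obtain ⟨-, h1, h2⟩ := Finset.mem_filter.1 ho
    obtain ⟨-, h3, h4⟩ := Finset.mem_filter.1 ho'
    have htri : o < o' ∨ o = o' ∨ o' < o := by
      rcases total o o' with h | h
      · exact h.lt_or_eq.imp id Or.inl
      · exact Or.inr (h.lt_or_eq.symm.imp Eq.symm id)
    rcases htri with hlt | heq | hlt
    · exact absurd ⟨h4, huD, o, hlt, h2, h1.1⟩ h3.2.1
    · exact heq
    · exact absurd ⟨h2, huD, o', hlt, h4, h3.1⟩ h1.2.1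
  have hcover : F.edgeSet ⊆ ((Q₁ ∪ (Q₂ ∪ (Q₃ ∪ Q₄))).image fun q => s(q.1, q.2) : Finset _) := by
    have hS1 : ∀ x y, x ∈ S → F.Adj x y → (x, y) ∈ Q₁ := by
      intro x y hx h
      refine Finset.mem_biUnion.2 ⟨x, hx, Finset.mem_image.2 ⟨y, ?_, rfl⟩⟩
      simp only [Finset.mem_union]
      rcases mem_cases (G := G) (S := S) y with hy | hy | hy
      · exact Or.inl hy
      · exact Or.inr (Or.inl (Finset.mem_filter.2 ⟨Finset.mem_univ _,
          touches_of_linked_adj hk hx hy (toL h)⟩))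
      · exact Or.inr (Or.inr (Finset.mem_filter.2 ⟨hy, h.1⟩))
    have hIC : ∀ o u, o ∈ I → u ∈ D → F.Adj o u → (o, u) ∈ Q₃ ∪ Q₄ := by
      intro o u ho hu h
      by_cases hpend : Pendant (pruned G S owner k s) S I o
      · refine Finset.mem_union_right _ (Finset.mem_biUnion.2 ⟨u, ?_, Finset.mem_image.2
          ⟨o, Finset.mem_filter.2 ⟨ho, h, hpend⟩, rfl⟩⟩)
        exact memD' hu (reduced_adj_of_linked_adj ho (toL h).symm)
      · have : ∃ a, a ∈ S ∧ (pruned G S owner k s).Adj a o := by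
          by_contra hcon
          exact hpend ⟨ho, hcon⟩
        obtain ⟨a, h1, h2⟩ := this
        exact Finset.mem_union_left _ (Finset.mem_biUnion.2 ⟨o, Finset.mem_biUnion.2
          ⟨a, h1, Finset.mem_filter.2 ⟨ho, h2⟩⟩, Finset.mem_image.2
          ⟨u, Finset.mem_filter.2 ⟨hu, h⟩, rfl⟩⟩)
    intro e he
    induction e using Sym2.ind with
    | _ x y =>
      have hxy : F.Adj x y := he
      simp only [Finset.coe_image, Set.mem_image, Finset.mem_coe, Finset.mem_union]
      simp only [Finset.mem_union] at hIC
      rcases mem_cases (G := G) (S := S) x with hx | hx | hx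
      · exact ⟨(x, y), Or.inl (hS1 _ _ hx hxy), rfl⟩
      · rcases mem_cases (G := G) (S := S) y with hy | hy | hy
        · exact ⟨(y, x), Or.inl (hS1 _ _ hy hxy.symm), Sym2.eq_swap⟩
        · have hred := reduced_adj_of_linked_adj_of_notMem (notMem_of_mem_core hx)
            (notMem_of_mem_core hy) (toL hxy)
          refine ⟨(x, y), Or.inr (Or.inl (Finset.mem_biUnion.2 ⟨x, memD' hx hred,
            Finset.mem_image.2 ⟨y, Finset.mem_filter.2 ⟨hy, Or.inr hred.1⟩, rfl⟩⟩)), rfl⟩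
        · exact ⟨(y, x), Or.inr (Or.inr (hIC _ _ hy hx hxy.symm)), Sym2.eq_swap⟩
      · rcases mem_cases (G := G) (S := S) y with hy | hy | hy
        · exact ⟨(y, x), Or.inl (hS1 _ _ hy hxy.symm), Sym2.eq_swap⟩
        · exact ⟨(x, y), Or.inr (Or.inr (hIC _ _ hx hy hxy)), rfl⟩
        · exact absurd hy (not_adj_of_mem_periphery hx (toG hx hxy))
  have h1 := Set.ncard_le_ncard hcover (Finset.finite_toSet _)
  rw [Set.ncard_coe_finset] at h1
  have h2 := (Finset.card_image_le (s := Q₁ ∪ (Q₂ ∪ (Q₃ ∪ Q₄))) (f := fun q => s(q.1, q.2)))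
  have d1 := Finset.card_union_le Q₁ (Q₂ ∪ (Q₃ ∪ Q₄))
  have d2 := Finset.card_union_le Q₂ (Q₃ ∪ Q₄)
  have d3 := Finset.card_union_le Q₃ Q₄
  -- The total is `256 * k ^ 2 + 2504 * (k ^ 2 * s)`, which gives the constant `2760`.
  have e1 : k ^ 2 ≤ k ^ 2 * s := Nat.le_mul_of_pos_right _ hs
  have e2 : 4 * k * (4 * k + 12 * k + 313 * (k * s)) = 64 * k ^ 2 + 1252 * (k ^ 2 * s) := by ring
  have e3 : 4 * k * (12 * k) * 3 = 144 * k ^ 2 := by ring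
  have e4 : 4 * k * (313 * (k * s)) * 1 = 1252 * (k ^ 2 * s) := by ring
  have e5 : 4 * k * (12 * k) * 1 = 48 * k ^ 2 := by ring
  omega

end Kernel


/-! ### A language of bounded loops -/

/-- Arithmetic terms with bounded sums. The bound of all sums is variable 2. -/
inductive Tm where
  | const (c : ℕ)
  | var (x : ℕ)
  | get (a : ℕ) (i j : Tm)
  | add (t u : Tm)
  | sub (t u : Tm)
  | sum (x : ℕ) (t : Tm)

/-- The value of a term. -/
def Tm.eval : Tm → RamState → ℕ
  | .const c, _ => c
  | .var x, s => s.var x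
  | .get a i j, s => s.arr a (i.eval s) (j.eval s)
  | .add t u, s => t.eval s + u.eval s
  | .sub t u, s => t.eval s - u.eval s
  | .sum x t, s => ∑ i ∈ Finset.range (s.var 2), t.eval (s.setVar x i)

/-- All variables are less than `b`, and variable 2 is not bound. -/
def Tm.ok (b : ℕ) : Tm → Bool
  | .const _ => true
  | .var x => x < b
  | .get _ i j => i.ok b && j.ok b
  | .add t u => t.ok b && u.ok b
  | .sub t u => t.ok b && u.ok b
  | .sum x t => (x < b && x != 2) && t.ok b

/-- The program that writes the value of a term to variable `r` and uses only the variables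
from `r` on. -/
def Tm.code : Tm → ℕ → RamProg
  | .const c, r => .assign r (.const c)
  | .var x, r => .assign r (.var x)
  | .get a i j, r =>
      .seq (i.code r) (.seq (j.code (r + 1)) (.assign r (.get a (.var r) (.var (r + 1)))))
  | .add t u, r =>
      .seq (t.code r) (.seq (u.code (r + 1)) (.assign r (.add (.var r) (.var (r + 1)))))
  | .sub t u, r =>
      .seq (t.code r) (.seq (u.code (r + 1)) (.assign r (.sub (.var r) (.var (r + 1)))))
  | .sum x t, r =>
      .seq (.assign (r + 1) (.var x)) (.seq (.assign r (.const 0)) (.seq (.assign x (.const 0))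
        (.seq (.loop (.sub (.var 2) (.var x)) (.seq (t.code (r + 2))
          (.seq (.assign r (.add (.var r) (.var (r + 2)))) (.assign x (.add (.var x) (.const 1))))))
        (.assign x (.var (r + 1))))))

/-- A bound for the time. -/
noncomputable def Tm.cost : Tm → Polynomial ℕ
  | .const _ => 2
  | .var _ => 2
  | .get _ i j => i.cost + j.cost + 4
  | .add t u => t.cost + u.cost + 4
  | .sub t u => t.cost + u.cost + 4
  | .sum _ t => Polynomial.X * (t.cost + 12) + 12

/-- The memories agree, except for the variables from `b` on. -/
def RamState.Agree (b : ℕ) (s s' : RamState) : Prop :=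
  s.arr = s'.arr ∧ ∀ x < b, s.var x = s'.var x

section Lang

variable {b r : ℕ} {s s' s'' : RamState}

theorem RamState.Agree.refl : s.Agree b s := ⟨rfl, fun _ _ => rfl⟩

theorem RamState.Agree.symm (h : s.Agree b s') : s'.Agree b s :=
  ⟨h.1.symm, fun x hx => (h.2 x hx).symm⟩

theorem RamState.Agree.trans (h : s.Agree b s') (h' : s'.Agree b s'') : s.Agree b s'' :=
  ⟨h.1.trans h'.1, fun x hx => (h.2 x hx).trans (h'.2 x hx)⟩

theorem RamState.Agree.mono (h : s.Agree r s') (hb : b ≤ r) : s.Agree b s' :=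
  ⟨h.1, fun x hx => h.2 x (hx.trans_le hb)⟩

theorem RamState.setVar_var (x v y : ℕ) :
    (s.setVar x v).var y = if y = x then v else s.var y := by
  simp [RamState.setVar, Function.update_apply]

@[simp] theorem RamState.setArr_var (a i j v : ℕ) : (s.setArr a i j v).var = s.var := rfl

theorem RamState.setArr_arr (a i j v a' i' j' : ℕ) :
    (s.setArr a i j v).arr a' i' j' = if a' = a ∧ i' = i ∧ j' = j then v else s.arr a' i' j' := by
  by_cases ha : a' = a
  · subst ha
    by_cases hi : i' = i
    · subst hi
      by_cases hj : j' = j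
      · subst hj
        simp [RamState.setArr]
      · simp [RamState.setArr, hj]
    · simp [RamState.setArr, hi]
  · simp [RamState.setArr, ha]

theorem RamState.Agree.setVar (h : s.Agree b s') (x v : ℕ) :
    (s.setVar x v).Agree b (s'.setVar x v) := by
  refine ⟨h.1, fun y hy => ?_⟩
  rw [RamState.setVar_var, RamState.setVar_var, h.2 y hy]

theorem RamState.agree_setVar (hr : b ≤ r) (v : ℕ) : s.Agree b (s.setVar r v) := by
  refine ⟨rfl, fun y hy => ?_⟩
  rw [RamState.setVar_var, if_neg (by omega)]

theorem Tm.eval_congr (t : Tm) (hb : 2 < b) (ht : t.ok b = true) (h : s.Agree b s') :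
    t.eval s = t.eval s' := by
  induction t generalizing s s' with
  | const => rfl
  | var x => exact h.2 x (by simpa [Tm.ok] using ht)
  | get a i j ihi ihj =>
    simp only [Tm.ok, Bool.and_eq_true] at ht
    simp only [Tm.eval, ihi ht.1 h, ihj ht.2 h, h.1]
  | add t u iht ihu =>
    simp only [Tm.ok, Bool.and_eq_true] at ht
    simp only [Tm.eval, iht ht.1 h, ihu ht.2 h]
  | sub t u iht ihu =>
    simp only [Tm.ok, Bool.and_eq_true] at ht
    simp only [Tm.eval, iht ht.1 h, ihu ht.2 h]
  | sum x t ih =>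
    simp only [Tm.ok, Bool.and_eq_true] at ht
    simp only [Tm.eval, h.2 2 hb]
    exact Finset.sum_congr rfl fun i _ => ih ht.2 (h.setVar x i)

/-- Subterms are evaluated into ever higher variables, so pending results are never overwritten. A
sum saves its bound variable in `r + 1` and restores it at the end; this is what makes the memories
agree below `r`. -/
theorem Tm.code_runs (t : Tm) (hb : 2 < b) (ht : t.ok b = true) (hr : b ≤ r) (s : RamState) :
    ∃ T s', (t.code r).Runs s T s' ∧ T ≤ t.cost.eval (s.var 2) ∧ s.Agree r s' ∧
      s'.var r = t.eval s := by
  induction t generalizing r s with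
  | const c =>
    refine ⟨_, _, .assign _ _ _, ?_, RamState.agree_setVar le_rfl _, ?_⟩
    · simp [RamExp.cost, Tm.cost]
    · simp [RamState.setVar_var, RamExp.val, Tm.eval]
  | var x =>
    refine ⟨_, _, .assign _ _ _, ?_, RamState.agree_setVar le_rfl _, ?_⟩
    · simp [RamExp.cost, Tm.cost]
    · simp [RamState.setVar_var, RamExp.val, Tm.eval]
  | get a t u iht ihu =>
    simp only [Tm.ok, Bool.and_eq_true] at ht
    obtain ⟨T₁, s₁, h1, h2, h3, h4⟩ := iht ht.1 hr s
    obtain ⟨T₂, s₂, h5, h6, h7, h8⟩ := ihu ht.2 (hr.trans (Nat.le_succ r)) s₁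
    refine ⟨_, _, .seq h1 (.seq h5 (.assign _ _ _)), ?_, ?_, ?_⟩
    · rw [← h3.2 2 (by omega)] at h6
      simp only [RamExp.cost, Tm.cost, Polynomial.eval_add, Polynomial.eval_ofNat]
      omega
    · exact (h3.trans (h7.mono (Nat.le_succ r))).trans (RamState.agree_setVar le_rfl _)
    · simp only [RamState.setVar_var, RamExp.val, if_true, Tm.eval]
      rw [h8, ← h7.2 r (by omega), h4, ← Tm.eval_congr u hb ht.2 (h3.mono hr), ← h7.1, ← h3.1]
  | add t u iht ihu =>
    simp only [Tm.ok, Bool.and_eq_true] at ht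
    obtain ⟨T₁, s₁, h1, h2, h3, h4⟩ := iht ht.1 hr s
    obtain ⟨T₂, s₂, h5, h6, h7, h8⟩ := ihu ht.2 (hr.trans (Nat.le_succ r)) s₁
    refine ⟨_, _, .seq h1 (.seq h5 (.assign _ _ _)), ?_, ?_, ?_⟩
    · rw [← h3.2 2 (by omega)] at h6
      simp only [RamExp.cost, Tm.cost, Polynomial.eval_add, Polynomial.eval_ofNat]
      omega
    · exact (h3.trans (h7.mono (Nat.le_succ r))).trans (RamState.agree_setVar le_rfl _)
    · simp only [RamState.setVar_var, RamExp.val, if_true, Tm.eval]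
      rw [h8, ← h7.2 r (by omega), h4, ← Tm.eval_congr u hb ht.2 (h3.mono hr)]
  | sub t u iht ihu =>
    simp only [Tm.ok, Bool.and_eq_true] at ht
    obtain ⟨T₁, s₁, h1, h2, h3, h4⟩ := iht ht.1 hr s
    obtain ⟨T₂, s₂, h5, h6, h7, h8⟩ := ihu ht.2 (hr.trans (Nat.le_succ r)) s₁
    refine ⟨_, _, .seq h1 (.seq h5 (.assign _ _ _)), ?_, ?_, ?_⟩
    · rw [← h3.2 2 (by omega)] at h6
      simp only [RamExp.cost, Tm.cost, Polynomial.eval_add, Polynomial.eval_ofNat]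
      omega
    · exact (h3.trans (h7.mono (Nat.le_succ r))).trans (RamState.agree_setVar le_rfl _)
    · simp only [RamState.setVar_var, RamExp.val, if_true, Tm.eval]
      rw [h8, ← h7.2 r (by omega), h4, ← Tm.eval_congr u hb ht.2 (h3.mono hr)]
  | sum x t ih =>
    simp only [Tm.ok, Bool.and_eq_true, decide_eq_true_eq, bne_iff_ne] at ht
    obtain ⟨⟨hxb, hx2⟩, ht⟩ := ht
    let L : RamProg := .loop (.sub (.var 2) (.var x)) (.seq (t.code (r + 2))
          (.seq (.assign r (.add (.var r) (.var (r + 2)))) (.assign x (.add (.var x) (.const 1)))))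
    have key : ∀ d i (s₁ : RamState), i + d = s.var 2 → (s.setVar x i).Agree r s₁ →
        s₁.var r = ∑ j ∈ Finset.range i, t.eval (s.setVar x j) → s₁.var (r + 1) = s.var x →
        ∃ T s₂, L.Runs s₁ T s₂ ∧ T ≤ d * (t.cost.eval (s.var 2) + 12) + 4 ∧
          (s.setVar x (s.var 2)).Agree r s₂ ∧
          s₂.var r = ∑ j ∈ Finset.range (s.var 2), t.eval (s.setVar x j) ∧
          s₂.var (r + 1) = s.var x := by
      intro d
      induction d with
      | zero =>
        intro i s₁ hi hA hsum hsave
        have hi' : i = s.var 2 := by omega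
        have hx : s₁.var x = i := by
          rw [← hA.2 x (by omega), RamState.setVar_var, if_pos rfl]
        have h2 : s₁.var 2 = s.var 2 := by
          rw [← hA.2 2 (by omega), RamState.setVar_var, if_neg (Ne.symm hx2)]
        refine ⟨_, s₁, .loop_false ?_, ?_, ?_, ?_, hsave⟩
        · simp only [RamExp.val]; omega
        · simp [RamExp.cost]
        · rw [← hi']; exact hA
        · rw [← hi']; exact hsum
      | succ d ihd =>
        intro i s₁ hi hA hsum hsave
        have hx : s₁.var x = i := by
          rw [← hA.2 x (by omega), RamState.setVar_var, if_pos rfl]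
        have h2 : s₁.var 2 = s.var 2 := by
          rw [← hA.2 2 (by omega), RamState.setVar_var, if_neg (Ne.symm hx2)]
        obtain ⟨T₁, s₂, h3, h4, h5, h6⟩ := ih ht (r := r + 2) (by omega) s₁
        have h7 : s₂.var x = i := by rw [← h5.2 x (by omega), hx]
        obtain ⟨T₂, s₃, h8, h9, h10⟩ := ihd (i + 1)
          ((s₂.setVar r (s₂.var r + s₂.var (r + 2))).setVar x (i + 1)) (by omega) (by
            refine ⟨hA.1.trans h5.1, fun y hy => ?_⟩
            simp only [RamState.setVar_var]
            by_cases hyx : y = x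
            · simp [hyx]
            · rw [if_neg hyx, if_neg hyx, if_neg (by omega), ← h5.2 y (by omega), ← hA.2 y hy,
                RamState.setVar_var, if_neg hyx]) (by
            simp only [RamState.setVar_var]
            rw [if_neg (by omega), if_pos trivial, h6, ← h5.2 r (by omega), hsum,
              Finset.sum_range_succ, Tm.eval_congr t hb ht (hA.mono hr)]) (by
            simp only [RamState.setVar_var]
            rw [if_neg (by omega), if_neg (by omega), ← h5.2 (r + 1) (by omega), hsave])
        have h11 := RamProg.Runs.assign (s₂.setVar r ((RamExp.add (.var r) (.var (r + 2))).val s₂))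
          x (.add (.var x) (.const 1))
        have h12 : (RamExp.add (.var x) (.const 1)).val
            (s₂.setVar r ((RamExp.add (.var r) (.var (r + 2))).val s₂)) = i + 1 := by
          simp only [RamExp.val, RamState.setVar_var]
          rw [if_neg (by omega), h7]
        rw [h12] at h11
        refine ⟨_, s₃, .loop_true ?_ (.seq h3 (.seq (.assign _ _ _) h11)) h8, ?_, h10⟩
        · simp only [RamExp.val]; omega
        -- The loop test and the two additions take four units each, hence `12` for a round.
        · rw [h2] at h4
          simp only [RamExp.cost]
          have : (d + 1) * (t.cost.eval (s.var 2) + 12) =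
            d * (t.cost.eval (s.var 2) + 12) + (t.cost.eval (s.var 2) + 12) := by ring
          omega
    let s₀ := ((s.setVar (r + 1) (s.var x)).setVar r 0).setVar x 0
    obtain ⟨T, s₂, h1, h2, h3, h4, h5⟩ := key (s.var 2) 0 s₀ (by omega) (by
        refine ⟨rfl, fun y hy => ?_⟩
        simp only [s₀, RamState.setVar_var]
        split_ifs <;> first | rfl | omega) (by
        simp only [s₀, RamState.setVar_var]
        rw [if_neg (by omega), if_pos trivial, Finset.sum_range_zero]) (by
        simp only [s₀, RamState.setVar_var]
        rw [if_neg (by omega), if_neg (by omega), if_pos trivial])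
    refine ⟨_, _, .seq (.assign _ _ _) (.seq (.assign _ _ _) (.seq (.assign _ _ _)
      (.seq h1 (.assign _ _ _)))), ?_, ?_, ?_⟩
    · simp only [RamExp.cost, Tm.cost, Polynomial.eval_add, Polynomial.eval_mul, Polynomial.eval_X,
        Polynomial.eval_ofNat]
      omega
    · refine ⟨h3.1, fun y hy => ?_⟩
      simp only [RamState.setVar_var, RamExp.val]
      by_cases hyx : y = x
      · rw [if_pos hyx, h5, hyx]
      · rw [if_neg hyx, ← h3.2 y hy, RamState.setVar_var, if_neg hyx]
    · simp only [RamState.setVar_var, Tm.eval]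
      rw [if_neg (by omega), h4]

/-- Programs whose loops run over the numbers less than variable 2. -/
inductive Prg where
  | skip
  | assign (x : ℕ) (t : Tm)
  | store (a : ℕ) (i j t : Tm)
  | seq (p q : Prg)
  | ite (t : Tm) (p q : Prg)
  | loop (x : ℕ) (p : Prg)

/-- The memory after `n` rounds of a loop. -/
def RamState.iter (f : RamState → RamState) (x : ℕ) (s : RamState) : ℕ → RamState
  | 0 => s
  | n + 1 => f ((RamState.iter f x s n).setVar x n)

/-- The memory after the run of a program. -/
def Prg.den : Prg → RamState → RamState
  | .skip, s => s
  | .assign x t, s => s.setVar x (t.eval s)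
  | .store a i j t, s => s.setArr a (i.eval s) (j.eval s) (t.eval s)
  | .seq p q, s => q.den (p.den s)
  | .ite t p q, s => if t.eval s = 0 then q.den s else p.den s
  | .loop x p, s => (RamState.iter p.den x s (s.var 2)).setVar x (s.var 2)

/-- The program changes the variable `x`. -/
def Prg.writes (x : ℕ) : Prg → Bool
  | .skip => false
  | .assign y _ => x == y
  | .store _ _ _ _ => false
  | .seq p q => p.writes x || q.writes x
  | .ite _ p q => p.writes x || q.writes x
  | .loop y p => x == y || p.writes x

/-- Only variables less than `b` occur, variable 2 is not changed, and loops do not change their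
counters. -/
def Prg.ok (b : ℕ) : Prg → Bool
  | .skip => true
  | .assign x t => (x < b && x != 2) && t.ok b
  | .store _ i j t => (i.ok b && j.ok b) && t.ok b
  | .seq p q => p.ok b && q.ok b
  | .ite t p q => (t.ok b && p.ok b) && q.ok b
  | .loop x p => (x < b && x != 2) && (!p.writes x && p.ok b)

/-- The translation. -/
def Prg.code (b : ℕ) : Prg → RamProg
  | .skip => .skip
  | .assign x t => .seq (t.code b) (.assign x (.var b))
  | .store a i j t => .seq (i.code b) (.seq (j.code (b + 1)) (.seq (t.code (b + 2))
      (.store a (.var b) (.var (b + 1)) (.var (b + 2)))))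
  | .seq p q => .seq (p.code b) (q.code b)
  | .ite t p q => .seq (t.code b) (.ite (.var b) (p.code b) (q.code b))
  | .loop x p => .seq (.assign x (.const 0)) (.loop (.sub (.var 2) (.var x))
      (.seq (p.code b) (.assign x (.add (.var x) (.const 1)))))

/-- A bound for the time. -/
noncomputable def Prg.cost : Prg → Polynomial ℕ
  | .skip => 1
  | .assign _ t => t.cost + 2
  | .store _ i j t => i.cost + j.cost + t.cost + 4
  | .seq p q => p.cost + q.cost
  | .ite t p q => t.cost + p.cost + q.cost + 2
  | .loop _ p => Polynomial.X * (p.cost + 8) + 6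

theorem Prg.den_var (p : Prg) {x : ℕ} (h : p.writes x = false) (s : RamState) :
    (p.den s).var x = s.var x := by
  induction p generalizing s with
  | skip => rfl
  | assign y t =>
    simp only [Prg.writes, beq_eq_false_iff_ne] at h
    simp [Prg.den, RamState.setVar_var, h]
  | store => rfl
  | seq p q ihp ihq =>
    simp only [Prg.writes, Bool.or_eq_false_iff] at h
    simp [Prg.den, ihp h.1, ihq h.2]
  | ite t p q ihp ihq =>
    simp only [Prg.writes, Bool.or_eq_false_iff] at h
    simp only [Prg.den]
    split_ifs
    exacts [ihq h.2 s, ihp h.1 s]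
  | loop y p ih =>
    simp only [Prg.writes, Bool.or_eq_false_iff, beq_eq_false_iff_ne] at h
    have : ∀ n, (RamState.iter p.den y s n).var x = s.var x := by
      intro n
      induction n with
      | zero => rfl
      | succ n ihn => rw [RamState.iter, ih h.2, RamState.setVar_var, if_neg h.1, ihn]
    simp [Prg.den, RamState.setVar_var, h.1, this]

/-- The bound of all loops stays fixed, so every part of a program has its time bounded by a
polynomial in the initial value of variable 2. -/
theorem Prg.writes_two (p : Prg) (h : p.ok b = true) : p.writes 2 = false := by
  induction p with
  | skip => rfl
  | assign y t =>
    simp only [Prg.ok, Bool.and_eq_true, bne_iff_ne] at h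
    simpa [Prg.writes] using Ne.symm h.1.2
  | store => rfl
  | seq p q ihp ihq =>
    simp only [Prg.ok, Bool.and_eq_true] at h
    simp [Prg.writes, ihp h.1, ihq h.2]
  | ite t p q ihp ihq =>
    simp only [Prg.ok, Bool.and_eq_true] at h
    simp [Prg.writes, ihp h.1.2, ihq h.2]
  | loop y p ih =>
    simp only [Prg.ok, Bool.and_eq_true, bne_iff_ne] at h
    simpa [Prg.writes, ih h.2.2] using Ne.symm h.1.2

/-- The variables from `b` on are scratch space that the source program cannot see, so agreement
below `b` carries through all constructs. In a loop the body leaves the counter alone, hence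
incrementing it gives the next index. -/
theorem Prg.code_runs (p : Prg) (hb : 2 < b) (hp : p.ok b = true) {s σ : RamState}
    (hs : s.Agree b σ) : ∃ T s', (p.code b).Runs s T s' ∧ T ≤ p.cost.eval (σ.var 2) ∧
      s'.Agree b (p.den σ) := by
  induction p generalizing s σ with
  | skip => exact ⟨_, s, .skip s, by simp [Prg.cost], hs⟩
  | assign x t =>
    simp only [Prg.ok, Bool.and_eq_true] at hp
    obtain ⟨T, s₁, h1, h2, h3, h4⟩ := t.code_runs hb hp.2 le_rfl s
    refine ⟨_, _, .seq h1 (.assign _ _ _), ?_, ?_⟩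
    · rw [hs.2 2 hb] at h2
      simp only [RamExp.cost, Prg.cost, Polynomial.eval_add, Polynomial.eval_ofNat]
      omega
    · simp only [RamExp.val, h4, Prg.den, t.eval_congr hb hp.2 hs]
      exact (h3.symm.trans hs).setVar _ _
  | store a i j t =>
    simp only [Prg.ok, Bool.and_eq_true] at hp
    obtain ⟨T₁, s₁, h1, h2, h3, h4⟩ := i.code_runs hb hp.1.1 le_rfl s
    obtain ⟨T₂, s₂, h5, h6, h7, h8⟩ := j.code_runs hb hp.1.2 (Nat.le_succ b) s₁
    obtain ⟨T₃, s₃, h9, h10, h11, h12⟩ := t.code_runs hb hp.2 (Nat.le_add_right b 2) s₂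
    have a1 := h3
    have a2 := a1.trans (h7.mono (Nat.le_succ b))
    have a3 := a2.trans (h11.mono (Nat.le_add_right b 2))
    refine ⟨_, _, .seq h1 (.seq h5 (.seq h9 (.store _ _ _ _ _))), ?_, ?_⟩
    · rw [← a2.2 2 hb, hs.2 2 hb] at h10
      rw [← a1.2 2 hb, hs.2 2 hb] at h6
      rw [hs.2 2 hb] at h2
      simp only [RamExp.cost, Prg.cost, Polynomial.eval_add, Polynomial.eval_ofNat]
      omega
    · have e1 : s₃.var b = i.eval σ := by
        rw [← h11.2 b (by omega), ← h7.2 b (by omega), h4, i.eval_congr hb hp.1.1 hs]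
      have e2 : s₃.var (b + 1) = j.eval σ := by
        rw [← h11.2 (b + 1) (by omega), h8, j.eval_congr hb hp.1.2 (a1.symm.trans hs)]
      have e3 : s₃.var (b + 2) = t.eval σ := by
        rw [h12, t.eval_congr hb hp.2 (a2.symm.trans hs)]
      have a4 := a3.symm.trans hs
      simp only [RamExp.val, e1, e2, e3, Prg.den]
      exact ⟨by simp only [RamState.setArr, a4.1], a4.2⟩
  | seq p q ihp ihq =>
    simp only [Prg.ok, Bool.and_eq_true] at hp
    obtain ⟨T₁, s₁, h1, h2, h3⟩ := ihp hp.1 hs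
    obtain ⟨T₂, s₂, h4, h5, h6⟩ := ihq hp.2 h3
    refine ⟨_, _, .seq h1 h4, ?_, h6⟩
    rw [p.den_var (p.writes_two hp.1)] at h5
    simp only [Prg.cost, Polynomial.eval_add]
    omega
  | ite t p q ihp ihq =>
    simp only [Prg.ok, Bool.and_eq_true] at hp
    obtain ⟨T, s₁, h1, h2, h3, h4⟩ := t.code_runs hb hp.1.1 le_rfl s
    rw [hs.2 2 hb] at h2
    rw [t.eval_congr hb hp.1.1 hs] at h4
    by_cases h : t.eval σ = 0
    · obtain ⟨T', s₂, h5, h6, h7⟩ := ihq hp.2 (h3.symm.trans hs)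
      refine ⟨_, s₂, .seq h1 (.ite_false (by simp only [RamExp.val]; rw [h4, h]) h5), ?_, ?_⟩
      · simp only [RamExp.cost, Prg.cost, Polynomial.eval_add, Polynomial.eval_ofNat]
        omega
      · simpa [Prg.den, h] using h7
    · obtain ⟨T', s₂, h5, h6, h7⟩ := ihp hp.1.2 (h3.symm.trans hs)
      refine ⟨_, s₂, .seq h1 (.ite_true (by simp only [RamExp.val]; rwa [h4]) h5), ?_, ?_⟩
      · simp only [RamExp.cost, Prg.cost, Polynomial.eval_add, Polynomial.eval_ofNat]
        omega
      · simpa [Prg.den, h] using h7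
  | loop x p ih =>
    simp only [Prg.ok, Bool.and_eq_true, bne_iff_ne, decide_eq_true_eq, Bool.not_eq_true'] at hp
    obtain ⟨⟨hxb, hx2⟩, hw, hp⟩ := hp
    have hw2 := p.writes_two hp
    let I := RamState.iter p.den x σ
    have hI2 : ∀ n, (I n).var 2 = σ.var 2 := by
      intro n
      induction n with
      | zero => rfl
      | succ n ihn =>
        change (p.den ((I n).setVar x n)).var 2 = _
        rw [p.den_var hw2, RamState.setVar_var, if_neg (Ne.symm hx2), ihn]
    have key : ∀ d i (s₁ : RamState), i + d = σ.var 2 → s₁.Agree b ((I i).setVar x i) →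
        ∃ T s₂, RamProg.Runs (.loop (.sub (.var 2) (.var x))
          (.seq (p.code b) (.assign x (.add (.var x) (.const 1))))) s₁ T s₂ ∧
          T ≤ d * (p.cost.eval (σ.var 2) + 8) + 4 ∧
          s₂.Agree b ((I (σ.var 2)).setVar x (σ.var 2)) := by
      intro d
      induction d with
      | zero =>
        intro i s₁ hi hA
        have hi' : i = σ.var 2 := by omega
        have h2 : s₁.var 2 = σ.var 2 := by
          rw [hA.2 2 hb, RamState.setVar_var, if_neg (Ne.symm hx2), hI2]
        have hx : s₁.var x = i := by rw [hA.2 x hxb, RamState.setVar_var, if_pos rfl]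
        refine ⟨_, s₁, .loop_false ?_, ?_, ?_⟩
        · simp only [RamExp.val]; omega
        · simp [RamExp.cost]
        · rw [← hi']; exact hA
      | succ d ihd =>
        intro i s₁ hi hA
        have h2 : s₁.var 2 = σ.var 2 := by
          rw [hA.2 2 hb, RamState.setVar_var, if_neg (Ne.symm hx2), hI2]
        have hx : s₁.var x = i := by rw [hA.2 x hxb, RamState.setVar_var, if_pos rfl]
        obtain ⟨T₁, s₂, h3, h4, h5⟩ := ih hp hA
        have h5' : s₂.Agree b (I (i + 1)) := h5
        have h6 : s₂.var x = i := by
          rw [h5.2 x hxb, p.den_var hw, RamState.setVar_var, if_pos rfl]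
        have h7 : (RamExp.add (.var x) (.const 1)).val s₂ = i + 1 := by
          simp only [RamExp.val, h6]
        have h8 := RamProg.Runs.assign s₂ x (.add (.var x) (.const 1))
        rw [h7] at h8
        obtain ⟨T₂, s₃, h9, h10, h11⟩ := ihd (i + 1) (s₂.setVar x (i + 1)) (by omega)
          (h5'.setVar _ _)
        refine ⟨_, s₃, .loop_true ?_ (.seq h3 h8) h9, ?_, h11⟩
        · simp only [RamExp.val]; omega
        · rw [RamState.setVar_var, if_neg (Ne.symm hx2), hI2] at h4
          simp only [RamExp.cost]
          have : (d + 1) * (p.cost.eval (σ.var 2) + 8) =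
            d * (p.cost.eval (σ.var 2) + 8) + (p.cost.eval (σ.var 2) + 8) := by ring
          omega
    obtain ⟨T, s₂, h1, h2, h3⟩ := key (σ.var 2) 0 (s.setVar x 0) (by omega) (hs.setVar x 0)
    refine ⟨_, s₂, .seq (.assign _ _ _) h1, ?_, h3⟩
    simp only [RamExp.cost, Prg.cost, Polynomial.eval_add, Polynomial.eval_mul, Polynomial.eval_X,
      Polynomial.eval_ofNat]
    omega

end Lang


/-! ### Formulas as terms -/

/-- The negation of a truth value. -/
def Tm.not (t : Tm) : Tm := .sub (.const 1) t

/-- The conjunction of truth values. -/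
def Tm.and (t u : Tm) : Tm := .sub (.add t u) (.const 1)

/-- The disjunction of truth values. -/
def Tm.or (t u : Tm) : Tm := .sub (.const 1) (.sub (.const 1) (.add t u))

/-- The comparison of numbers. -/
def Tm.le (t u : Tm) : Tm := .sub (.const 1) (.sub t u)

/-- Bounded existential quantification. -/
def Tm.ex (x : ℕ) (t : Tm) : Tm := .sub (.const 1) (.sub (.const 1) (.sum x t))

/-- Bounded universal quantification. -/
def Tm.all (x : ℕ) (t : Tm) : Tm := (Tm.ex x t.not).not

/-- Multiples of a number. -/
def Tm.times (t : Tm) : ℕ → Tm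
  | 0 => .const 0
  | c + 1 => .add (t.times c) t

section Formulas

open scoped Classical

/-- The term `t` has the value `m`. -/
def Val (t : Tm) (s : RamState) (m : ℕ) : Prop := t.eval s = m

/-- The term `t` has the truth value of `P`. -/
def Dec (t : Tm) (s : RamState) (P : Prop) : Prop := t.eval s = if P then 1 else 0

variable {s : RamState} {t u : Tm} {P Q : Prop} {m m' n : ℕ}

theorem Val.const (c : ℕ) : Val (.const c) s c := rfl

theorem Val.var {x : ℕ} (h : s.var x = m) : Val (.var x) s m := h

theorem Val.add (h : Val t s m) (h' : Val u s m') : Val (.add t u) s (m + m') := by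
  simp only [Val, Tm.eval] at *; rw [h, h']

theorem Val.sub (h : Val t s m) (h' : Val u s m') : Val (.sub t u) s (m - m') := by
  simp only [Val, Tm.eval] at *; rw [h, h']

theorem Val.times (h : Val t s m) (c : ℕ) : Val (t.times c) s (c * m) := by
  induction c with
  | zero => simp [Val, Tm.times, Tm.eval]
  | succ c ih => rw [Nat.succ_mul]; exact ih.add h

theorem Val.le (h : Val t s m) (h' : Val u s m') : Dec (t.le u) s (m ≤ m') := by
  simp only [Val, Dec, Tm.eval, Tm.le] at *
  rw [h, h']
  split_ifs <;> omega

theorem Dec.congr (h : Dec t s P) (hPQ : P ↔ Q) : Dec t s Q := by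
  rwa [← propext hPQ]

theorem Dec.not (h : Dec t s P) : Dec t.not s (¬ P) := by
  simp only [Dec, Tm.eval, Tm.not] at *
  by_cases hP : P <;> simp [hP, h]

theorem Dec.and (h : Dec t s P) (h' : Dec u s Q) : Dec (t.and u) s (P ∧ Q) := by
  simp only [Dec, Tm.eval, Tm.and] at *
  by_cases hP : P <;> by_cases hQ : Q <;> simp [hP, hQ, h, h']

theorem Dec.or (h : Dec t s P) (h' : Dec u s Q) : Dec (t.or u) s (P ∨ Q) := by
  simp only [Dec, Tm.eval, Tm.or] at *
  by_cases hP : P <;> by_cases hQ : Q <;> simp [hP, hQ, h, h']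

theorem Dec.imp (h : Dec t s P) (h' : Dec u s Q) : Dec (t.not.or u) s (P → Q) :=
  (h.not.or h').congr imp_iff_not_or.symm

theorem Dec.eval_eq_zero (h : Dec t s P) : t.eval s = 0 ↔ ¬ P := by
  rw [Dec] at h
  by_cases hP : P <;> simp [hP, h]

theorem Val.eq (h : Val t s m) (h' : Val u s m') :
    Dec ((t.le u).and (u.le t)) s (m = m') :=
  ((h.le h').and (h'.le h)).congr le_antisymm_iff.symm

theorem Dec.count {P : Fin n → Prop} {_ : DecidablePred P} (x : ℕ)
    (h : ∀ v : Fin n, Dec t (s.setVar x v) (P v)) (hn : s.var 2 = n := by assumption) :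
    Val (.sum x t) s (Finset.univ.filter P).card := by
  rw [Val, Tm.eval, hn, Finset.sum_range, Finset.card_filter]
  refine Finset.sum_congr rfl fun v _ => ?_
  rw [h v]
  congr

theorem Dec.ex {P : Fin n → Prop} (x : ℕ) (h : ∀ v : Fin n, Dec t (s.setVar x v) (P v))
    (hn : s.var 2 = n := by assumption) : Dec (.ex x t) s (∃ v, P v) := by
  have h1 : (Tm.sum x t).eval s = (Finset.univ.filter P).card := Dec.count x h hn
  have h2 : (Finset.univ.filter P).card ≠ 0 ↔ ∃ v, P v := by
    rw [Finset.card_ne_zero]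
    simp [Finset.Nonempty]
  simp only [Dec, Tm.ex, Tm.eval] at h1 ⊢
  rw [h1]
  simp only [← h2]
  split_ifs <;> omega

theorem Dec.all {P : Fin n → Prop} (x : ℕ) (h : ∀ v : Fin n, Dec t (s.setVar x v) (P v))
    (hn : s.var 2 = n := by assumption) : Dec (.all x t) s (∀ v, P v) :=
  (Dec.ex x (fun v => (h v).not) hn).not.congr (by simp)

theorem Dec.eqv (x y : ℕ) (i j : Fin n) (hx : s.var x = i := by first | rfl | assumption)
    (hy : s.var y = j := by first | rfl | assumption) :
    Dec (((Tm.var x).le (.var y)).and ((Tm.var y).le (.var x))) s (i = j) :=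
  ((Val.var hx).eq (Val.var hy)).congr Fin.ext_iff.symm

theorem Dec.ltv (x y : ℕ) (i j : Fin n) (hx : s.var x = i := by first | rfl | assumption)
    (hy : s.var y = j := by first | rfl | assumption) :
    Dec (((Tm.var x).add (.const 1)).le (.var y)) s (i < j) :=
  (((Val.var hx).add (.const 1)).le (Val.var hy)).congr Nat.succ_le_iff

end Formulas

/-! ### Loops -/

section Loops

variable {b n : ℕ} {s s' s'' : RamState}

/-- The memories agree, except for the array `a` and the variables from 10 on. -/
def RamState.Frame (a : ℕ) (s s' : RamState) : Prop :=
  (∀ a', a' ≠ a → s'.arr a' = s.arr a') ∧ ∀ x < 10, s'.var x = s.var x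

theorem RamState.Frame.refl {a : ℕ} : s.Frame a s := ⟨fun _ _ => rfl, fun _ _ => rfl⟩

theorem RamState.Frame.trans {a : ℕ} (h : s.Frame a s') (h' : s'.Frame a s'') : s.Frame a s'' :=
  ⟨fun a' ha => (h'.1 a' ha).trans (h.1 a' ha), fun x hx => (h'.2 x hx).trans (h.2 x hx)⟩

theorem RamState.frame_setVar {a x : ℕ} (hx : 10 ≤ x) (v : ℕ) : s.Frame a (s.setVar x v) :=
  ⟨fun _ _ => rfl, fun y hy => by rw [RamState.setVar_var, if_neg (by omega)]⟩

theorem RamState.frame_setArr (a i j v : ℕ) : s.Frame a (s.setArr a i j v) :=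
  ⟨fun a' ha => by simp [RamState.setArr, ha], fun _ _ => rfl⟩

/-- The rule for a loop with an invariant. -/
theorem Prg.loop_induction {x : ℕ} {p : Prg} (Inv : ℕ → RamState → Prop) (h0 : Inv 0 s)
    (hset : ∀ i s' v, Inv i s' → Inv i (s'.setVar x v))
    (hstep : ∀ i < s.var 2, ∀ s', Inv i s' → s'.var x = i → Inv (i + 1) (p.den s')) :
    Inv (s.var 2) ((Prg.loop x p).den s) := by
  have key : ∀ i ≤ s.var 2, Inv i (RamState.iter p.den x s i) := by
    intro i
    induction i with
    | zero => exact fun _ => h0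
    | succ i ih =>
      intro hi
      exact hstep i hi _ (hset _ _ _ (ih (by omega))) (by rw [RamState.setVar_var, if_pos rfl])
  exact hset _ _ _ (key _ le_rfl)

/-- The program that fills the array `a` with the values of `t`. -/
def Prg.fill (a : ℕ) (t : Tm) : Prg := .loop 10 (.loop 11 (.store a (.var 10) (.var 11) t))

/-- The term is evaluated while the array is only partly overwritten, so its value must not depend
on the array `a`. -/
theorem Prg.fill_den {a : ℕ} {t : Tm} {f : Fin n → Fin n → ℕ} (hn : s.var 2 = n)
    (ht : ∀ s', s.Frame a s' → ∀ i j : Fin n, s'.var 10 = i → s'.var 11 = j → t.eval s' = f i j) :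
    s.Frame a ((Prg.fill a t).den s) ∧ ∀ i j : Fin n, ((Prg.fill a t).den s).arr a i j = f i j := by
  have h := Prg.loop_induction (x := 10) (p := .loop 11 (.store a (.var 10) (.var 11) t)) (s := s)
    (fun m s' => s.Frame a s' ∧ ∀ i j : Fin n, (i : ℕ) < m → s'.arr a i j = f i j)
    ⟨.refl, fun _ _ h => absurd h (Nat.not_lt_zero _)⟩
    (fun m s' v h => ⟨h.1.trans (RamState.frame_setVar le_rfl v), h.2⟩) (by
      intro i hi s₁ hs₁ hx
      have hn₁ : s₁.var 2 = n := by rw [hs₁.1.2 2 (by omega), hn]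
      -- Invariant of the inner loop: the rows before `i` and the first `m` entries of row `i` are
      -- final.
      have h := Prg.loop_induction (x := 11) (p := .store a (.var 10) (.var 11) t) (s := s₁)
        (fun m s' => (s.Frame a s' ∧ s'.var 10 = i) ∧ ∀ i' j' : Fin n,
          (i' : ℕ) < i ∨ ((i' : ℕ) = i ∧ (j' : ℕ) < m) → s'.arr a i' j' = f i' j')
        ⟨⟨hs₁.1, hx⟩, fun i' j' h => hs₁.2 i' j' (by omega)⟩
        (fun m s' v h => ⟨⟨h.1.1.trans (RamState.frame_setVar (by omega) v), by
          rw [RamState.setVar_var, if_neg (by omega), h.1.2]⟩, h.2⟩) (by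
          intro j hj s₂ hs₂ hy
          refine ⟨⟨hs₂.1.1.trans (RamState.frame_setArr _ _ _ _), hs₂.1.2⟩, fun i' j' h => ?_⟩
          simp only [Prg.den, RamState.setArr_arr, Tm.eval, hs₂.1.2, hy, true_and]
          split_ifs with hij
          · rw [ht s₂ hs₂.1.1 i' j' (by rw [hs₂.1.2, hij.1]) (by rw [hy, hij.2])]
          · exact hs₂.2 i' j' (by omega))
      exact ⟨h.1.1, fun i' j' h' => h.2 i' j' (by omega)⟩)
  exact ⟨h.1, fun i j => h.2 i j (by rw [hn]; exact i.2)⟩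

/-- The rule for a loop that works towards a goal for each value of its counter. Here `Rep x s`
means that the memory `s` represents `x`, and `l` holds the counters of the outer loops. -/
theorem Prg.loop_progress {X : Type*} {r : X → X → Prop} (hr : ∀ x, r x x)
    (htr : ∀ x y z, r x y → r y z → r x z) {Rep : X → RamState → Prop}
    (hn : ∀ x s, Rep x s → s.var 2 = n) (hset : ∀ x s y v, 10 ≤ y → Rep x s → Rep x (s.setVar y v))
    {D : Fin n → X → Prop} (hD : ∀ i x y, r x y → D i x → D i y) {l : List ℕ} {e : ℕ → ℕ} {y : ℕ}
    (hy : 10 ≤ y) (hyl : y ∉ l) {p : Prg} (hpl : ∀ z ∈ l, p.writes z = false)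
    (hp : ∀ (i : Fin n) x s, Rep x s → (∀ z ∈ l, s.var z = e z) → s.var y = i →
      ∃ x', r x x' ∧ Rep x' (p.den s) ∧ D i x')
    (x : X) (s : RamState) (hx : Rep x s) (he : ∀ z ∈ l, s.var z = e z) :
    ∃ x', r x x' ∧ Rep x' ((Prg.loop y p).den s) ∧ ∀ i, D i x' := by
  have h := Prg.loop_induction (x := y) (p := p) (s := s)
    (fun m s' => (∀ z ∈ l, s'.var z = e z) ∧
      ∃ x', r x x' ∧ Rep x' s' ∧ ∀ i : Fin n, (i : ℕ) < m → D i x')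
    ⟨he, x, hr x, hx, fun _ h => absurd h (Nat.not_lt_zero _)⟩
    (by
      rintro m s' v ⟨h1, x', h2, h3, h4⟩
      refine ⟨fun z hz => ?_, x', h2, hset _ _ _ _ hy h3, h4⟩
      rw [RamState.setVar_var, if_neg (by rintro rfl; exact hyl hz), h1 z hz])
    (by
      rintro m hm s' ⟨h1, x', h2, h3, h4⟩ h5
      rw [hn _ _ hx] at hm
      obtain ⟨x'', h6, h7, h8⟩ := hp ⟨m, hm⟩ x' s' h3 h1 h5
      refine ⟨fun z hz => by rw [Prg.den_var p (hpl z hz), h1 z hz], x'', htr _ _ _ h2 h6, h7,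
        fun i hi => ?_⟩
      rcases Nat.lt_succ_iff_lt_or_eq.1 hi with hi | hi
      · exact hD _ _ _ h6 (h4 i hi)
      · rwa [show i = ⟨m, hm⟩ from Fin.ext hi])
  obtain ⟨-, x', h2, h3, h4⟩ := h
  exact ⟨x', h2, h3, fun i => h4 i (by rw [hn _ _ hx]; exact i.2)⟩

end Loops


/-! ### The tables of the algorithm -/

/-- The choices in a run of the algorithm. -/
structure Choices (I : GraphInstance) where
  S : Finset (Fin I.n)
  owner : Fin I.n → Option (Fin I.n)
  O : Fin I.n → Finset (Fin I.n)

/-- A number whose square is larger than `k`. -/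
def root (k : ℕ) : ℕ := Nat.sqrt k + 1

namespace Choices

variable {I : GraphInstance} (c : Choices I)

/-- The graph with the vertices of the kernel and the edges that the choices determine. -/
noncomputable def linkedGraph : SimpleGraph (Fin I.n) :=
  addLinks (reduced I.graph c.S I.k) (dense I.graph c.S I.k) c.O

/-- The graph without the edges to surplus vertices. -/
noncomputable def prunedGraph : SimpleGraph (Fin I.n) :=
  removeSurplus c.linkedGraph c.S (periphery I.graph c.S) I.k

/-- The graph without the edges to later twins. -/
noncomputable def finalGraph : SimpleGraph (Fin I.n) :=
  removeTwins c.prunedGraph c.S (core I.graph c.S) (periphery I.graph c.S)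

open scoped Classical in
/-- The number of non-isolated vertices before `i`. -/
noncomputable def rank (i : Fin I.n) : ℕ :=
  (Finset.univ.filter fun u => u < i ∧ ∃ w, c.finalGraph.Adj u w).card

/-- The contents of the arrays. -/
def table : ℕ → Fin I.n → Fin I.n → Prop
  | 0, i, j => I.graph.Adj i j
  | 1, i, j => i ∈ c.S ∧ i = j
  | 2, i, _ => i ∈ core I.graph c.S
  | 3, i, _ => i ∈ periphery I.graph c.S
  | 4, i, j => Touches I.graph c.S i j
  | 5, i, _ => i ∈ rich I.graph c.S I.k
  | 6, i, _ => i ∈ dispensable I.graph c.S I.k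
  | 7, i, j => (reduced I.graph c.S I.k).Adj i j
  | 8, i, j => c.owner j = some i
  | 9, i, j => (dense I.graph c.S I.k).Adj i j
  | 10, i, j => j ∈ c.O i
  | 11, i, j => j ∈ peelStep (reduced I.graph c.S I.k) (dense I.graph c.S I.k) (root I.k) i (c.O i)
  | 12, i, j => c.linkedGraph.Adj i j
  | 13, i, j => Simplicial c.linkedGraph c.S (periphery I.graph c.S) i j
  | 14, i, j => c.prunedGraph.Adj i j
  | 15, i, _ => Pendant c.prunedGraph c.S (periphery I.graph c.S) i
  | 16, i, j => c.finalGraph.Adj i j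
  | 17, i, _ => ∃ w, c.finalGraph.Adj i w
  | 18, i, j => c.rank i = j
  | _, i, j => ∃ x y, c.finalGraph.Adj x y ∧ c.rank x = i ∧ c.rank y = j

end Choices

section Tables

open scoped Classical

variable {I : GraphInstance} {c c' : Choices I} {m : ℕ} {s s' : RamState}

/-- The first `m` arrays hold the tables of `c`. -/
structure Models (m : ℕ) (c : Choices I) (s : RamState) : Prop where
  param : s.var 1 = I.k
  size : s.var 2 = I.n
  root : s.var 3 = root I.k
  arr : ∀ a < m, ∀ i j : Fin I.n, s.arr a i j = if c.table a i j then 1 else 0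

theorem Models.mono {m' : ℕ} (h : Models m c s) (hm : m' ≤ m) : Models m' c s :=
  ⟨h.param, h.size, h.root, fun a ha => h.arr a (ha.trans_le hm)⟩

theorem Models.of_frame {a : ℕ} (h : Models m c s) (ha : m ≤ a) (hs : s.Frame a s') :
    Models m c s' := by
  refine ⟨by rw [hs.2 1 (by omega), h.param], by rw [hs.2 2 (by omega), h.size],
    by rw [hs.2 3 (by omega), h.root], fun a' ha' i j => ?_⟩
  rw [hs.1 a' (by omega), h.arr a' ha']

theorem Models.setVar (h : Models m c s) {x : ℕ} (hx : 10 ≤ x) (v : ℕ) :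
    Models m c (s.setVar x v) :=
  h.of_frame le_rfl (RamState.frame_setVar hx v)

theorem Models.succ (h : Models m c s)
    (ha : ∀ i j : Fin I.n, s.arr m i j = if c.table m i j then 1 else 0) : Models (m + 1) c s := by
  refine ⟨h.param, h.size, h.root, fun a ha' => ?_⟩
  rcases Nat.lt_succ_iff_lt_or_eq.1 ha' with h' | rfl
  exacts [h.arr a h', ha]

theorem Models.congr (h : Models m c s) (hc : ∀ a < m, c.table a = c'.table a) : Models m c' s :=
  ⟨h.param, h.size, h.root, fun a ha => by rw [← hc a ha]; exact h.arr a ha⟩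

theorem Models.fill {a : ℕ} {t : Tm} {R : Fin I.n → Fin I.n → Prop} (h : Models m c s) (ha : m ≤ a)
    (ht : ∀ s', s.Frame a s' → Models m c s' → ∀ i j : Fin I.n, s'.var 10 = i → s'.var 11 = j →
      Dec t s' (R i j)) :
    Models m c ((Prg.fill a t).den s) ∧
      ∀ i j : Fin I.n, ((Prg.fill a t).den s).arr a i j = if R i j then 1 else 0 := by
  have h1 := Prg.fill_den (a := a) (t := t) (f := fun i j => if R i j then 1 else 0) h.size
    fun s' hs' i j hi hj => ht s' hs' (h.of_frame ha hs') i j hi hj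
  exact ⟨h.of_frame ha h1.1, h1.2⟩

theorem Models.get (h : Models m c s) (a x y : ℕ) (i j : Fin I.n) (ha : a < m := by decide)
    (hs : s'.arr = s.arr := by rfl) (hx : s'.var x = i := by first | rfl | assumption)
    (hy : s'.var y = j := by first | rfl | assumption) :
    Dec (.get a (.var x) (.var y)) s' (c.table a i j) := by
  simp only [Dec, Tm.eval, hx, hy, hs, h.arr a ha]

/-- Membership in `S` is stored on the diagonal of its table, so that marking a vertex changes a
single cell. -/
theorem Models.memS (h : Models m c s) (x : ℕ) (i : Fin I.n) (hm : 1 < m := by decide)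
    (hs : s'.arr = s.arr := by rfl) (hx : s'.var x = i := by first | rfl | assumption) :
    Dec (.get 1 (.var x) (.var x)) s' (i ∈ c.S) :=
  (h.get 1 x x i i hm hs hx hx).congr (and_iff_left rfl)

theorem Models.valK (h : Models m c s) (hs : s'.var 1 = s.var 1 := by rfl) :
    Val (.var 1) s' I.k :=
  hs.trans h.param

theorem Models.valRoot (h : Models m c s) (hs : s'.var 3 = s.var 3 := by rfl) :
    Val (.var 3) s' (_root_.root I.k) :=
  hs.trans h.root

theorem Dec.countIn {n : ℕ} {t : Tm} {A : Finset (Fin n)} {P : Fin n → Prop}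
    {_ : DecidablePred P}     (x : ℕ) (h : ∀ v : Fin n, Dec t (s.setVar x v) (v ∈ A ∧ P v))
    (hn : s.var 2 = n := by assumption) : Val (.sum x t) s (A.filter P).card := by
  have h1 : Val (.sum x t) s (Finset.univ.filter fun v => v ∈ A ∧ P v).card := Dec.count x h hn
  rwa [← Finset.filter_filter, Finset.filter_univ_mem] at h1

theorem Models.outDegree (h : Models m c s) (x z : ℕ) (i : Fin I.n) (hm : 1 < m := by decide)
    (hs : s'.arr = s.arr := by rfl) (hx : s'.var x = i := by first | rfl | assumption)
    (hn : s'.var 2 = I.n := by assumption) (hxz : x ≠ z := by decide) :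
    Val (.sum z ((Tm.get 1 (.var z) (.var z)).not.and (.get 0 (.var x) (.var z)))) s'
      (outDegree I.graph c.S i) :=
  Dec.count z fun v => Dec.and (s := s'.setVar z v)
    (h.memS (s' := s'.setVar z v) z v hm hs (by rw [RamState.setVar_var, if_pos rfl])).not
    (h.get (s' := s'.setVar z v) 0 x z i v (by omega) hs (by rw [RamState.setVar_var, if_neg hxz, hx])
      (by rw [RamState.setVar_var, if_pos rfl]))

/-- A term expresses the relation `R` with the help of the first `m` arrays. -/
def Expressible (m : ℕ) (R : ∀ I : GraphInstance, Choices I → Fin I.n → Fin I.n → Prop) : Prop :=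
  ∃ t : Tm, (∀ (I : GraphInstance) (c : Choices I) (s : RamState),
    Models m c s → ∀ i j : Fin I.n, s.var 10 = i → s.var 11 = j → Dec t s (R I c i j)) ∧
    t.ok 40 = true

/-- The term is left open and is determined by the derivation of its truth value, which mirrors the
definition of the relation. Variables 10 and 11 hold the indices, those from 30 on are bound in
sums. -/
theorem expressible_core : Expressible 2 fun I c i _ => i ∈ core I.graph c.S :=
  ⟨_, fun I c s h i j hi hj => by
    have hn := h.size
    exact ((h.memS 10 i).not.and (((Val.const 2).le (h.outDegree 10 30 i)).or
      (Dec.ex 30 fun y => (h.memS 30 y).not.and ((h.get 0 10 30 i y).and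
        ((h.outDegree 30 31 y).le (Val.const 1)))))).congr mem_core.symm, by rfl⟩

theorem expressible_periphery : Expressible 3 fun I c i _ => i ∈ periphery I.graph c.S :=
  ⟨_, fun I c s h i j hi hj => ((h.memS 10 i).not.and (h.get 2 10 10 i i).not).congr
    mem_periphery.symm, by rfl⟩

theorem expressible_touches : Expressible 4 fun I c i j => Touches I.graph c.S i j :=
  ⟨_, fun I c s h i j hi hj => by
    have hn := h.size
    exact (h.memS 10 i).and ((h.get 2 11 11 j j).and (Dec.ex 30 fun x => (h.memS 30 x).not.and
      ((h.get 0 10 30 i x).and ((Dec.eqv 30 11 x j).or (h.get 0 30 11 x j))))), by rfl⟩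

theorem expressible_rich : Expressible 5 fun I c i _ => i ∈ rich I.graph c.S I.k :=
  ⟨_, fun I c s h i j hi hj => by
    have hn := h.size
    exact ((h.memS 10 i).and ((h.valK.times 12).le (Dec.count 30 fun d => h.get 4 10 30 i d))).congr
      mem_rich.symm, by rfl⟩

theorem expressible_dispensable :
    Expressible 6 fun I c i _ => i ∈ dispensable I.graph c.S I.k :=
  ⟨_, fun I c s h i j hi hj => by
    have hn := h.size
    exact ((h.get 5 10 10 i i).or ((h.get 2 10 10 i i).and (Dec.ex 30 fun a =>
      (h.get 4 30 10 a i).and (h.get 5 30 30 a a).not).not)).congr mem_dispensable.symm, by rfl⟩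

theorem expressible_reduced : Expressible 7 fun I c i j => (reduced I.graph c.S I.k).Adj i j :=
  ⟨_, fun I c s h i j hi hj =>
    (h.get 0 10 11 i j).and ((h.get 6 10 10 i i).not.and (h.get 6 11 11 j j).not), by rfl⟩

theorem expressible_dense : Expressible 9 fun I c i j => (dense I.graph c.S I.k).Adj i j :=
  ⟨_, fun I c s h i j hi hj => by
    have hn := h.size
    exact (h.get 7 10 11 i j).or ((Dec.eqv 10 11 i j).not.and (((h.memS 10 i).or (h.memS 11 j)).and
      ((h.get 3 10 10 i i).not.and ((h.get 3 11 11 j j).not.and ((h.valK.times 4).le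
        (Dec.countIn 30 fun o => (h.get 3 30 30 o o).and
          ((h.get 7 10 30 i o).and (h.get 7 11 30 j o)))))))), by rfl⟩

theorem expressible_seed : Expressible 10 fun I c i j => j ∈ seed (reduced I.graph c.S I.k)
    (dense I.graph c.S I.k) c.S (periphery I.graph c.S) c.owner I.k (root I.k) i :=
  ⟨_, fun I c s h i j hi hj => by
    have hn := h.size
    have h1 : (¬ ∃ w, c.owner j = some w) ↔ c.owner j = none := by
      rw [Option.eq_none_iff_forall_ne_some]; simp
    exact ((h.memS 10 i).and ((h.get 3 11 11 j j).and ((h.get 7 10 11 i j).and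
      (((Dec.ex 30 fun w => h.get 8 30 11 w j).not.congr h1).and (((h.valK.times 4).le
        (Dec.countIn 30 fun o => (h.get 3 30 30 o o).and (h.get 7 10 30 i o))).and
        ((Dec.count 30 fun b => (Dec.eqv 30 10 b i).not.and ((h.get 7 30 11 b j).and
          (h.get 9 10 30 i b).not)).le h.valRoot)))))).congr mem_seed.symm, by rfl⟩

theorem mem_peelStep {V : Type*} [Fintype V] {H K : SimpleGraph V} {s : ℕ} {a o : V}
    {O : Finset V} : o ∈ peelStep H K s a O ↔ o ∈ O ∧ ∀ b, b ≠ a → ¬ K.Adj a b → H.Adj b o →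
      14 * s ≤ (O.filter fun o => H.Adj b o).card :=
  Finset.mem_filter

theorem expressible_peelStep : Expressible 11 fun I c i j =>
    j ∈ peelStep (reduced I.graph c.S I.k) (dense I.graph c.S I.k) (root I.k) i (c.O i) :=
  ⟨_, fun I c s h i j hi hj => by
    have hn := h.size
    exact ((h.get 10 10 11 i j).and (Dec.all 30 fun b => (Dec.eqv 30 10 b i).not.imp
      ((h.get 9 10 30 i b).not.imp ((h.get 7 30 11 b j).imp ((h.valRoot.times 14).le
        (Dec.countIn 31 fun o => (h.get 10 10 31 i o).and (h.get 7 30 31 b o))))))).congr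
      mem_peelStep.symm, by rfl⟩

theorem expressible_linkedGraph : Expressible 12 fun _ c i j => c.linkedGraph.Adj i j :=
  ⟨_, fun I c s h i j hi hj => by
    have hn := h.size
    exact (h.get 9 10 11 i j).or ((Dec.eqv 10 11 i j).not.and
      ((Dec.ex 30 fun o => (h.get 10 10 30 i o).and (h.get 7 11 30 j o)).or
        (Dec.ex 30 fun o => (h.get 10 11 30 j o).and (h.get 7 10 30 i o)))), by rfl⟩

theorem expressible_simplicial : Expressible 13 fun I c i j =>
    Simplicial c.linkedGraph c.S (periphery I.graph c.S) i j :=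
  ⟨_, fun I c s h i j hi hj => by
    have hn := h.size
    exact (h.memS 10 i).and ((h.get 3 11 11 j j).and ((h.get 12 10 11 i j).and
      (Dec.all 30 fun b => (Dec.eqv 30 10 b i).not.imp ((h.get 12 11 30 j b).imp
        (h.get 12 10 30 i b))))), by rfl⟩

theorem expressible_prunedGraph : Expressible 14 fun _ c i j => c.prunedGraph.Adj i j :=
  ⟨_, fun I c s h i j hi hj => by
    have hn := h.size
    exact (h.get 12 10 11 i j).and (((h.get 13 10 11 i j).and ((h.valK.times 4).le
      (Dec.count 30 fun o => (Dec.ltv 30 11 o j).and (h.get 13 10 30 i o)))).not.and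
      ((h.get 13 11 10 j i).and ((h.valK.times 4).le
      (Dec.count 30 fun o => (Dec.ltv 30 10 o i).and (h.get 13 11 30 j o)))).not), by rfl⟩

theorem expressible_pendant : Expressible 15 fun I c i _ =>
    Pendant c.prunedGraph c.S (periphery I.graph c.S) i :=
  ⟨_, fun I c s h i j hi hj => by
    have hn := h.size
    exact (h.get 3 10 10 i i).and (Dec.ex 30 fun a => (h.memS 30 a).and
      (h.get 14 30 10 a i)).not, by rfl⟩

theorem expressible_finalGraph : Expressible 16 fun _ c i j => c.finalGraph.Adj i j :=
  ⟨_, fun I c s h i j hi hj => by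
    have hn := h.size
    exact (h.get 14 10 11 i j).and (((h.get 15 10 10 i i).and ((h.get 2 11 11 j j).and
      (Dec.ex 30 fun o => (Dec.ltv 30 10 o i).and ((h.get 15 30 30 o o).and
        (h.get 14 30 11 o j))))).not.and ((h.get 15 11 11 j j).and ((h.get 2 10 10 i i).and
      (Dec.ex 30 fun o => (Dec.ltv 30 11 o j).and ((h.get 15 30 30 o o).and
        (h.get 14 30 10 o i))))).not), by rfl⟩

theorem expressible_adj_finalGraph : Expressible 17 fun _ c i _ => ∃ w, c.finalGraph.Adj i w :=
  ⟨_, fun I c s h i j hi hj => by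
    have hn := h.size
    exact Dec.ex 30 fun w => h.get 16 10 30 i w, by rfl⟩

theorem expressible_rank : Expressible 18 fun _ c i j => c.rank i = j :=
  ⟨_, fun I c s h i j hi hj => by
    have hn := h.size
    exact (Dec.count 30 fun u => (Dec.ltv 30 10 u i).and (h.get 17 30 30 u u)).eq (Val.var hj),
    by rfl⟩

theorem expressible_relabeled : Expressible 19 fun _ c i j =>
    ∃ x y, c.finalGraph.Adj x y ∧ c.rank x = i ∧ c.rank y = j :=
  ⟨_, fun I c s h i j hi hj => by
    have hn := h.size
    exact Dec.ex 30 fun x => Dec.ex 31 fun y => (h.get 16 30 31 x y).and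
      ((h.get 18 30 10 x i).and (h.get 18 31 11 y j)), by rfl⟩

/-- A program that fills the arrays from `m` to `m' - 1`. -/
def Reaches (m m' : ℕ) : Prop :=
  ∃ p : Prg, p.ok 40 = true ∧ ∀ (I : GraphInstance) (c : Choices I) (s : RamState),
    Models m c s → Models m' c (p.den s)

theorem Reaches.trans {m₁ m₂ m₃ : ℕ} (h : Reaches m₁ m₂) (h' : Reaches m₂ m₃) : Reaches m₁ m₃ := by
  obtain ⟨p, h1, h2⟩ := h
  obtain ⟨q, h3, h4⟩ := h'
  exact ⟨.seq p q, by simp [Prg.ok, h1, h3], fun I c s h => h4 I c _ (h2 I c s h)⟩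

theorem Prg.fill_ok {a : ℕ} {t : Tm} (ht : t.ok 40 = true) : (Prg.fill a t).ok 40 = true := by
  simp [Prg.fill, Prg.ok, Prg.writes, Tm.ok, ht]

/-- The term consults only the earlier arrays, so filling array `m` does not disturb its own
computation. -/
theorem Expressible.reaches (h : Expressible m fun _ c i j => c.table m i j) :
    Reaches m (m + 1) := by
  obtain ⟨t, h1, h2⟩ := h
  refine ⟨.fill m t, Prg.fill_ok h2, fun I c s h => ?_⟩
  have h3 := h.fill le_rfl fun s' _ hs' => h1 I c s' hs'
  exact h3.1.succ h3.2

theorem reaches_reduced : Reaches 2 8 :=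
  (Expressible.reaches expressible_core).trans ((Expressible.reaches expressible_periphery).trans
    ((Expressible.reaches expressible_touches).trans ((Expressible.reaches expressible_rich).trans
      ((Expressible.reaches expressible_dispensable).trans
        (Expressible.reaches expressible_reduced)))))

theorem reaches_dense : Reaches 9 10 := Expressible.reaches expressible_dense

theorem reaches_relabeled : Reaches 11 20 :=
  (Expressible.reaches expressible_peelStep).trans
  ((Expressible.reaches expressible_linkedGraph).trans
    ((Expressible.reaches expressible_simplicial).trans
      ((Expressible.reaches expressible_prunedGraph).trans
        ((Expressible.reaches expressible_pendant).trans
          ((Expressible.reaches expressible_finalGraph).trans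
            ((Expressible.reaches expressible_adj_finalGraph).trans
              ((Expressible.reaches expressible_rank).trans
                (Expressible.reaches expressible_relabeled))))))))

end Tables


/-! ### The iterated and greedy searches: links, private neighbors, maximal set of paths -/

section Searches

open scoped Classical

variable {I : GraphInstance} {c : Choices I} {m : ℕ} {s s' : RamState}

/-- The program that computes the links. -/
theorem exists_prg_links : ∃ p : Prg, p.ok 40 = true ∧ ∀ (I : GraphInstance) (c : Choices I)
    (s : RamState), Models 10 c s → Models 11 { c with
      O := linkFamily (reduced I.graph c.S I.k) (dense I.graph c.S I.k) c.S (periphery I.graph c.S)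
        c.owner I.k (root I.k) } (p.den s) := by
  obtain ⟨t, ht, htok⟩ := expressible_seed
  obtain ⟨u, hu, huok⟩ := expressible_peelStep
  have hcopy : (Tm.get 11 (.var 10) (.var 11)).ok 40 = true := by rfl
  -- A round is computed in array 11 and then copied back, since it must not see its own deletions.
  refine ⟨.seq (.fill 10 t) (.loop 20 (.seq (.fill 11 u) (.fill 10 (.get 11 (.var 10) (.var 11))))),
    ?_, fun I c s h => ?_⟩
  · simp only [Prg.ok, Prg.fill_ok htok, Prg.fill_ok huok, Prg.fill_ok hcopy]
    rfl
  · have hc : ∀ (c : Choices I) (O : Fin I.n → Finset (Fin I.n)) (a : ℕ), a < 10 →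
        c.table a = { c with O := O }.table a := by
      intro c O a ha
      interval_cases a <;> rfl
    let step := peelStep (reduced I.graph c.S I.k) (dense I.graph c.S I.k) (root I.k)
    let start := seed (reduced I.graph c.S I.k) (dense I.graph c.S I.k) c.S (periphery I.graph c.S)
        c.owner I.k (root I.k)
    have h1 := h.fill le_rfl fun s' _ hs' => ht I c s' hs'
    have h2 := Prg.loop_induction (x := 20) (s := (Prg.fill 10 t).den s)
      (p := .seq (.fill 11 u) (.fill 10 (.get 11 (.var 10) (.var 11))))
      (fun i s' => Models 11 { c with O := fun a => (step a)^[i] (start a) } s')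
      ((h1.1.congr (hc c _)).succ h1.2) (fun _ _ _ h => h.setVar (by norm_num) _) (by
        intro i _ s₁ hs₁ _
        have h3 := hs₁.fill le_rfl fun s' _ hs' => hu I _ s' hs'
        have h4 := h3.1.succ h3.2
        have h5 := (h4.mono (by norm_num : 10 ≤ 12)).fill (a := 10)
          (t := .get 11 (.var 10) (.var 11)) (R := fun a o => o ∈ (step a)^[i + 1] (start a)) le_rfl
          (by
            intro s' hF _ a o ha ho
            simp only [Dec, Tm.eval, ha, ho, hF.1 11 (by norm_num), h4.arr 11 (by norm_num),
              Function.iterate_succ_apply']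
            exact if_congr Iff.rfl rfl rfl)
        exact (h5.1.congr (hc _ _)).succ h5.2)
    rw [h1.1.size] at h2
    have h6 : linkFamily (reduced I.graph c.S I.k) (dense I.graph c.S I.k) c.S
        (periphery I.graph c.S) c.owner I.k (root I.k) = fun a => (step a)^[I.n] (start a) := by
      funext a
      simp only [linkFamily, Fintype.card_fin, step, start]
    rw [h6]
    exact h2

/-- The program that computes the private neighbors. -/
theorem exists_prg_owner : ∃ p : Prg, p.ok 40 = true ∧ ∀ (I : GraphInstance) (c : Choices I)
    (s : RamState), Models 8 c s → ∃ owner, IsOwner (reduced I.graph c.S I.k)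
      (periphery I.graph c.S) owner (root I.k) ∧ Models 9 { c with owner := owner } (p.den s) := by
  have hcond : ∃ t : Tm, (∀ (I : GraphInstance) (c : Choices I) (s : RamState), Models 9 c s →
      ∀ w o : Fin I.n, s.var 20 = w → s.var 21 = o → Dec t s (o ∈ periphery I.graph c.S ∧
        (reduced I.graph c.S I.k).Adj w o ∧ c.owner o = none ∧
        (Finset.univ.filter fun o' => c.owner o' = some w).card + 1 ≤ root I.k)) ∧
      t.ok 40 = true :=
    ⟨_, fun I c s h i j hi hj => by
      have hn := h.size
      have h1 : (¬ ∃ w, c.owner j = some w) ↔ c.owner j = none := by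
        rw [Option.eq_none_iff_forall_ne_some]; simp
      exact (h.get 3 21 21 j j).and ((h.get 7 20 21 i j).and
        (((Dec.ex 30 fun w => h.get 8 30 21 w j).not.congr h1).and
        (((Dec.count 30 fun o => h.get 8 20 30 i o).add (Val.const 1)).le h.valRoot))), by rfl⟩
  obtain ⟨t, ht, htok⟩ := hcond
  have hzero : (Tm.const 0).ok 40 = true := by rfl
  refine ⟨.seq (.fill 8 (.const 0)) (.loop 20 (.loop 21
    (.ite t (.store 8 (.var 20) (.var 21) (.const 1)) .skip))), ?_, fun I c s h => ?_⟩
  · simp only [Prg.ok, Prg.fill_ok hzero, htok]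
    rfl
  · have hc : ∀ (c : Choices I) (owner : Fin I.n → Option (Fin I.n)) (a : ℕ), a < 8 →
        c.table a = { c with owner := owner }.table a := by
      intro c O a ha
      interval_cases a <;> rfl
    let H := reduced I.graph c.S I.k
    let A := periphery I.graph c.S
    let r : (Fin I.n → Option (Fin I.n)) → (Fin I.n → Option (Fin I.n)) → Prop :=
      fun f g => ∀ o w, f o = some w → g o = some w
    let Rep : (Fin I.n → Option (Fin I.n)) → RamState → Prop := fun f s =>
      Models 9 { c with owner := f } s ∧ (∀ o w, f o = some w → o ∈ A ∧ H.Adj w o) ∧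
        ∀ w, (Finset.univ.filter fun o' => f o' = some w).card ≤ root I.k
    -- Once the pair has been treated, `o` is owned or `w` has its full share. Owners are never
    -- withdrawn, so one pass over all pairs suffices.
    let D : Fin I.n → Fin I.n → (Fin I.n → Option (Fin I.n)) → Prop := fun w o f =>
      o ∈ A → H.Adj w o → f o = none →
        root I.k ≤ (Finset.univ.filter fun o' => f o' = some w).card
    have hr : ∀ f, r f f := fun _ _ _ h => h
    have htr : ∀ f g h, r f g → r g h → r f h := fun _ _ _ h1 h2 o w h => h2 o w (h1 o w h)
    have hD : ∀ w o f g, r f g → D w o f → D w o g := by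
      intro w o f g hfg hf ho hwo hg
      have h1 : f o = none := by
        by_contra hne
        obtain ⟨w', hw'⟩ := Option.ne_none_iff_exists'.1 hne
        rw [hfg o w' hw'] at hg
        cases hg
      refine (hf ho hwo h1).trans (Finset.card_le_card fun o' ho' => ?_)
      simp only [Finset.mem_filter, Finset.mem_univ, true_and] at ho' ⊢
      exact hfg _ _ ho'
    have hset : ∀ f s y v, 10 ≤ y → Rep f s → Rep f (s.setVar y v) :=
      fun f s y v hy h => ⟨h.1.setVar hy v, h.2⟩
    have hbody : ∀ (w o : Fin I.n) f s, Rep f s → s.var 20 = w → s.var 21 = o → ∃ f', r f f' ∧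
        Rep f' ((Prg.ite t (.store 8 (.var 20) (.var 21) (.const 1)) .skip).den s) ∧ D w o f' := by
      intro w o f s hs hw ho
      have h0 := (ht I _ s hs.1 w o hw ho).eval_eq_zero
      rw [Prg.den]
      split_ifs with hif
      · refine ⟨f, hr f, hs, fun h1 h2 h3 => ?_⟩
        by_contra hlt
        exact h0.1 hif ⟨h1, h2, h3, by dsimp only; omega⟩
      · obtain ⟨h1, h2, h3, h4⟩ := not_not.1 (fun h => hif (h0.2 h))
        dsimp only at h1 h2 h3 h4
        have hup : ∀ o' w', Function.update f o (some w) o' = some w' ↔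
            (o' = o ∧ w' = w) ∨ f o' = some w' := by
          intro o' w'
          by_cases hoo : o' = o
          · subst hoo; simp [h3, eq_comm]
          · simp [hoo]
        refine ⟨Function.update f o (some w), fun o' w' h => (hup o' w').2 (Or.inr h), ⟨?_, ?_, ?_⟩,
          fun _ _ h => ?_⟩
        · refine (((hs.1.mono (by norm_num : 8 ≤ 9)).congr
            (hc { c with owner := f } _)).of_frame le_rfl (RamState.frame_setArr _ _ _ _)).succ ?_
          intro i j
          simp only [RamState.setArr_arr, Tm.eval, hw, ho, true_and, hs.1.arr 8 (by norm_num)]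
          have e1 : ({ c with owner := Function.update f o (some w) } : Choices I).table 8 i j ↔
              (j = o ∧ i = w) ∨ f j = some i := hup j i
          have e2 : ({ c with owner := f } : Choices I).table 8 i j ↔ f j = some i := Iff.rfl
          simp only [e1, e2]
          by_cases hij : i = w ∧ j = o
          · rw [if_pos ⟨congrArg _ hij.1, congrArg _ hij.2⟩, if_pos (Or.inl ⟨hij.2, hij.1⟩)]
          · rw [if_neg fun h => hij ⟨Fin.ext h.1, Fin.ext h.2⟩]
            simp only [show ¬ (j = o ∧ i = w) from fun h => hij ⟨h.2, h.1⟩, false_or]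
        · intro o' w' h
          rcases (hup o' w').1 h with ⟨rfl, rfl⟩ | h
          exacts [⟨h1, h2⟩, hs.2.1 o' w' h]
        · intro w'
          by_cases hww : w' = w
          · subst hww
            refine le_trans ?_ h4
            refine (Finset.card_le_card fun o' ho' => ?_).trans (Finset.card_insert_le o _)
            simp only [Finset.mem_filter, Finset.mem_univ, true_and, Finset.mem_insert, hup] at ho' ⊢
            exact ho'.imp And.left id
          · refine (Finset.card_le_card fun o' ho' => ?_).trans (hs.2.2 w')
            simp only [Finset.mem_filter, Finset.mem_univ, true_and, hup, hww, and_false,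
              false_or] at ho' ⊢
            exact ho'
        · simp at h
    have h1 := h.fill (a := 8) (t := .const 0) (R := fun _ _ => False) le_rfl
      (fun s' _ _ _ _ _ _ => by simp [Dec, Tm.eval])
    have h2 : Rep (fun _ => none) ((Prg.fill 8 (.const 0)).den s) := by
      refine ⟨(h1.1.congr (hc c _)).succ fun i j => ?_, by simp, by simp⟩
      rw [h1.2]
      simp [Choices.table]
    obtain ⟨f, -, h3, h4⟩ := Prg.loop_progress (n := I.n) hr htr (fun _ _ h => h.1.size) hset
      (D := fun w f => ∀ o, D w o f) (fun w f g h1 h2 o => hD w o f g h1 (h2 o)) (l := [])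
      (e := fun _ => 0) (y := 20) (by norm_num) (by simp)
      (p := .loop 21 (.ite t (.store 8 (.var 20) (.var 21) (.const 1)) .skip)) (by simp)
      (by
        intro w f s hf _ hw
        exact Prg.loop_progress (n := I.n) hr htr (fun _ _ h => h.1.size) hset (D := D w) (hD w)
          (l := [20]) (e := fun _ => w) (y := 21) (by norm_num) (by simp) (by simp [Prg.writes])
          (fun o f s hf hl ho => hbody w o f s hf (hl 20 (by simp)) ho) f s hf (by simpa using hw))
      _ _ h2 (by simp)
    exact ⟨f, ⟨h3.2.1, fun o ho hfo w hwo => by convert h4 w o ho hwo hfo,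
      fun w => by convert h3.2.2 w⟩, h3.1⟩

/-- The vertices of a set are those of disjoint paths. -/
def IsPathUnion {V : Type*} (G : SimpleGraph V) (S : Finset V) : Prop :=
  ∃ (ι : Type) (_ : Fintype ι) (f : ι → Fin 4 → V), IsPacking G f ∧ (∀ i j, f i j ∈ S) ∧
    S.card = 4 * Fintype.card ι

theorem IsPathUnion.insert {V : Type*} [DecidableEq V] {G : SimpleGraph V} {S : Finset V} (h : IsPathUnion G S)
    {a b c d : V} (ha : a ∉ S) (hb : b ∉ S) (hc : c ∉ S) (hd : d ∉ S) (hac : a ≠ c) (had : a ≠ d)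
    (hbd : b ≠ d) (hab : G.Adj a b) (hbc : G.Adj b c) (hcd : G.Adj c d) :
    IsPathUnion G (insert d (insert c (insert b (insert a S)))) := by
  obtain ⟨ι, _, f, h1, h2, h3⟩ := h
  refine ⟨Option ι, inferInstance, fun o => o.elim ![a, b, c, d] f, isPacking_option h1
    (injective_vec4 ⟨hab.ne, hac, had, hbc.ne, hbd, hcd.ne⟩) ⟨hab, hbc, hcd⟩ ?_, ?_, ?_⟩
  · intro j i l hjl
    have := h2 j i
    rw [hjl] at this
    fin_cases l
    exacts [ha this, hb this, hc this, hd this]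
  · rintro (_ | i) j
    · fin_cases j <;> simp
    · simp [h2 i j]
  · rw [Finset.card_insert_of_notMem, Finset.card_insert_of_notMem, Finset.card_insert_of_notMem,
      Finset.card_insert_of_notMem ha, h3, Fintype.card_option]
    · ring
    · simp [hb, hab.ne']
    · simp [hc, hac.symm, hbc.ne']
    · simp [hd, had.symm, hbd.symm, hcd.ne']

theorem Choices.table_zero (c : Choices I) : c.table 0 = I.graph.Adj := rfl

theorem Models.insertS {S : Finset (Fin I.n)} (h : Models 2 { c with S := S } s) (i : Fin I.n) :
    Models 2 { c with S := insert i S } (s.setArr 1 i i 1) := by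
  have hc : ∀ T : Finset (Fin I.n), ∀ a < 1, ({ c with S := S } : Choices I).table a =
      ({ c with S := T } : Choices I).table a := by
    intro T a ha
    interval_cases a
    rw [Choices.table_zero, Choices.table_zero]
  refine (((h.mono (by norm_num : 1 ≤ 2)).congr (hc _)).of_frame le_rfl
    (RamState.frame_setArr _ _ _ _)).succ fun v w => ?_
  rw [RamState.setArr_arr, h.arr 1 (by norm_num)]
  have e1 : ({ c with S := insert i S } : Choices I).table 1 v w ↔ (v = i ∨ v ∈ S) ∧ v = w :=
    and_congr_left' Finset.mem_insert
  have e2 : ({ c with S := S } : Choices I).table 1 v w ↔ v ∈ S ∧ v = w := Iff.rfl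
  simp only [e1, e2, true_and]
  by_cases hvw : v = i ∧ w = i
  · rw [if_pos ⟨congrArg _ hvw.1, congrArg _ hvw.2⟩, if_pos ⟨Or.inl hvw.1, hvw.1.trans hvw.2.symm⟩]
  · rw [if_neg fun h => hvw ⟨Fin.ext h.1, Fin.ext h.2⟩]
    refine if_congr ⟨fun h => ⟨Or.inr h.1, h.2⟩,
      fun h => ⟨h.1.resolve_left fun hv => hvw ⟨hv, ?_⟩, h.2⟩⟩ rfl rfl
    rw [← h.2, hv]

/-- The program that computes a maximal set of disjoint paths. -/
theorem exists_prg_paths : ∃ p : Prg, p.ok 40 = true ∧ ∀ (I : GraphInstance) (c : Choices I)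
    (s : RamState), Models 1 c s → ∃ S, MeetsPaths I.graph S ∧ IsPathUnion I.graph S ∧
      Models 2 { c with S := S } (p.den s) := by
  have hcond : ∃ t : Tm, (∀ (I : GraphInstance) (c : Choices I) (s : RamState), Models 2 c s →
      ∀ x y z w : Fin I.n, s.var 20 = x → s.var 21 = y → s.var 22 = z → s.var 23 = w →
        Dec t s (x ∉ c.S ∧ y ∉ c.S ∧ z ∉ c.S ∧ w ∉ c.S ∧ x ≠ z ∧ x ≠ w ∧ y ≠ w ∧
          I.graph.Adj x y ∧ I.graph.Adj y z ∧ I.graph.Adj z w)) ∧ t.ok 40 = true :=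
    ⟨_, fun I c s h x y z w hx hy hz hw => (h.memS 20 x).not.and ((h.memS 21 y).not.and
      ((h.memS 22 z).not.and ((h.memS 23 w).not.and ((Dec.eqv 20 22 x z).not.and
        ((Dec.eqv 20 23 x w).not.and ((Dec.eqv 21 23 y w).not.and ((h.get 0 20 21 x y).and
          ((h.get 0 21 22 y z).and (h.get 0 22 23 z w))))))))), by rfl⟩
  obtain ⟨t, ht, htok⟩ := hcond
  have hzero : (Tm.const 0).ok 40 = true := by rfl
  let mark : ℕ → Prg := fun x => .store 1 (.var x) (.var x) (.const 1)
  let body : Prg := .ite t (.seq (mark 20) (.seq (mark 21) (.seq (mark 22) (mark 23)))) .skip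
  refine ⟨.seq (.fill 1 (.const 0)) (.loop 20 (.loop 21 (.loop 22 (.loop 23 body)))), ?_,
    fun I c s h => ?_⟩
  · simp only [Prg.ok, Prg.fill_ok hzero, htok, body]
    rfl
  · let Rep : Finset (Fin I.n) → RamState → Prop := fun S s =>
      Models 2 { c with S := S } s ∧ IsPathUnion I.graph S
    -- The quadruple is not a path outside `S`. This persists because `S` only grows, and for all
    -- quadruples together it is the maximality of the family.
    let D : Fin I.n → Fin I.n → Fin I.n → Fin I.n → Finset (Fin I.n) → Prop := fun x y z w S =>
      x ∉ S → y ∉ S → z ∉ S → w ∉ S → x ≠ z → x ≠ w → y ≠ w →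
        I.graph.Adj x y → I.graph.Adj y z → I.graph.Adj z w → False
    let r : Finset (Fin I.n) → Finset (Fin I.n) → Prop := fun S T => S ⊆ T
    have hr : ∀ S, r S S := fun _ => subset_rfl
    have htr : ∀ S T U, r S T → r T U → r S U := fun _ _ _ => LE.le.trans
    have hD : ∀ x y z w S T, r S T → D x y z w S → D x y z w T :=
      fun x y z w S T hST h h1 h2 h3 h4 => h (fun h => h1 (hST h)) (fun h => h2 (hST h))
        (fun h => h3 (hST h)) (fun h => h4 (hST h))
    have hset : ∀ S s y v, 10 ≤ y → Rep S s → Rep S (s.setVar y v) :=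
      fun S s y v hy h => ⟨h.1.setVar hy v, h.2⟩
    have hn : ∀ S s, Rep S s → s.var 2 = I.n := fun _ _ h => h.1.size
    have hbody : ∀ (x y z w : Fin I.n) S s, Rep S s → s.var 20 = x → s.var 21 = y → s.var 22 = z →
        s.var 23 = w → ∃ S', r S S' ∧ Rep S' (body.den s) ∧ D x y z w S' := by
      intro x y z w S s hs hx hy hz hw
      have h0 := (ht I _ s hs.1 x y z w hx hy hz hw).eval_eq_zero
      simp only [body, Prg.den]
      split_ifs with hif
      · exact ⟨S, hr S, hs, fun h1 h2 h3 h4 h5 h6 h7 h8 h9 h10 => h0.1 hif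
          ⟨h1, h2, h3, h4, h5, h6, h7, h8, h9, h10⟩⟩
      · obtain ⟨h1, h2, h3, h4, h5, h6, h7, h8, h9, h10⟩ := not_not.1 (fun h => hif (h0.2 h))
        refine ⟨insert w (insert z (insert y (insert x S))), fun v hv => by simp [hv], ⟨?_,
          hs.2.insert h1 h2 h3 h4 h5 h6 h7 h8 h9 h10⟩, fun h => absurd (by simp) h⟩
        have h11 := (((hs.1.insertS x).insertS y).insertS z).insertS w
        simpa only [mark, Prg.den, Tm.eval, RamState.setArr_var, hx, hy, hz, hw] using h11
    have h1 := h.fill (a := 1) (t := .const 0) (R := fun _ _ => False) le_rfl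
      (fun s' _ _ _ _ _ _ => by simp [Dec, Tm.eval])
    have h2 : Rep ∅ ((Prg.fill 1 (.const 0)).den s) := by
      refine ⟨(h1.1.congr fun a ha => ?_).succ fun i j => ?_, Empty, inferInstance, Empty.elim,
        ⟨fun i => i.elim, fun i => i.elim⟩, fun i => i.elim, by simp⟩
      · interval_cases a
        rw [Choices.table_zero, Choices.table_zero]
      · rw [h1.2]
        simp [Choices.table]
    obtain ⟨S, -, h3, h4⟩ := Prg.loop_progress (n := I.n) hr htr hn hset
      (D := fun x S => ∀ y z w, D x y z w S) (fun x S T h1 h2 y z w => hD x y z w S T h1 (h2 y z w))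
      (l := []) (e := fun _ => 0) (y := 20) (by norm_num) (by simp)
      (p := .loop 21 (.loop 22 (.loop 23 body))) (by simp)
      (by
        intro x S s hS _ hx
        refine Prg.loop_progress (n := I.n) hr htr hn hset (D := fun y S => ∀ z w, D x y z w S)
          (fun y S T h1 h2 z w => hD x y z w S T h1 (h2 z w))
          (l := [20]) (e := fun _ => x) (y := 21) (by norm_num) (by simp)
          (by simp [body, mark, Prg.writes]) ?_ S s hS (by simpa using hx)
        intro y S s hS hl hy
        refine Prg.loop_progress (n := I.n) hr htr hn hset (D := fun z S => ∀ w, D x y z w S)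
          (fun z S T h1 h2 w => hD x y z w S T h1 (h2 w))
          (l := [20, 21]) (e := fun v => if v = 20 then x else y) (y := 22) (by norm_num) (by simp)
          (by simp [body, mark, Prg.writes]) ?_ S s hS (by simpa [hy] using hl)
        intro z S s hS hl hz
        refine Prg.loop_progress (n := I.n) hr htr hn hset (D := fun w S => D x y z w S)
          (fun w S T h1 h2 => hD x y z w S T h1 h2)
          (l := [20, 21, 22]) (e := fun v => if v = 20 then x else if v = 21 then y else z) (y := 23)
          (by norm_num) (by simp) (by simp [body, mark, Prg.writes]) ?_ S s hS
          (by simpa [hz] using hl)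
        intro w S s hS hl hw
        simp only [List.mem_cons, List.not_mem_nil, or_false, forall_eq_or_imp, forall_eq] at hl
        exact hbody x y z w S s hS (by simpa using hl.1) (by simpa using hl.2.1)
          (by simpa using hl.2.2) hw)
      _ _ h2 (by simp)
    exact ⟨S, fun x y z w h1 h2 h3 h5 h6 h7 h8 => h4 x y z w h1 h2 h3 h5 h6 h7 h8, h3.2, h3.1⟩

end Searches


/-! ### Dropping the isolated vertices -/

section Relabeling

open scoped Classical

variable {n : ℕ} (F : SimpleGraph (Fin n))

/-- The vertices that are not isolated. -/
noncomputable def support : Finset (Fin n) := Finset.univ.filter fun u => ∃ w, F.Adj u w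

/-- The list of the non-isolated vertices. -/
noncomputable def supportEmb : Fin (support F).card ↪o Fin n := (support F).orderEmbOfFin rfl

variable {F}

theorem exists_supportEmb {u w : Fin n} (h : F.Adj u w) : ∃ i, supportEmb F i = u := by
  have h1 : u ∈ Set.range (supportEmb F) := by
    rw [supportEmb, Finset.range_orderEmbOfFin]
    simp only [support, Finset.coe_filter, Finset.mem_univ, true_and, Set.mem_ofPred_eq]
    exact ⟨w, h⟩
  exact h1

/-- The enumeration is increasing, so the new name of a vertex is the number of non-isolated
vertices before it, which a program finds by counting. -/
theorem card_lt_supportEmb (i : Fin (support F).card) :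
    (Finset.univ.filter fun u => u < supportEmb F i ∧ ∃ w, F.Adj u w).card = i := by
  have h1 : (Finset.univ.filter fun u => u < supportEmb F i ∧ ∃ w, F.Adj u w) =
      (Finset.Iio i).map (supportEmb F).toEmbedding := by
    ext u
    simp only [Finset.mem_filter, Finset.mem_univ, true_and, Finset.mem_map, Finset.mem_Iio,
      RelEmbedding.coe_toEmbedding]
    constructor
    · rintro ⟨h1, w, h2⟩
      obtain ⟨j, rfl⟩ := exists_supportEmb h2
      exact ⟨j, (supportEmb F).lt_iff_lt.1 h1, rfl⟩
    · rintro ⟨j, h1, rfl⟩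
      refine ⟨(supportEmb F).lt_iff_lt.2 h1, ?_⟩
      have h2 : supportEmb F j ∈ support F := Finset.orderEmbOfFin_mem _ _ _
      exact (Finset.mem_filter.1 h2).2
  rw [h1, Finset.card_map, Fin.card_Iio]

theorem hasPacking_comap_supportEmb_iff {k : ℕ} :
    HasPacking (F.comap (supportEmb F)) k ↔ HasPacking F k := by
  constructor
  · rintro ⟨f, hf⟩
    exact ⟨fun i c => supportEmb F (f i c), fun i j c d h =>
      hf.inj i j c d ((supportEmb F).injective h), hf.path⟩
  · rintro ⟨f, hf⟩
    have h1 : ∀ i c, ∃ u, supportEmb F u = f i c := fun i c => by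
      obtain ⟨v, hv⟩ := hf.exists_adj i c
      exact exists_supportEmb hv
    choose g hg using h1
    refine ⟨g, fun i j c d h => hf.inj i j c d (by rw [← hg, ← hg, h]), fun i => ?_⟩
    have := hf.path i
    simpa only [IsPath4, SimpleGraph.comap_adj, hg] using this

theorem ncard_edgeSet_comap_supportEmb_le :
    (F.comap (supportEmb F)).edgeSet.ncard ≤ F.edgeSet.ncard := by
  refine Set.ncard_le_ncard_of_injOn (Sym2.map (supportEmb F)) ?_
    (Sym2.map.injective (supportEmb F).injective).injOn (Set.toFinite _)
  intro z
  refine Sym2.ind (fun x y h => ?_) z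
  exact h

theorem card_support_le : (support F).card ≤ 2 * F.edgeSet.ncard := by
  have h1 : F.edgeSet.ncard = F.edgeFinset.card := by
    rw [Set.ncard_eq_toFinset_card', SimpleGraph.edgeFinset]
  rw [h1, ← F.sum_degrees_eq_twice_card_edges, support, Finset.card_filter]
  refine Finset.sum_le_sum fun v _ => ?_
  split_ifs with h
  · obtain ⟨w, hw⟩ := h
    exact (F.degree_pos_iff_exists_adj v).2 ⟨w, hw⟩
  · exact Nat.zero_le _

end Relabeling

/-! ### Writing the kernel out, and computing the root -/

section Output

open scoped Classical

variable {I : GraphInstance} {c : Choices I} {s : RamState}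

/-- The instance that the algorithm outputs if it does not find an answer. -/
noncomputable def Choices.kernel (c : Choices I) : GraphInstance :=
  ⟨(support c.finalGraph).card, c.finalGraph.comap (supportEmb c.finalGraph),
    I.k - (rich I.graph c.S I.k).card⟩

theorem Choices.kernel_n_le : c.kernel.n ≤ I.n := by
  have h := (support c.finalGraph).card_le_univ
  rwa [Fintype.card_fin] at h

/-- Ends of an edge are listed by `supportEmb`, and on listed vertices `rank` is its inverse.
Isolated vertices may share a rank with others, but no edge brings them into play. -/
theorem Choices.table_relabeled {u v : Fin c.kernel.n} :
    c.table 19 (Fin.castLE c.kernel_n_le u) (Fin.castLE c.kernel_n_le v) ↔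
      c.kernel.graph.Adj u v := by
  have h : ∀ i : Fin c.kernel.n, c.rank (supportEmb c.finalGraph i) = i := fun i =>
    card_lt_supportEmb i
  constructor
  · rintro ⟨x, y, h1, h2, h3⟩
    obtain ⟨i, rfl⟩ := exists_supportEmb h1
    obtain ⟨j, rfl⟩ := exists_supportEmb h1.symm
    have e1 : i = u := Fin.ext ((h i).symm.trans h2)
    have e2 : j = v := Fin.ext ((h j).symm.trans h3)
    rw [← e1, ← e2]
    exact h1
  · intro h1
    exact ⟨_, _, h1, h u, h v⟩

/-- The program that outputs the kernel. -/
theorem exists_prg_output : ∃ p : Prg, p.ok 40 = true ∧ ∀ (I : GraphInstance) (c : Choices I)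
    (s : RamState), Models 20 c s → (p.den s).Outputs c.kernel := by
  have hcopy : (Tm.get 19 (.var 10) (.var 11)).ok 40 = true := by rfl
  -- Variables 0 and 1 may be overwritten first: the bound `n` is still in variable 2, and the
  -- relabeled matrix is already complete in array 19.
  refine ⟨.seq (.assign 0 (.sum 30 (.get 17 (.var 30) (.var 30))))
    (.seq (.assign 1 (.sub (.var 1) (.sum 30 (.get 5 (.var 30) (.var 30)))))
      (.fill 0 (.get 19 (.var 10) (.var 11)))), ?_, fun I c s h => ?_⟩
  · simp only [Prg.ok, Prg.fill_ok hcopy]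
    rfl
  · have hn := h.size
    have h1 : (Tm.sum 30 (.get 17 (.var 30) (.var 30))).eval s = c.kernel.n :=
      Dec.count 30 fun v => h.get 17 30 30 v v
    simp only [Prg.den]
    rw [h1]
    set s₁ := s.setVar 0 c.kernel.n with hs₁
    have hn₁ : s₁.var 2 = I.n := by rw [hs₁, RamState.setVar_var, if_neg (by norm_num), hn]
    have h2 : (Tm.sub (.var 1) (.sum 30 (.get 5 (.var 30) (.var 30)))).eval s₁ = c.kernel.k := by
      have h3 : Val (.sub (.var 1) (.sum 30 (.get 5 (.var 30) (.var 30)))) s₁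
          (I.k - (Finset.univ.filter fun v => v ∈ rich I.graph c.S I.k).card) :=
        h.valK.sub (Dec.count 30 fun v => h.get 5 30 30 v v)
      rwa [Finset.filter_univ_mem] at h3
    rw [h2]
    set s₂ := s₁.setVar 1 c.kernel.k with hs₂
    have hn₂ : s₂.var 2 = I.n := by rw [hs₂, RamState.setVar_var, if_neg (by norm_num), hn₁]
    have h3 := Prg.fill_den (a := 0) (t := .get 19 (.var 10) (.var 11))
      (f := fun i j => if c.table 19 i j then 1 else 0) hn₂ (by
        intro s' hs' i j hi hj
        simp only [Tm.eval, hi, hj, hs'.1 19 (by norm_num)]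
        exact h.arr 19 (by norm_num) i j)
    refine ⟨?_, ?_, fun u v => ?_⟩
    · rw [h3.1.2 0 (by norm_num)]
      simp [hs₂, hs₁, RamState.setVar_var]
    · rw [h3.1.2 1 (by norm_num)]
      simp [hs₂, RamState.setVar_var]
    · have h4 := h3.2 (Fin.castLE c.kernel_n_le u) (Fin.castLE c.kernel_n_le v)
      simp only [Choices.table_relabeled, Fin.val_castLE] at h4
      rw [h4]
      exact ⟨fun h => if_pos h, fun h => if_neg h⟩

theorem Val.sum {n : ℕ} {t : Tm} {f : Fin n → ℕ} (x : ℕ)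
    (h : ∀ v : Fin n, Val t (s.setVar x v) (f v))
    (hn : s.var 2 = n := by assumption) : Val (.sum x t) s (∑ v, f v) := by
  rw [Val, Tm.eval, hn, Finset.sum_range]
  exact Finset.sum_congr rfl fun v _ => h v

/-- Terms have no product, so the square is obtained as a count of pairs. -/
theorem sum_card_lt_lt {n : ℕ} (i : Fin n) :
    ∑ j : Fin n, (Finset.univ.filter fun l : Fin n => j < i ∧ l < i).card = i * i := by
  have h1 : ∀ j : Fin n, (Finset.univ.filter fun l : Fin n => j < i ∧ l < i).card =
      if j < i then (i : ℕ) else 0 := by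
    intro j
    split_ifs with h
    · simp only [h, true_and]
      rw [show (Finset.univ.filter fun l : Fin n => l < i) = Finset.Iio i by ext; simp, Fin.card_Iio]
    · simp [h]
  rw [Finset.sum_congr rfl fun j _ => h1 j, ← Finset.sum_filter, Finset.sum_const,
    show (Finset.univ.filter fun l : Fin n => l < i) = Finset.Iio i by ext; simp, Fin.card_Iio,
    smul_eq_mul]

/-- The numbers counted are `0` up to `Nat.sqrt k`, all below `n`; counting from zero yields the
added one in `root`. -/
theorem card_mul_self_le {n k : ℕ} (h : k < n) :
    (Finset.univ.filter fun i : Fin n => (i : ℕ) * i ≤ k).card = root k := by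
  have h1 : Nat.sqrt k < n := (Nat.sqrt_le_self k).trans_lt h
  have h2 : (Finset.univ.filter fun i : Fin n => (i : ℕ) * i ≤ k) =
      Finset.Iic (⟨Nat.sqrt k, h1⟩ : Fin n) := by
    ext i
    simp only [Finset.mem_filter, Finset.mem_univ, true_and, Finset.mem_Iic, ← Nat.le_sqrt]
    rfl
  rw [h2, Fin.card_Iic, root]

/-- The term that computes the root. -/
theorem exists_tm_root : ∃ t : Tm, (∀ (I : GraphInstance) (s : RamState), I.k < I.n →
    s.var 1 = I.k → s.var 2 = I.n → Val t s (root I.k)) ∧ t.ok 40 = true :=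
  ⟨_, fun I s h hk hn => by
    rw [← card_mul_self_le h]
    simp only [← sum_card_lt_lt]
    exact Dec.count 30 fun i => (Val.sum 31 fun j => Dec.count 32 fun l =>
      (Dec.ltv 31 30 j i).and (Dec.ltv 32 30 l i)).le (Val.var (x := 1) hk), by rfl⟩

end Output


/-! ### Assembly of the algorithm and its trivial cases -/

section Algorithm

open scoped Classical

/-- The instance `J` is a kernel for `I`. -/
structure IsKernel (I J : GraphInstance) : Prop where
  equiv : HasPacking J.graph J.k ↔ HasPacking I.graph I.k
  edges : J.numEdges ≤ 2760 * (I.k ^ 2 * root I.k)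
  vertices : J.n ≤ 2 * (2760 * (I.k ^ 2 * root I.k))
  n_le : J.n ≤ I.n
  k_le : J.k ≤ I.k

theorem lt_root_sq (k : ℕ) : k < root k ^ 2 := Nat.lt_succ_sqrt' k

/-- The program that computes the kernel from a maximal set of disjoint paths. -/
theorem exists_prg_kernel : ∃ p : Prg, p.ok 40 = true ∧ ∀ (I : GraphInstance) (c : Choices I)
    (s : RamState), Models 2 c s → MeetsPaths I.graph c.S → c.S.card ≤ 4 * I.k → 1 ≤ I.k →
      ∃ J, (p.den s).Outputs J ∧ IsKernel I J := by
  obtain ⟨p₁, ok₁, h₁⟩ := reaches_reduced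
  obtain ⟨p₂, ok₂, h₂⟩ := exists_prg_owner
  obtain ⟨p₃, ok₃, h₃⟩ := reaches_dense
  obtain ⟨p₄, ok₄, h₄⟩ := exists_prg_links
  obtain ⟨p₅, ok₅, h₅⟩ := reaches_relabeled
  obtain ⟨p₆, ok₆, h₆⟩ := exists_prg_output
  refine ⟨.seq p₁ (.seq p₂ (.seq p₃ (.seq p₄ (.seq p₅ p₆)))),
    by simp [Prg.ok, ok₁, ok₂, ok₃, ok₄, ok₅, ok₆], fun I c s h hP hS hk => ?_⟩
  obtain ⟨owner, hown, h'⟩ := h₂ I c _ (h₁ I c s h)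
  have h'' := h₆ I _ _ (h₅ I _ _ (h₄ I _ _ (h₃ I _ _ h')))
  have hedges := ncard_edgeSet_kernelGraph_le le_total hP hS hown (lt_root_sq _) hk
  refine ⟨_, h'', ?_, ?_, ?_, Choices.kernel_n_le, Nat.sub_le _ _⟩
  · exact hasPacking_comap_supportEmb_iff.trans (hasPacking_kernelGraph_iff hP hown (lt_root_sq _))
  · exact ncard_edgeSet_comap_supportEmb_le.trans hedges
  · exact card_support_le.trans (Nat.mul_le_mul_left 2 hedges)

/-- An instance without vertices. -/
def trivialInstance (k : ℕ) : GraphInstance := ⟨0, ⊥, k⟩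

theorem isKernel_trivialInstance {I : GraphInstance} {k : ℕ} (hk : k ≤ I.k)
    (h : HasPacking (⊥ : SimpleGraph (Fin 0)) k ↔ HasPacking I.graph I.k) :
    IsKernel I (trivialInstance k) where
  equiv := h
  edges := by
    have : (trivialInstance k).numEdges = 0 := by simp [trivialInstance, GraphInstance.numEdges]
    rw [this]
    exact Nat.zero_le _
  vertices := Nat.zero_le _
  n_le := Nat.zero_le _
  k_le := hk

theorem outputs_trivialInstance {s : RamState} {k : ℕ} :
    ((Prg.seq (.assign 0 (.const 0)) (.assign 1 (.const k))).den s).Outputs (trivialInstance k) := by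
  refine ⟨?_, ?_, fun u => Fin.elim0 u⟩ <;>
    simp [Prg.den, RamState.setVar_var, Tm.eval, trivialInstance]

theorem HasPacking.four_mul_le {n k : ℕ} {G : SimpleGraph (Fin n)} (h : HasPacking G k) :
    4 * k ≤ n := by
  obtain ⟨f, hf⟩ := h
  have h1 := (usedBy f).card_le_univ
  rwa [card_usedBy hf, Fintype.card_fin, Fintype.card_fin] at h1

theorem IsPathUnion.hasPacking {V : Type*} {G : SimpleGraph V} {S : Finset V}
    (h : IsPathUnion G S) {k : ℕ} (hk : 4 * k ≤ S.card) : HasPacking G k := by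
  obtain ⟨ι, _, f, h1, -, h3⟩ := h
  exact h1.hasPacking (by omega)

/-- The kernelization algorithm. -/
theorem exists_prg_kernelization : ∃ p : Prg, p.ok 40 = true ∧ ∀ (I : GraphInstance)
    (s : RamState), s.var 1 = I.k → s.var 2 = I.n →
      (∀ i j : Fin I.n, s.arr 0 i j = if I.graph.Adj i j then 1 else 0) →
      ∃ J, (p.den s).Outputs J ∧ IsKernel I J := by
  obtain ⟨t, ht, okt⟩ := exists_tm_root
  obtain ⟨p, okp, hp⟩ := exists_prg_paths
  obtain ⟨q, okq, hq⟩ := exists_prg_kernel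
  let out : ℕ → Prg := fun k => .seq (.assign 0 (.const 0)) (.assign 1 (.const k))
  let large : Tm := ((Tm.var 1).times 4).le (.sum 30 (.get 1 (.var 30) (.var 30)))
  -- The empty graph is a positive instance with parameter `0` and a negative one with parameter
  -- `1`. The test `4 * k ≤ n` settles graphs with too few vertices and also secures `k < n`, which
  -- the computation of the root needs.
  refine ⟨.ite (.var 1) (.ite (((Tm.var 1).times 4).le (.var 2)) (.seq (.assign 3 t) (.seq p
    (.ite large (out 0) q))) (out 1)) (out 0), ?_, fun I s hk hn harr => ?_⟩
  · simp only [Prg.ok, okt, okp, okq, out, large]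
    rfl
  · have h0 : ((Tm.var 1).times 4 |>.le (.var 2)).eval s = 0 ↔ ¬ 4 * I.k ≤ I.n :=
      (((Val.var hk).times 4).le (Val.var hn)).eval_eq_zero
    have e1 : (Tm.var 1).eval s = I.k := hk
    rw [Prg.den, e1]
    split_ifs with hk0
    · refine ⟨_, outputs_trivialInstance, isKernel_trivialInstance (Nat.zero_le _) ?_⟩
      rw [hk0]
      exact ⟨fun _ => hasPacking_zero, fun _ => hasPacking_zero⟩
    rw [Prg.den]
    split_ifs with hkn
    · refine ⟨_, outputs_trivialInstance, isKernel_trivialInstance (by omega) ⟨fun ⟨f, _⟩ => ?_,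
        fun h => absurd h.four_mul_le (h0.1 hkn)⟩⟩
      exact (f 0 0).elim0
    have hkn' : 4 * I.k ≤ I.n := not_not.1 fun h => hkn (h0.2 h)
    have e3 : t.eval s = root I.k := ht I s (by omega) hk hn
    have h1 : Models 1 (⟨∅, fun _ => none, fun _ => ∅⟩ : Choices I) (s.setVar 3 (t.eval s)) := by
      refine ⟨?_, ?_, ?_, fun a ha i j => ?_⟩
      · rw [RamState.setVar_var, if_neg (by norm_num), hk]
      · rw [RamState.setVar_var, if_neg (by norm_num), hn]
      · rw [RamState.setVar_var, if_pos rfl, e3]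
      · obtain rfl : a = 0 := by omega
        exact harr i j
    obtain ⟨S, hP, hU, h2⟩ := hp I _ _ h1
    have hn2 := h2.size
    have h3 : Dec large (p.den (s.setVar 3 (t.eval s)))
        (4 * I.k ≤ (Finset.univ.filter fun v => v ∈ S).card) :=
      (h2.valK.times 4).le (Dec.count 30 fun v => h2.memS 30 v)
    rw [Finset.filter_univ_mem] at h3
    rw [Prg.den, Prg.den, Prg.den, Prg.den]
    split_ifs with hl
    · exact hq I _ _ h2 hP (not_le.1 (h3.eval_eq_zero.1 hl)).le (by omega)
    · refine ⟨_, outputs_trivialInstance, isKernel_trivialInstance (Nat.zero_le _)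
        ⟨fun _ => hU.hasPacking ?_, fun _ => hasPacking_zero⟩⟩
      exact not_not.1 fun h => hl (h3.eval_eq_zero.2 h)

end Algorithm

/-! ### Size, running time and the exponent -/

theorem Polynomial.eval_mono_nat (P : Polynomial ℕ) {m n : ℕ} (h : m ≤ n) :
    P.eval m ≤ P.eval n := by
  rw [Polynomial.eval_eq_sum_range, Polynomial.eval_eq_sum_range]
  exact Finset.sum_le_sum fun i _ => Nat.mul_le_mul_left _ (Nat.pow_le_pow_left h i)

theorem IsKernel.size_le {I J : GraphInstance} (h : IsKernel I J) : J.size ≤ I.size :=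
  add_le_add (Nat.pow_le_pow_left h.n_le 2) (Nat.size_le_size h.k_le)

theorem GraphInstance.n_le_size (I : GraphInstance) : I.n ≤ I.size :=
  (Nat.le_self_pow two_ne_zero _).trans (Nat.le_add_right _ _)

/-- For positive `k` the added one in `root k` is at most the real square root of `k`, which costs a
factor of two. -/
theorem sq_mul_root_le (k : ℕ) (hk : 1 ≤ k) :
    ((k ^ 2 * root k : ℕ) : ℝ) ≤ 2 * (k : ℝ) ^ (5 / 2 : ℝ) := by
  have hk' : (1 : ℝ) ≤ k := by exact_mod_cast hk
  have h1 : (k : ℝ) ^ (5 / 2 : ℝ) = (k : ℝ) ^ 2 * Real.sqrt k := by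
    rw [Real.sqrt_eq_rpow, ← Real.rpow_natCast, ← Real.rpow_add (by linarith)]
    norm_num
  have h2 : ((Nat.sqrt k : ℕ) : ℝ) ≤ Real.sqrt k := Real.nat_sqrt_le_real_sqrt
  have h3 : (1 : ℝ) ≤ Real.sqrt k := Real.one_le_sqrt.2 hk'
  rw [h1, root]
  push_cast
  nlinarith [mul_le_mul_of_nonneg_left (add_le_add h2 h3) (sq_nonneg (k : ℝ))]

/-- The problem of finding `k` vertex-disjoint paths with three edges each has kernels with
`O(k ^ 2.5)` edges. -/
theorem theorem5 :
    ∃ C : ℝ, HasKernelsWithEdges (GraphMatchingProblem (pathWithEdges 3))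
      (fun k : ℕ => C * (k : ℝ) ^ (5 / 2 : ℝ)) := by
  obtain ⟨p, okp, hp⟩ := exists_prg_kernelization
  -- The constant is `2 * 2760`. In the time bound, `2` pays for copying `n` to variable 2 and `X`
  -- for writing the output, which is no larger than the input. In the size bound, the square covers
  -- the adjacency matrix, with at most two vertices per edge, and `k` covers the digits of the
  -- parameter.
  refine ⟨5520, .seq (.assign 2 (.var 0)) (p.code 40), p.cost + Polynomial.X + 2,
    fun k => (5520 * (k ^ 2 * root k)) ^ 2 + k, fun I => ?_⟩
  set s := I.input.setVar 2 I.n with hs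
  obtain ⟨J, hJ, hker⟩ := hp I s rfl rfl (by
    intro i j
    by_cases h : I.graph.Adj i j
    · rw [if_pos h]
      exact if_pos ⟨rfl, i.2, j.2, h⟩
    · rw [if_neg h]
      exact if_neg fun ⟨_, _, _, h'⟩ => h h')
  obtain ⟨T, s', h1, h2, h3⟩ := p.code_runs (by norm_num) okp (RamState.Agree.refl (b := 40) (s := s))
  have hn : s.var 2 = I.n := rfl
  refine ⟨J, ⟨_, s', .seq (.assign _ _ _) h1, ⟨?_, ?_, ?_⟩, ?_⟩, ?_, ?_, ?_, ?_⟩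
  · rw [h3.2 0 (by norm_num), hJ.1]
  · rw [h3.2 1 (by norm_num), hJ.2.1]
  · rw [h3.1]
    exact hJ.2.2
  · rw [hn] at h2
    have h4 := p.cost.eval_mono_nat I.n_le_size
    have h5 := hker.size_le
    simp only [RamExp.cost, Polynomial.eval_add, Polynomial.eval_X, Polynomial.eval_ofNat]
    omega
  · rw [mem_graphMatchingProblem_iff, mem_graphMatchingProblem_iff]
    exact hker.equiv
  · refine add_le_add (Nat.pow_le_pow_left (hker.vertices.trans (by omega)) 2) ?_
    exact (Nat.size_le_size hker.k_le).trans (Nat.size_le.2 Nat.lt_two_pow_self)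
  · exact hker.k_le.trans (Nat.le_add_left _ _)
  · have h4 : (J.numEdges : ℝ) ≤ 2760 * ((I.k ^ 2 * root I.k : ℕ) : ℝ) := by
      exact_mod_cast hker.edges
    -- The estimate for the root needs a positive parameter; for parameter zero both sides vanish.
    rcases Nat.eq_zero_or_pos I.k with h0 | h0
    · rw [h0] at h4 ⊢
      simpa using h4
    · have h5 := sq_mul_root_le I.k h0
      dsimp only
      linarith
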